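/- **Theorem 3.2.** There is an absolute constant $C>0$ such that the following holds. Let $\mathcal G=(\mathcal V,\mathcal E)$ be a finite simple graph with $n=|\mathcal V|$ vertices and maximal degree $\Delta$, put $d=\max(\Delta,1)$, and let $\{X_i\}_{i\in\mathcal V}$ be real random variables on a common probability space with $E X_i=0$ and $E|X_i|^3<\infty$ for all $i$. Suppose that $\mathcal G$ is a dependency graph for $\{X_i\}$: for any disjoint $\Gamma_1,\Gamma_2\subset\mathcal V$ such that no edge has one endpoint in $\Gamma_1$ and the other in $\Gamma_2$, the families $\{X_i:i\in\Gamma_1\}$ and $\{X_j:j\in\Gamma_2\}$ are independent. For $i\in\mathcal V$ let $A_i=\{i\}\cup\{j\in\mathcal V:\{i,j\}\in\mathcal E\}$ and $Y_i=\sum_{j\in A_i}X_j$, and put $$S=\sum_{i\in\mathcal V}X_i,\quad \bar X=\frac1n\sum_{i\in\mathcal V}X_i,\quad \bar Y=\frac1n\sum_{i\in\mathcal V}Y_i,\quad V=\sqrt{\Bigl(\sum_{i\in\mathcal V}(X_iY_i-\bar X\bar Y)\Bigr)_+},\quad W=\frac SV,$$ where $(x)_+=\max(x,0)$ and $W=0$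 where $V=0$. Assume $\sigma^2=\sum_{i\in\mathcal V}E\{X_iY_i\}>0$ (with $\sigma>0$), and let $\gamma=\sum_{i\in\mathcal V}E|X_i/\sigma|^3$. Then $$\sup_{z\in\mathbb R}\bigl|P(W\le z)-\Phi(z)\bigr|\le C\,d^{9}\bigl(1+d^{6}n^{1/3}\gamma^{2/3}\bigr)\bigl(n^{-1/2}+\gamma\bigr),$$ where $\Phi$ is the standard normal distribution function. -/

import Mathlib

open MeasureTheory ProbabilityTheory

namespace GraphDep

variable {V Ω : Type*}

/-- `G` is a dependency graph for the field `X`: for any two disjoint sets of vertices with no edge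
of `G` between them, the two corresponding families of random variables are independent. -/
def IsDependencyGraph [MeasurableSpace Ω] (P : Measure Ω) (G : SimpleGraph V)
    (X : V → Ω → ℝ) : Prop :=
  ∀ Γ₁ Γ₂ : Set V, Disjoint Γ₁ Γ₂ → (∀ i ∈ Γ₁, ∀ j ∈ Γ₂, ¬ G.Adj i j) →
    IndepFun (fun ω (i : Γ₁) => X i ω) (fun ω (j : Γ₂) => X j ω) P

variable [Fintype V]

/-- `S = ∑ i, X i`. -/
def sumS (X : V → Ω → ℝ) (ω : Ω) : ℝ := ∑ i, X i ω

variable [DecidableEq V]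

/-- The neighbourhood `A i` of the vertex `i`, consisting of `i` itself and all vertices joined
to `i` by an edge. -/
def nbhd (G : SimpleGraph V) [DecidableRel G.Adj] (i : V) : Finset V :=
  insert i (G.neighborFinset i)

/-- `Y i = ∑ j ∈ A i, X j`. -/
def sumY (G : SimpleGraph V) [DecidableRel G.Adj] (X : V → Ω → ℝ) (i : V) (ω : Ω) : ℝ :=
  ∑ j ∈ nbhd G i, X j ω

/-- The average over the index set, at the outcome `ω`. -/
noncomputable def avg (Z : V → Ω → ℝ) (ω : Ω) : ℝ := (∑ i, Z i ω) / (Fintype.card V : ℝ)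

/-- The self-normalizer, the square root of the positive part of
`∑ i, (X i * Y i - avg X * avg Y)`. -/
noncomputable def normV (G : SimpleGraph V) [DecidableRel G.Adj] (X : V → Ω → ℝ) (ω : Ω) : ℝ :=
  Real.sqrt (max (∑ i, (X i ω * sumY G X i ω - avg X ω * avg (sumY G X) ω)) 0)

/-- The self-normalized sum `S / V` (with value `0` where the self-normalizer vanishes). -/
noncomputable def statW (G : SimpleGraph V) [DecidableRel G.Adj] (X : V → Ω → ℝ) (ω : Ω) : ℝ :=
  sumS X ω / normV G X ω

variable [MeasurableSpace Ω]

/-- `σ² = ∑ i, E[X i * Y i]`. -/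
noncomputable def sigmaSq (P : Measure Ω) (G : SimpleGraph V) [DecidableRel G.Adj]
    (X : V → Ω → ℝ) : ℝ :=
  ∑ i, ∫ ω, X i ω * sumY G X i ω ∂P

/-- `γ = ∑ i, E |X i / σ| ^ 3`, where `σ` is the square root of `sigmaSq`. -/
noncomputable def gamma (P : Measure Ω) (G : SimpleGraph V) [DecidableRel G.Adj]
    (X : V → Ω → ℝ) : ℝ :=
  ∑ i, ∫ ω, |X i ω / Real.sqrt (sigmaSq P G X)| ^ 3 ∂P

end GraphDep

open MeasureTheory ProbabilityTheory

set_option linter.unusedSectionVars false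

/-! Divide by σ, so that the variance is 1, and write β = D⁶κ³, where D bounds the closed
neighbourhoods and κ³ bounds the sum of the third absolute moments (`NormalizedField`). The
uncentred form Q = ∑ XᵢYᵢ has mean 1, and truncation at level 1 shows that its deviations beyond 1/8
have expectation O(β) (`integral_crossSum_dev_le`). It therefore costs only O(β) to replace √Q by
the root c of Q cut off to [1/4, 4], and the main object is U = S/c (`cutStat`).

U is compared with the normal law by Stein's method, with a ramp of width α = 64β in place of the
indicator of (-∞, z]. In E U f(U) = ∑ E Xᵢ f(U)/c the neighbourhood of i is removed from both S and
Q. The reduced statistic is independent of the centred Xᵢ, so its term vanishes, and the first-order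
term reproduces f'(U)Q/c². The remainders are products of three nearby variables, bounded by third
moments, and an increment of the ramp divided by α. The increment is harmless once the shifted
statistic S - zc lies in an interval of length O(α) with probability O(α), conditionally on the
variables near i.

This conditional concentration is the core of the proof. Let f be the primitive of a tent around the
interval and A an event depending on the variables in M. Expand E 1_A (∑ Xᵢ) f(S - zc) over the
vertices i far from M. The left side is O(α)P(A); the main term is at least P(A, interval)/4 up to
O(α)P(A). The error is again a concentration probability, now conditional on M and a ball around i.
Thus a bound c for the larger sets gives 17α + c/4 for M (`concentration_step`). Starting from the
trivial bound 1 and iterating about κ^(-1/2) times makes the contribution of the starting value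
O(κ³). Conditional concentration enters the error terms through `integral_mul_overlap_le`: an
increment over a random interval is bounded by a length of overlap, which Tonelli turns into an
integral of conditional probabilities.

The recursion needs |z|β small. Other z are covered by monotonicity and Gaussian tails, giving O(β)
uniformly for U. Finally V² = Q - S·T/n with T = ∑ Yᵢ, and truncating S at n^(1/12) and T at a
multiple of n^(1/4) bounds the effect of the centring. The second moments that enter there satisfy ∑
E Xᵢ² ≤ n^(1/3)κ², whence the factor n^(1/3)γ^(2/3). -/

namespace GraphDep

/-! ### σ-algebras generated by subfamilies -/

section SigmaAlgebras

variable {V Ω : Type*}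

/-- The `σ`-algebra generated by the variables `X i` with `i ∈ M`. -/
abbrev sigAlg (X : V → Ω → ℝ) (M : Set V) : MeasurableSpace Ω :=
  MeasurableSpace.comap (fun ω (i : M) => X i ω) inferInstance

theorem measurable_sigAlg_apply (X : V → Ω → ℝ) {M : Set V} {i : V} (hi : i ∈ M) :
    Measurable[sigAlg X M] (X i) :=
  (measurable_pi_apply (⟨i, hi⟩ : M)).comp
    (comap_measurable (fun ω (i : M) => X i ω))

theorem sigAlg_mono (X : V → Ω → ℝ) {M N : Set V} (h : M ⊆ N) : sigAlg X M ≤ sigAlg X N := by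
  have h1 : (fun ω (i : M) => X i ω) =
      (fun (x : N → ℝ) (i : M) => x ⟨i, h i.2⟩) ∘ (fun ω (i : N) => X i ω) := rfl
  have h2 : Measurable (fun (x : N → ℝ) (i : M) => x ⟨i, h i.2⟩) :=
    measurable_pi_lambda _ fun i => measurable_pi_apply _
  unfold sigAlg
  rw [h1, ← MeasurableSpace.comap_comp]
  exact MeasurableSpace.comap_mono h2.comap_le

theorem sigAlg_le [m : MeasurableSpace Ω] {X : V → Ω → ℝ} (hX : ∀ i, Measurable (X i))
    (M : Set V) : sigAlg X M ≤ m :=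
  Measurable.comap_le (f := fun ω (i : M) => X i ω) (measurable_pi_lambda _ fun i => hX i)

theorem measurable_sigAlg_sum (X : V → Ω → ℝ) {M : Set V} (J : Finset V) (h : ∀ i ∈ J, i ∈ M) :
    Measurable[sigAlg X M] (fun ω => ∑ i ∈ J, X i ω) :=
  Finset.measurable_fun_sum J fun i hi => measurable_sigAlg_apply X (h i hi)

theorem measurable_sigAlg_abs_sum (X : V → Ω → ℝ) {M : Set V} (J : Finset V)
    (h : ∀ i ∈ J, i ∈ M) :
    Measurable[sigAlg X M] (fun ω => ∑ i ∈ J, |X i ω|) :=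
  Finset.measurable_fun_sum J fun i hi =>
    continuous_abs.measurable.comp (measurable_sigAlg_apply X (h i hi))

end SigmaAlgebras

/-! ### Graph balls and double counting -/

section Balls

variable {V : Type*} [Fintype V] [DecidableEq V] (G : SimpleGraph V) [DecidableRel G.Adj]

theorem mem_nbhd {i j : V} : j ∈ nbhd G i ↔ j = i ∨ G.Adj i j := by
  simp [nbhd]

theorem mem_nbhd_comm {i j : V} : j ∈ nbhd G i ↔ i ∈ nbhd G j := by
  simp [mem_nbhd, G.adj_comm, eq_comm]

theorem self_mem_nbhd (i : V) : i ∈ nbhd G i := by simp [nbhd]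

/-- The ball of radius `2` around `i`. -/
def ballTwo (i : V) : Finset V := (nbhd G i).biUnion (nbhd G)

/-- The ball of radius `3` around `i`. -/
def ballThree (i : V) : Finset V := (ballTwo G i).biUnion (nbhd G)

theorem mem_ballTwo {i j : V} : j ∈ ballTwo G i ↔ ∃ k ∈ nbhd G i, j ∈ nbhd G k := by
  simp [ballTwo]

theorem mem_ballThree {i j : V} : j ∈ ballThree G i ↔ ∃ k ∈ ballTwo G i, j ∈ nbhd G k := by
  simp [ballThree]

theorem mem_ballTwo_comm {i j : V} : j ∈ ballTwo G i ↔ i ∈ ballTwo G j := by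
  simp only [mem_ballTwo]
  constructor <;> rintro ⟨k, h1, h2⟩ <;>
    exact ⟨k, (mem_nbhd_comm G).1 h2, (mem_nbhd_comm G).1 h1⟩

theorem mem_ballThree_comm {i j : V} : j ∈ ballThree G i ↔ i ∈ ballThree G j := by
  have key : ∀ {i j : V}, j ∈ ballThree G i → i ∈ ballThree G j := by
    intro i j h
    obtain ⟨k, hk, hj⟩ := (mem_ballThree G).1 h
    obtain ⟨l, hl, hkl⟩ := (mem_ballTwo G).1 hk
    exact (mem_ballThree G).2 ⟨l, (mem_ballTwo G).2 ⟨k, (mem_nbhd_comm G).1 hj,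
      (mem_nbhd_comm G).1 hkl⟩, (mem_nbhd_comm G).1 hl⟩
  exact ⟨key, key⟩

theorem nbhd_subset_ballTwo (i : V) : nbhd G i ⊆ ballTwo G i := fun j hj =>
  (mem_ballTwo G).2 ⟨j, hj, self_mem_nbhd G j⟩

theorem ballTwo_subset_ballThree (i : V) : ballTwo G i ⊆ ballThree G i := fun j hj =>
  (mem_ballThree G).2 ⟨j, hj, self_mem_nbhd G j⟩

theorem self_mem_ballTwo (i : V) : i ∈ ballTwo G i := nbhd_subset_ballTwo G i (self_mem_nbhd G i)

theorem card_biUnion_nbhd_le {D : ℝ} (hD : ∀ i, ((nbhd G i).card : ℝ) ≤ D)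
    (M : Finset V) :
    ((M.biUnion (nbhd G)).card : ℝ) ≤ M.card * D := by
  calc ((M.biUnion (nbhd G)).card : ℝ) ≤ ((∑ i ∈ M, (nbhd G i).card : ℕ) : ℝ) := by
        exact_mod_cast Finset.card_biUnion_le
    _ = ∑ i ∈ M, ((nbhd G i).card : ℝ) := by push_cast; rfl
    _ ≤ ∑ _i ∈ M, D := Finset.sum_le_sum fun i _ => hD i
    _ = M.card * D := by simp

theorem card_ballTwo_le {D : ℝ} (hD : ∀ i, ((nbhd G i).card : ℝ) ≤ D)
    (hD0 : 0 ≤ D) (i : V) :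
    ((ballTwo G i).card : ℝ) ≤ D ^ 2 := by
  refine (card_biUnion_nbhd_le G hD _).trans ?_
  nlinarith [hD i]

theorem card_ballThree_le {D : ℝ} (hD : ∀ i, ((nbhd G i).card : ℝ) ≤ D)
    (hD0 : 0 ≤ D) (i : V) :
    ((ballThree G i).card : ℝ) ≤ D ^ 3 := by
  refine (card_biUnion_nbhd_le G hD _).trans ?_
  nlinarith [card_ballTwo_le G hD hD0 i]

/-- For a symmetric relation with at most `K` related elements each, iterated sums are bounded by
`K` times the plain sum. -/
theorem sum_sum_le_of_symm {ι : Type*} [Fintype ι] [DecidableEq ι] {N : ι → Finset ι} {K : ℝ}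
    (hsymm : ∀ i j, j ∈ N i → i ∈ N j) (hK : ∀ i, ((N i).card : ℝ) ≤ K) {a : ι → ℝ}
    (ha : ∀ i, 0 ≤ a i) (J : Finset ι) :
    ∑ i ∈ J, ∑ j ∈ N i, a j ≤ K * ∑ i, a i := by
  have h1 : ∑ i ∈ J, ∑ j ∈ N i, a j = ∑ j, ∑ i ∈ J.filter (fun i => j ∈ N i), a j := by
    rw [Finset.sum_comm' (t' := Finset.univ) (s' := fun j => J.filter (fun i => j ∈ N i))]
    intro x y; simp
  rw [h1, Finset.mul_sum]
  refine Finset.sum_le_sum fun j _ => ?_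
  rw [Finset.sum_const, nsmul_eq_mul]
  refine mul_le_mul_of_nonneg_right (le_trans ?_ (hK j)) (ha j)
  exact_mod_cast Finset.card_le_card fun i hi => hsymm i j (Finset.mem_filter.1 hi).2

end Balls

/-! ### Independence of separated subfamilies -/

section Independence

variable {V Ω : Type*} [Fintype V] [DecidableEq V] (G : SimpleGraph V) [DecidableRel G.Adj]

/-- No vertex of `N` belongs to the closed neighbourhood of a vertex of `M`. -/
def Separated (M N : Set V) : Prop := ∀ i ∈ M, ∀ j ∈ N, j ∉ nbhd G i

variable {G} [MeasurableSpace Ω] {P : Measure Ω} {X : V → Ω → ℝ}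

/-- Separation by closed neighbourhoods gives both disjointness and absence of edges; independence
then passes to sub-σ-algebras. -/
theorem IsDependencyGraph.indepFun (hdep : IsDependencyGraph P G X) {M N : Set V}
    (h : Separated G M N) {α β : Type*} [MeasurableSpace α] [MeasurableSpace β]
    {ξ : Ω → α} {η : Ω → β} (hξ : Measurable[sigAlg X M] ξ) (hη : Measurable[sigAlg X N] η) :
    IndepFun ξ η P := by
  have h1 := hdep M N (Set.disjoint_left.2 fun i hi hi' => h i hi i hi' (self_mem_nbhd G i))
    (fun i hi j hj hij => h i hi j hj ((mem_nbhd G).2 (Or.inr hij)))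
  rw [IndepFun_iff_Indep] at h1 ⊢
  exact indep_of_indep_of_le_left (indep_of_indep_of_le_right h1 hη.comap_le) hξ.comap_le

theorem separated_nbhd_compl (i : V) : Separated G {i} {j | j ∉ nbhd G i} := by
  rintro k rfl j hj
  exact hj

/-- A vertex of `M` adjacent to the ball of radius 2 would lie in the ball of radius 3. This is why
radius 3 decides which vertices count as far. -/
theorem separated_of_ballThree {M : Set V} {i : V} (h : ∀ j ∈ M, j ∉ ballThree G i) :
    Separated G (ballTwo G i : Set V) M := by
  intro k hk j hj hjk
  exact h j hj ((mem_ballThree G).2 ⟨k, hk, hjk⟩)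

theorem Separated.symm {M N : Set V} (h : Separated G M N) : Separated G N M :=
  fun i hi j hj hij => h j hj i hi ((mem_nbhd_comm G).1 hij)

end Independence

end GraphDep

namespace GraphDep

theorem integral_add_add {Ω : Type*} [MeasurableSpace Ω] {P : Measure Ω} {f g h : Ω → ℝ}
    (hf : Integrable f P) (hg : Integrable g P) (hh : Integrable h P) :
    ∫ ω, (f ω + g ω + h ω) ∂P = ∫ ω, f ω ∂P + ∫ ω, g ω ∂P + ∫ ω, h ω ∂P := by
  rw [integral_add (f := fun ω => f ω + g ω) (hf.add hg) hh, integral_add hf hg]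

theorem integral_sub_sub {Ω : Type*} [MeasurableSpace Ω] {P : Measure Ω} {f g h : Ω → ℝ}
    (hf : Integrable f P) (hg : Integrable g P) (hh : Integrable h P) :
    ∫ ω, (f ω - g ω - h ω) ∂P = ∫ ω, f ω ∂P - ∫ ω, g ω ∂P - ∫ ω, h ω ∂P := by
  rw [integral_sub (f := fun ω => f ω - g ω) (hf.sub hg) hh, integral_sub hf hg]

/-! ### Variance of locally dependent sums -/

section LocalVariance

variable {ι Ω : Type*} [Fintype ι] [DecidableEq ι] [MeasurableSpace Ω] {P : Measure Ω}
  [IsProbabilityMeasure P]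

theorem abs_covariance_le {x y : Ω → ℝ} (hx : MemLp x 2 P) (hy : MemLp y 2 P) :
    |cov[x, y; P]| ≤ (Var[x; P] + Var[y; P]) / 2 := by
  have h1 := variance_nonneg (x - y) P
  have h2 := variance_nonneg (x + y) P
  rw [variance_sub hx hy] at h1
  rw [variance_add hx hy] at h2
  rw [abs_le]
  constructor <;> linarith

/-- The variance of a sum of variables, each of which is independent of all but `K` others. -/
theorem variance_sum_le_of_local {N : ι → Finset ι} {K : ℝ}
    (hsymm : ∀ i j, j ∈ N i → i ∈ N j) (hK : ∀ i, ((N i).card : ℝ) ≤ K)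
    {p : ι → Ω → ℝ} (hp : ∀ i, MemLp (p i) 2 P) (hind : ∀ i j, j ∉ N i → IndepFun (p i) (p j) P)
    (J : Finset ι) :
    Var[fun ω => ∑ i ∈ J, p i ω; P] ≤ K * ∑ i ∈ J, ∫ ω, p i ω ^ 2 ∂P := by
  -- Setting the variances to 0 off `J` lets the inner sums run over all of `N i`, so that double
  -- counting applies.
  set v : ι → ℝ := fun i => if i ∈ J then Var[p i; P] else 0 with hv
  have hv0 : ∀ i, 0 ≤ v i := fun i => by
    simp only [hv]; split_ifs
    · exact variance_nonneg _ _
    · exact le_rfl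
  have hvar : ∀ i, Var[p i; P] ≤ ∫ ω, p i ω ^ 2 ∂P := fun i =>
    variance_le_expectation_sq (hp i).1
  have hK0 : ∀ i ∈ J, 0 ≤ K := fun i _ => (Nat.cast_nonneg _).trans (hK i)
  have hsumv : ∑ i, v i = ∑ i ∈ J, Var[p i; P] := by
    simp [hv, Finset.sum_ite_mem]
  rw [variance_fun_sum' (fun i _ => hp i)]
  have h1 : ∀ i ∈ J, ∑ j ∈ J, cov[p i, p j; P] ≤ ∑ j ∈ N i, (v i + v j) / 2 := by
    intro i hi
    calc ∑ j ∈ J, cov[p i, p j; P] ≤ ∑ j ∈ J, if j ∈ N i then (v i + v j) / 2 else 0 := by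
          refine Finset.sum_le_sum fun j hj => ?_
          split_ifs with h
          · have := (le_abs_self _).trans (abs_covariance_le (hp i) (hp j))
            simpa [hv, hi, hj] using this
          · rw [(hind i j h).covariance_eq_zero (hp i) (hp j)]
      _ ≤ ∑ j, if j ∈ N i then (v i + v j) / 2 else 0 := by
          refine Finset.sum_le_sum_of_subset_of_nonneg (Finset.subset_univ _) fun j _ _ => ?_
          split_ifs
          · linarith [hv0 i, hv0 j]
          · exact le_rfl
      _ = ∑ j ∈ N i, (v i + v j) / 2 := by simp [Finset.sum_ite_mem]
  have h2 : ∑ i ∈ J, ∑ j ∈ N i, v i ≤ K * ∑ i, v i := by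
    calc ∑ i ∈ J, ∑ j ∈ N i, v i ≤ ∑ i ∈ J, K * v i := by
          refine Finset.sum_le_sum fun i _ => ?_
          rw [Finset.sum_const, nsmul_eq_mul]
          exact mul_le_mul_of_nonneg_right (hK i) (hv0 i)
      _ = K * ∑ i, v i := by
          rw [← Finset.mul_sum, hsumv]
          congr 1
          exact Finset.sum_congr rfl fun i hi => by simp [hv, hi]
  have h3 := sum_sum_le_of_symm hsymm hK hv0 J
  calc ∑ i ∈ J, ∑ j ∈ J, cov[p i, p j; P] ≤ ∑ i ∈ J, ∑ j ∈ N i, (v i + v j) / 2 :=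
        Finset.sum_le_sum h1
    _ = (∑ i ∈ J, ∑ j ∈ N i, v i + ∑ i ∈ J, ∑ j ∈ N i, v j) / 2 := by
        simp only [Finset.sum_add_distrib, ← Finset.sum_div]
    _ ≤ K * ∑ i ∈ J, Var[p i; P] := by rw [← hsumv]; linarith
    _ ≤ K * ∑ i ∈ J, ∫ ω, p i ω ^ 2 ∂P := by
        rcases J.eq_empty_or_nonempty with rfl | ⟨i, hi⟩
        · simp
        · exact mul_le_mul_of_nonneg_left (Finset.sum_le_sum fun i _ => hvar i) (hK0 i hi)

end LocalVariance

/-! ### Normalized fields and their moments -/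

variable {V Ω : Type*} [Fintype V] [DecidableEq V] [MeasurableSpace Ω]

/-- A centred field with dependency graph `G`, closed neighbourhoods of at most `D` vertices,
third absolute moments adding up to at most `κ ^ 3`, and sum of variance `1`. -/
structure NormalizedField (P : Measure Ω) (G : SimpleGraph V) [DecidableRel G.Adj]
    (X : V → Ω → ℝ) (D κ : ℝ) : Prop where
  meas : ∀ i, Measurable (X i)
  cube : ∀ i, Integrable (fun ω => |X i ω| ^ 3) P
  mean : ∀ i, ∫ ω, X i ω ∂P = 0
  dep : IsDependencyGraph P G X
  card_le : ∀ i, ((nbhd G i).card : ℝ) ≤ D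
  one_le : 1 ≤ D
  pos : 0 < κ
  sum_cube : ∑ i, ∫ ω, |X i ω| ^ 3 ∂P ≤ κ ^ 3
  unit : ∑ i, ∫ ω, X i ω * sumY G X i ω ∂P = 1

/-- The sum of the absolute values over a set of vertices. -/
def absSum (X : V → Ω → ℝ) (A : Finset V) (ω : Ω) : ℝ := ∑ j ∈ A, |X j ω|

theorem absSum_nonneg (X : V → Ω → ℝ) (A : Finset V) (ω : Ω) : 0 ≤ absSum X A ω :=
  Finset.sum_nonneg fun _ _ => abs_nonneg _

theorem absSum_mono (X : V → Ω → ℝ) {A B : Finset V} (h : A ⊆ B) (ω : Ω) :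
    absSum X A ω ≤ absSum X B ω :=
  Finset.sum_le_sum_of_subset_of_nonneg h fun _ _ _ => abs_nonneg _

theorem abs_sum_le_absSum (X : V → Ω → ℝ) (A : Finset V) (ω : Ω) :
    |∑ j ∈ A, X j ω| ≤ absSum X A ω :=
  Finset.abs_sum_le_sum_abs _ _

theorem mul_mul_le_cubes {a b c : ℝ} (ha : 0 ≤ a) (hb : 0 ≤ b) (hc : 0 ≤ c) :
    a * b * c ≤ (a ^ 3 + b ^ 3 + c ^ 3) / 3 := by
  nlinarith [mul_nonneg (add_nonneg (add_nonneg ha hb) hc) (add_nonneg (add_nonneg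
    (sq_nonneg (a - b)) (sq_nonneg (b - c))) (sq_nonneg (a - c)))]

namespace NormalizedField

variable {P : Measure Ω} [IsProbabilityMeasure P] {G : SimpleGraph V} [DecidableRel G.Adj]
  {X : V → Ω → ℝ} {D κ : ℝ} (F : NormalizedField P G X D κ)

theorem pos_D (F : NormalizedField P G X D κ) : 0 < D := zero_lt_one.trans_le F.one_le

theorem measurable_sum (F : NormalizedField P G X D κ) (A : Finset V) :
    Measurable (fun ω => ∑ i ∈ A, X i ω) :=
  Finset.measurable_fun_sum A fun i _ => F.meas i

theorem integrable_sq (F : NormalizedField P G X D κ) (i : V) :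
    Integrable (fun ω => X i ω ^ 2) P := by
  refine ((integrable_const (1 : ℝ)).add (F.cube i)).mono'
    ((F.meas i).pow_const 2).aestronglyMeasurable (Filter.Eventually.of_forall fun ω => ?_)
  simp only [Real.norm_eq_abs, Pi.add_apply]
  rw [abs_of_nonneg (sq_nonneg _), ← sq_abs]
  have := abs_nonneg (X i ω)
  rcases le_total (|X i ω|) 1 with h | h
  · nlinarith [pow_nonneg this 3]
  · nlinarith [sq_nonneg (X i ω), sq_nonneg |X i ω|]

theorem memLp_two (F : NormalizedField P G X D κ) (i : V) : MemLp (X i) 2 P :=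
  (memLp_two_iff_integrable_sq (F.meas i).aestronglyMeasurable).2 (F.integrable_sq i)

theorem integrable (F : NormalizedField P G X D κ) (i : V) : Integrable (X i) P :=
  (F.memLp_two i).integrable one_le_two

theorem integrable_mul (F : NormalizedField P G X D κ) (i j : V) :
    Integrable (fun ω => X i ω * X j ω) P :=
  (F.memLp_two i).integrable_mul (F.memLp_two j)

theorem integrable_triple (F : NormalizedField P G X D κ) (i j k : V) :
    Integrable (fun ω => |X i ω| * |X j ω| * |X k ω|) P := by
  refine (((F.cube i).add (F.cube j)).add (F.cube k)).mono'
    (((F.meas i).abs.mul (F.meas j).abs).mul (F.meas k).abs).aestronglyMeasurable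
    (Filter.Eventually.of_forall fun ω => ?_)
  simp only [Real.norm_eq_abs, Pi.add_apply]
  have h := mul_mul_le_cubes (abs_nonneg (X i ω)) (abs_nonneg (X j ω)) (abs_nonneg (X k ω))
  rw [abs_of_nonneg (by positivity)]
  have : 0 ≤ |X i ω| ^ 3 + |X j ω| ^ 3 + |X k ω| ^ 3 := by positivity
  linarith

theorem triple_eq (X : V → Ω → ℝ) (i : V) (A B : Finset V) (ω : Ω) :
    |X i ω| * absSum X A ω * absSum X B ω =
      ∑ j ∈ A, ∑ k ∈ B, |X i ω| * |X j ω| * |X k ω| := by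
  simp only [absSum, Finset.mul_sum, Finset.sum_mul]
  rw [Finset.sum_comm]

theorem integrable_mul_absSum_mul_absSum (F : NormalizedField P G X D κ) (i : V)
    (A B : Finset V) :
    Integrable (fun ω => |X i ω| * absSum X A ω * absSum X B ω) P := by
  simp only [triple_eq]
  exact integrable_finsetSum _ fun j _ => integrable_finsetSum _ fun k _ =>
    F.integrable_triple i j k

/-- By AM-GM each triple product costs a third of the sum of the cubes. Symmetry of `N` means each
vertex is counted at most K times, so only the total third moment enters. -/
theorem sum_integral_triple_le (F : NormalizedField P G X D κ) {N : V → Finset V} {K : ℝ}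
    (hsymm : ∀ i j, j ∈ N i → i ∈ N j) (hK : ∀ i, ((N i).card : ℝ) ≤ K) (hK0 : 0 ≤ K)
    (J : Finset V) :
    ∑ i ∈ J, ∫ ω, |X i ω| * absSum X (N i) ω * absSum X (N i) ω ∂P ≤ K ^ 2 * κ ^ 3 := by
  set m : V → ℝ := fun i => ∫ ω, |X i ω| ^ 3 ∂P with hm
  have hm0 : ∀ i, 0 ≤ m i := fun i => integral_nonneg fun ω => by positivity
  have h1 : ∀ i, ∫ ω, |X i ω| * absSum X (N i) ω * absSum X (N i) ω ∂P ≤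
      (K ^ 2 * m i + 2 * (K * ∑ j ∈ N i, m j)) / 3 := by
    intro i
    simp only [triple_eq]
    rw [integral_finsetSum _ fun j _ => integrable_finsetSum _ fun k _ =>
      F.integrable_triple i j k]
    simp_rw [integral_finsetSum (N i) fun k _ => F.integrable_triple i _ k]
    calc ∑ j ∈ N i, ∑ k ∈ N i, ∫ ω, |X i ω| * |X j ω| * |X k ω| ∂P
        ≤ ∑ j ∈ N i, ∑ k ∈ N i, (m i + m j + m k) / 3 := by
          refine Finset.sum_le_sum fun j _ => Finset.sum_le_sum fun k _ => ?_
          have hc := F.cube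
          calc ∫ ω, |X i ω| * |X j ω| * |X k ω| ∂P
              ≤ ∫ ω, (|X i ω| ^ 3 + |X j ω| ^ 3 + |X k ω| ^ 3) / 3 ∂P :=
                integral_mono (F.integrable_triple i j k)
                  ((((hc i).add (hc j)).add (hc k)).div_const 3)
                  fun ω => mul_mul_le_cubes (abs_nonneg _) (abs_nonneg _) (abs_nonneg _)
            _ = (m i + m j + m k) / 3 := by
                rw [integral_div, integral_add_add (hc i) (hc j) (hc k)]
      _ = ((N i).card * (N i).card * m i + 2 * ((N i).card * ∑ j ∈ N i, m j)) / 3 := by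
          simp only [add_div, Finset.sum_add_distrib, Finset.sum_const, nsmul_eq_mul,
            ← Finset.mul_sum, ← Finset.sum_div]
          ring
      _ ≤ (K ^ 2 * m i + 2 * (K * ∑ j ∈ N i, m j)) / 3 := by
          have h2 : ((N i).card : ℝ) * (N i).card ≤ K ^ 2 := by
            rw [sq]; exact mul_le_mul (hK i) (hK i) (Nat.cast_nonneg _) hK0
          have h3 : 0 ≤ ∑ j ∈ N i, m j := Finset.sum_nonneg fun j _ => hm0 j
          have := mul_le_mul_of_nonneg_right h2 (hm0 i)
          have := mul_le_mul_of_nonneg_right (hK i) h3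
          linarith
  have h2 := sum_sum_le_of_symm hsymm hK hm0 J
  have h3 : ∑ i ∈ J, m i ≤ κ ^ 3 :=
    (Finset.sum_le_sum_of_subset_of_nonneg (Finset.subset_univ J) fun i _ _ => hm0 i).trans
      F.sum_cube
  calc _ ≤ ∑ i ∈ J, (K ^ 2 * m i + 2 * (K * ∑ j ∈ N i, m j)) / 3 :=
        Finset.sum_le_sum fun i _ => h1 i
    _ = (K ^ 2 * ∑ i ∈ J, m i + 2 * (K * ∑ i ∈ J, ∑ j ∈ N i, m j)) / 3 := by
        simp only [add_div, Finset.sum_add_distrib, ← Finset.mul_sum, ← Finset.sum_div]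
    _ ≤ (K ^ 2 * κ ^ 3 + 2 * (K * (K * κ ^ 3))) / 3 := by
        have := mul_le_mul_of_nonneg_left h3 (sq_nonneg K)
        have := mul_le_mul_of_nonneg_left (h2.trans
          (mul_le_mul_of_nonneg_left F.sum_cube hK0)) hK0
        linarith
    _ = K ^ 2 * κ ^ 3 := by ring

theorem integral_cube_le (F : NormalizedField P G X D κ) (i : V) :
    ∫ ω, |X i ω| ^ 3 ∂P ≤ κ ^ 3 :=
  (Finset.single_le_sum (f := fun i => ∫ ω, |X i ω| ^ 3 ∂P)
    (fun _ _ => integral_nonneg fun ω => by positivity) (Finset.mem_univ i)).trans F.sum_cube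

/-- A substitute for Hölder, from (|x| - t)²(2|x| + t) ≥ 0. The choice t = κ bounds one second
moment; t = κ/n^(1/3) balances the sum over all vertices. -/
theorem three_mul_integral_sq_le (F : NormalizedField P G X D κ) (i : V) {t : ℝ} (ht : 0 < t) :
    3 * ∫ ω, X i ω ^ 2 ∂P ≤ 2 * (∫ ω, |X i ω| ^ 3 ∂P) / t + t ^ 2 := by
  have h : ∀ ω, 3 * X i ω ^ 2 ≤ 2 * |X i ω| ^ 3 / t + t ^ 2 := by
    intro ω
    have ha := abs_nonneg (X i ω)
    rw [← sq_abs, ← sub_nonneg, show 2 * |X i ω| ^ 3 / t + t ^ 2 - 3 * |X i ω| ^ 2 =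
      (|X i ω| - t) ^ 2 * (2 * |X i ω| + t) / t by field_simp; ring]
    positivity
  have h2 := integral_mono ((F.integrable_sq i).const_mul 3)
    ((((F.cube i).const_mul 2).div_const t).add (integrable_const (t ^ 2))) h
  simp only [Pi.add_apply] at h2
  rw [integral_add (((F.cube i).const_mul 2).div_const t) (integrable_const _),
    integral_const_mul, integral_div, integral_const_mul] at h2
  simpa using h2

theorem integral_sq_le (F : NormalizedField P G X D κ) (i : V) :
    ∫ ω, X i ω ^ 2 ∂P ≤ κ ^ 2 := by
  have h := F.three_mul_integral_sq_le i F.pos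
  have h2 : 2 * (∫ ω, |X i ω| ^ 3 ∂P) / κ ≤ 2 * κ ^ 2 := by
    rw [div_le_iff₀ F.pos]
    nlinarith [F.integral_cube_le i]
  linarith

theorem abs_integral_mul_le (F : NormalizedField P G X D κ) (i j : V) :
    |∫ ω, X i ω * X j ω ∂P| ≤ (∫ ω, X i ω ^ 2 ∂P + ∫ ω, X j ω ^ 2 ∂P) / 2 := by
  have h2 : ∫ ω, (X i ω ^ 2 + X j ω ^ 2) / 2 ∂P =
      (∫ ω, X i ω ^ 2 ∂P + ∫ ω, X j ω ^ 2 ∂P) / 2 := by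
    rw [integral_div, integral_add (F.integrable_sq i) (F.integrable_sq j)]
  rw [← h2]
  refine abs_integral_le_integral_abs.trans (integral_mono (F.integrable_mul i j).abs
    (((F.integrable_sq i).add (F.integrable_sq j)).div_const 2) fun ω => ?_)
  simp only
  rw [abs_mul]
  nlinarith [sq_nonneg (|X i ω| - |X j ω|), sq_abs (X i ω), sq_abs (X j ω)]

theorem measurable_sumY (F : NormalizedField P G X D κ) (i : V) : Measurable (sumY G X i) :=
  F.measurable_sum _

theorem integrable_mul_sumY (F : NormalizedField P G X D κ) (i : V) :
    Integrable (fun ω => X i ω * sumY G X i ω) P := by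
  simp only [sumY, Finset.mul_sum]
  exact integrable_finsetSum _ fun j _ => F.integrable_mul i j

theorem integral_mul_sumY (F : NormalizedField P G X D κ) (i : V) :
    ∫ ω, X i ω * sumY G X i ω ∂P = ∑ j ∈ nbhd G i, ∫ ω, X i ω * X j ω ∂P := by
  simp only [sumY, Finset.mul_sum]
  exact integral_finsetSum _ fun j _ => F.integrable_mul i j

theorem abs_integral_mul_sumY_le (F : NormalizedField P G X D κ) (i : V) :
    |∫ ω, X i ω * sumY G X i ω ∂P| ≤ D * κ ^ 2 := by
  rw [F.integral_mul_sumY]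
  calc _ ≤ ∑ j ∈ nbhd G i, |∫ ω, X i ω * X j ω ∂P| := Finset.abs_sum_le_sum_abs _ _
    _ ≤ ∑ j ∈ nbhd G i, κ ^ 2 := Finset.sum_le_sum fun j _ => by
        have := F.abs_integral_mul_le i j
        linarith [F.integral_sq_le i, F.integral_sq_le j]
    _ = (nbhd G i).card * κ ^ 2 := by simp
    _ ≤ D * κ ^ 2 := mul_le_mul_of_nonneg_right (F.card_le i) (sq_nonneg κ)

/-- The sum of the second moments is at least `1 / D`. -/
theorem one_le_mul_sum_sq (F : NormalizedField P G X D κ) :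
    1 ≤ D * ∑ i, ∫ ω, X i ω ^ 2 ∂P := by
  set m : V → ℝ := fun i => ∫ ω, X i ω ^ 2 ∂P
  have hm0 : ∀ i, 0 ≤ m i := fun i => integral_nonneg fun ω => by positivity
  calc (1 : ℝ) = ∑ i, ∑ j ∈ nbhd G i, ∫ ω, X i ω * X j ω ∂P := by
        rw [← F.unit]; exact Finset.sum_congr rfl fun i _ => F.integral_mul_sumY i
    _ ≤ ∑ i, ∑ j ∈ nbhd G i, (m i + m j) / 2 := Finset.sum_le_sum fun i _ =>
        Finset.sum_le_sum fun j _ => (le_abs_self _).trans (F.abs_integral_mul_le i j)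
    _ = (∑ i, (nbhd G i).card * m i + ∑ i, ∑ j ∈ nbhd G i, m j) / 2 := by
        simp only [add_div, Finset.sum_add_distrib, Finset.sum_const, nsmul_eq_mul,
          Finset.sum_div]
        simp only [mul_div_assoc]
    _ ≤ (D * ∑ i, m i + D * ∑ i, m i) / 2 := by
        have h1 : ∑ i, (nbhd G i).card * m i ≤ D * ∑ i, m i := by
          rw [Finset.mul_sum]
          exact Finset.sum_le_sum fun i _ => mul_le_mul_of_nonneg_right (F.card_le i) (hm0 i)
        have h2 := sum_sum_le_of_symm (fun i j => (mem_nbhd_comm G).1) F.card_le hm0 Finset.univ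
        linarith
    _ = D * ∑ i, m i := by ring

theorem indepFun_of_notMem (F : NormalizedField P G X D κ) {i j : V} (h : j ∉ nbhd G i) :
    IndepFun (X i) (X j) P :=
  F.dep.indepFun (M := {i}) (N := {j}) (by rintro _ rfl _ rfl; exact h)
    (measurable_sigAlg_apply X rfl) (measurable_sigAlg_apply X rfl)

theorem memLp_two_sum (F : NormalizedField P G X D κ) (J : Finset V) :
    MemLp (fun ω => ∑ i ∈ J, X i ω) 2 P :=
  memLp_finsetSum J fun i _ => F.memLp_two i

theorem integrable_sum (F : NormalizedField P G X D κ) (J : Finset V) :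
    Integrable (fun ω => ∑ i ∈ J, X i ω) P :=
  integrable_finsetSum J fun i _ => F.integrable i

/-- The weights are needed for ∑ Yᵢ, in which Xᵢ appears as often as its closed neighbourhood has
vertices. -/
theorem integral_weighted_sum_sq_le (F : NormalizedField P G X D κ) (J : Finset V) (a : V → ℝ) :
    ∫ ω, (∑ i ∈ J, a i * X i ω) ^ 2 ∂P ≤ D * ∑ i ∈ J, a i ^ 2 * ∫ ω, X i ω ^ 2 ∂P := by
  have hp : ∀ i, MemLp (fun ω => a i * X i ω) 2 P := fun i => (F.memLp_two i).const_mul (a i)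
  have h := variance_sum_le_of_local (P := P) (N := nbhd G) (K := D)
    (p := fun i ω => a i * X i ω) (fun i j => (mem_nbhd_comm G).1) F.card_le hp
    (fun i j hij => (F.indepFun_of_notMem hij).comp (measurable_const_mul (a i))
      (measurable_const_mul (a j))) J
  rw [variance_of_integral_eq_zero] at h
  · refine h.trans_eq ?_
    congr 1
    refine Finset.sum_congr rfl fun i _ => ?_
    rw [← integral_const_mul]
    simp only [mul_pow]
  · exact (Finset.measurable_fun_sum J fun i _ => (F.meas i).const_mul (a i)).aemeasurable
  · rw [integral_finsetSum J fun i _ => (F.integrable i).const_mul (a i)]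
    simp [integral_const_mul, F.mean]

theorem integral_sum_sq_le (F : NormalizedField P G X D κ) (J : Finset V) :
    ∫ ω, (∑ i ∈ J, X i ω) ^ 2 ∂P ≤ D * ∑ i ∈ J, ∫ ω, X i ω ^ 2 ∂P := by
  simpa using F.integral_weighted_sum_sq_le J (fun _ => 1)

/-- Pairs that are not neighbours are uncorrelated, so only the products counted in `unit` survive.
-/
theorem integral_sumS_sq (F : NormalizedField P G X D κ) : ∫ ω, (∑ i, X i ω) ^ 2 ∂P = 1 := by
  rw [← F.unit]
  have h : ∀ i j, j ∉ nbhd G i → ∫ ω, X i ω * X j ω ∂P = 0 := fun i j hij => by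
    rw [(F.indepFun_of_notMem hij).integral_fun_mul_eq_mul_integral
      (F.meas i).aestronglyMeasurable (F.meas j).aestronglyMeasurable, F.mean i, zero_mul]
  simp only [F.integral_mul_sumY, sq, Finset.sum_mul_sum]
  rw [integral_finsetSum _ fun i _ => integrable_finsetSum _ fun j _ => F.integrable_mul i j]
  refine Finset.sum_congr rfl fun i _ => ?_
  rw [integral_finsetSum _ fun j _ => F.integrable_mul i j]
  exact (Finset.sum_subset (Finset.subset_univ _) fun j _ hj => h i j hj).symm

/-- Leaving out a small set of summands keeps the sum bounded in mean. -/
theorem integral_abs_sum_le (F : NormalizedField P G X D κ) {J : Finset V}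
    (hJ : D * (Jᶜ.card : ℝ) * κ ^ 2 ≤ 1 / 16) :
    ∫ ω, |∑ i ∈ J, X i ω| ∂P ≤ 2 := by
  have hc : ∫ ω, (∑ i ∈ Jᶜ, X i ω) ^ 2 ∂P ≤ 1 / 16 := by
    refine (F.integral_sum_sq_le _).trans (le_trans ?_ hJ)
    rw [mul_assoc]
    refine mul_le_mul_of_nonneg_left ?_ F.pos_D.le
    calc _ ≤ ∑ i ∈ Jᶜ, κ ^ 2 := Finset.sum_le_sum fun i _ => F.integral_sq_le i
      _ = _ := by simp
  have hi := (F.memLp_two_sum Finset.univ).integrable_sq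
  have hic := (F.memLp_two_sum Jᶜ).integrable_sq
  -- With x + y = S, |x| ≤ 1/2 + x²/2 ≤ 1/2 + (x + y)² + y²; the three terms have means 1/2, 1 and
  -- at most 1/16.
  have h : ∫ ω, |∑ i ∈ J, X i ω| ∂P ≤
      ∫ ω, (1 / 2 + (∑ i, X i ω) ^ 2 + (∑ i ∈ Jᶜ, X i ω) ^ 2) ∂P := by
    refine integral_mono (F.integrable_sum J).abs (((integrable_const _).add hi).add hic)
      fun ω => ?_
    have h1 := Finset.sum_add_sum_compl J (fun i => X i ω)
    simp only
    rw [← h1]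
    set x := ∑ i ∈ J, X i ω
    set y := ∑ i ∈ Jᶜ, X i ω
    rw [abs_le]
    constructor <;> nlinarith [sq_nonneg (x + 2 * y), sq_nonneg (x + 1), sq_nonneg (x - 1)]
  rw [integral_add_add (integrable_const _) hi hic, F.integral_sumS_sq] at h
  simp only [integral_const, probReal_univ, smul_eq_mul, one_mul] at h
  linarith

end NormalizedField

end GraphDep

/-! ### Truncation and concentration of the quadratic form -/

namespace GraphDep

/-- The identity on `[-1, 1]`, and `0` elsewhere. -/
noncomputable def clip (x : ℝ) : ℝ := if |x| ≤ 1 then x else 0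

theorem measurable_clip : Measurable clip :=
  Measurable.ite (measurableSet_le continuous_abs.measurable measurable_const) measurable_id
    measurable_const

theorem abs_clip_le_one (x : ℝ) : |clip x| ≤ 1 := by
  unfold clip; split_ifs with h
  · exact h
  · simp

/-- Either nothing is clipped, or the larger absolute value exceeds 1 and its cube dominates the
product. With `clip_mul_sq_le` this lets third moments control a quadratic form: the clipped part in
variance, the rest in mean. -/
theorem abs_mul_sub_clip_le (x y : ℝ) :
    |x * y - clip x * clip y| ≤ |x| ^ 3 + |y| ^ 3 := by
  have key : ∀ {a b : ℝ}, 0 ≤ a → 0 ≤ b → (1 < a ∨ 1 < b) → a * b ≤ a ^ 3 + b ^ 3 := by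
    intro a b ha hb h
    rcases le_total a b with hab | hab
    · have hb1 : 1 ≤ b := by rcases h with h | h <;> linarith
      calc a * b ≤ b * b := by gcongr
        _ ≤ b ^ 3 := by nlinarith [mul_nonneg hb hb]
        _ ≤ _ := by linarith [pow_nonneg ha 3]
    · have ha1 : 1 ≤ a := by rcases h with h | h <;> linarith
      calc a * b ≤ a * a := by gcongr
        _ ≤ a ^ 3 := by nlinarith [mul_nonneg ha ha]
        _ ≤ _ := by linarith [pow_nonneg hb 3]
  have hx := abs_nonneg x
  have hy := abs_nonneg y
  unfold clip
  split_ifs with h1 h2 h2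
  · simp; positivity
  · simpa [abs_mul] using key hx hy (Or.inr (not_le.1 h2))
  · simpa [abs_mul] using key hx hy (Or.inl (not_le.1 h1))
  · simpa [abs_mul] using key hx hy (Or.inl (not_le.1 h1))

theorem clip_mul_sq_le (x y : ℝ) : (clip x * clip y) ^ 2 ≤ |x| ^ 3 + |y| ^ 3 := by
  have key : ∀ {a : ℝ}, 0 ≤ a → a ≤ 1 → a ^ 4 ≤ a ^ 3 := fun ha h =>
    pow_le_pow_of_le_one ha h (by norm_num)
  have hx := abs_nonneg x
  have hy := abs_nonneg y
  have h0 : (0 : ℝ) ≤ |x| ^ 3 + |y| ^ 3 := by positivity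
  unfold clip
  split_ifs with h1 h2 h2
  · rw [← sq_abs, abs_mul]
    have := key hx h1
    have := key hy h2
    nlinarith [sq_nonneg (|x| ^ 2 - |y| ^ 2), sq_nonneg (|x| ^ 2), sq_nonneg (|y| ^ 2)]
  all_goals simpa using h0

variable {V Ω : Type*} [Fintype V] [DecidableEq V] [MeasurableSpace Ω]

/-- The sum of the products `X i * Y i` over `i ∈ J`. -/
def crossSum (G : SimpleGraph V) [DecidableRel G.Adj] (X : V → Ω → ℝ) (J : Finset V) (ω : Ω) :
    ℝ := ∑ i ∈ J, X i ω * sumY G X i ω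

namespace NormalizedField

variable {P : Measure Ω} [IsProbabilityMeasure P] {G : SimpleGraph V} [DecidableRel G.Adj]
  {X : V → Ω → ℝ} {D κ : ℝ}

theorem integrable_crossSum (F : NormalizedField P G X D κ) (J : Finset V) :
    Integrable (crossSum G X J) P :=
  integrable_finsetSum J fun i _ => F.integrable_mul_sumY i

theorem measurable_crossSum (F : NormalizedField P G X D κ) (J : Finset V) :
    Measurable (crossSum G X J) :=
  Finset.measurable_fun_sum J fun i _ => (F.meas i).mul (F.measurable_sumY i)

/-- Leaving out a small set of terms keeps the mean of the quadratic form close to `1`. -/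
theorem integral_crossSum_ge (F : NormalizedField P G X D κ) {J : Finset V}
    (hJ : D * (Jᶜ.card : ℝ) * κ ^ 2 ≤ 1 / 16) :
    15 / 16 ≤ ∫ ω, crossSum G X J ω ∂P := by
  have h1 : ∫ ω, crossSum G X J ω ∂P = ∑ i ∈ J, ∫ ω, X i ω * sumY G X i ω ∂P :=
    integral_finsetSum J fun i _ => F.integrable_mul_sumY i
  have h2 := Finset.sum_add_sum_compl J (fun i => ∫ ω, X i ω * sumY G X i ω ∂P)
  rw [F.unit] at h2
  have h3 : ∑ i ∈ Jᶜ, ∫ ω, X i ω * sumY G X i ω ∂P ≤ ∑ i ∈ Jᶜ, D * κ ^ 2 :=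
    Finset.sum_le_sum fun i _ => (le_abs_self _).trans (F.abs_integral_mul_sumY_le i)
  rw [Finset.sum_const, nsmul_eq_mul] at h3
  rw [h1]
  linarith

theorem sum_sum_cubes_le (F : NormalizedField P G X D κ) (J : Finset V) :
    ∑ i ∈ J, ∑ j ∈ nbhd G i, (∫ ω, |X i ω| ^ 3 ∂P + ∫ ω, |X j ω| ^ 3 ∂P) ≤ 2 * D * κ ^ 3 := by
  have hm0 : ∀ i, 0 ≤ ∫ ω, |X i ω| ^ 3 ∂P := fun i => integral_nonneg fun ω => by positivity
  simp only [Finset.sum_add_distrib, Finset.sum_const, nsmul_eq_mul]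
  have h1 : ∑ i ∈ J, ((nbhd G i).card : ℝ) * ∫ ω, |X i ω| ^ 3 ∂P ≤ D * κ ^ 3 := by
    calc _ ≤ ∑ i ∈ J, D * ∫ ω, |X i ω| ^ 3 ∂P :=
          Finset.sum_le_sum fun i _ => mul_le_mul_of_nonneg_right (F.card_le i) (hm0 i)
      _ ≤ ∑ i, D * ∫ ω, |X i ω| ^ 3 ∂P :=
          Finset.sum_le_sum_of_subset_of_nonneg (Finset.subset_univ J) fun i _ _ =>
            mul_nonneg F.pos_D.le (hm0 i)
      _ ≤ D * κ ^ 3 := by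
          rw [← Finset.mul_sum]
          exact mul_le_mul_of_nonneg_left F.sum_cube F.pos_D.le
  have h2 := (sum_sum_le_of_symm (fun i j => (mem_nbhd_comm G).1) F.card_le hm0 J).trans
    (mul_le_mul_of_nonneg_left F.sum_cube F.pos_D.le)
  linarith

/-- The quadratic form is concentrated around its mean. -/
theorem integral_crossSum_dev_le (F : NormalizedField P G X D κ) (J : Finset V) :
    ∫ ω, max (|crossSum G X J ω - ∫ ω', crossSum G X J ω' ∂P| - 1 / 8) 0 ∂P ≤
      8 * (D ^ 6 * κ ^ 3) := by
  set p : V → Ω → ℝ := fun i ω => ∑ j ∈ nbhd G i, clip (X i ω) * clip (X j ω) with hp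
  set q : Ω → ℝ := fun ω => ∑ i ∈ J, p i ω with hq
  set r : Ω → ℝ := fun ω => crossSum G X J ω - q ω with hr
  have hD := F.one_le
  have hD0 := F.pos_D
  have hκ := F.pos
  have hcl : ∀ i, Measurable (fun ω => clip (X i ω)) := fun i => measurable_clip.comp (F.meas i)
  have hpm : ∀ i, Measurable (p i) := fun i =>
    Finset.measurable_fun_sum _ fun j _ => (hcl i).mul (hcl j)
  have hpb : ∀ i ω, |p i ω| ≤ (nbhd G i).card := fun i ω => by
    refine (Finset.abs_sum_le_sum_abs _ _).trans ?_
    have : ∑ j ∈ nbhd G i, |clip (X i ω) * clip (X j ω)| ≤ ∑ j ∈ nbhd G i, (1 : ℝ) :=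
      Finset.sum_le_sum fun j _ => by
        rw [abs_mul]
        exact mul_le_one₀ (abs_clip_le_one _) (abs_nonneg _) (abs_clip_le_one _)
    simpa using this
  have hp2 : ∀ i, MemLp (p i) 2 P := fun i =>
    MemLp.of_bound (hpm i).aestronglyMeasurable _ (Filter.Eventually.of_forall (hpb i))
  have hq2 : MemLp q 2 P := memLp_finsetSum J fun i _ => hp2 i
  have hqi : Integrable q P := hq2.integrable one_le_two
  have hri : Integrable r P := (F.integrable_crossSum J).sub hqi
  have hrb : ∀ ω, |r ω| ≤ ∑ i ∈ J, ∑ j ∈ nbhd G i, (|X i ω| ^ 3 + |X j ω| ^ 3) := fun ω => by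
    simp only [hr, hq, hp, crossSum, sumY, Finset.mul_sum, ← Finset.sum_sub_distrib]
    exact (Finset.abs_sum_le_sum_abs _ _).trans (Finset.sum_le_sum fun i _ =>
      (Finset.abs_sum_le_sum_abs _ _).trans (Finset.sum_le_sum fun j _ =>
        abs_mul_sub_clip_le _ _))
  have hc2 : ∀ i j, Integrable (fun ω => |X i ω| ^ 3 + |X j ω| ^ 3) P := fun i j =>
    (F.cube i).add (F.cube j)
  have hr1 : ∫ ω, |r ω| ∂P ≤ 2 * D * κ ^ 3 := by
    refine (integral_mono hri.abs (integrable_finsetSum _ fun i _ =>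
      integrable_finsetSum _ fun j _ => hc2 i j) hrb).trans (le_of_eq_of_le ?_
        (F.sum_sum_cubes_le J))
    rw [integral_finsetSum _ fun i _ => integrable_finsetSum _ fun j _ => hc2 i j]
    refine Finset.sum_congr rfl fun i _ => ?_
    rw [integral_finsetSum _ fun j _ => hc2 i j]
    exact Finset.sum_congr rfl fun j _ => integral_add (F.cube i) (F.cube j)
  have hpsq : ∀ i, ∫ ω, p i ω ^ 2 ∂P ≤
      D * ∑ j ∈ nbhd G i, (∫ ω, |X i ω| ^ 3 ∂P + ∫ ω, |X j ω| ^ 3 ∂P) := fun i => by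
    have h1 : ∀ ω, p i ω ^ 2 ≤ D * ∑ j ∈ nbhd G i, (|X i ω| ^ 3 + |X j ω| ^ 3) := fun ω => by
      calc p i ω ^ 2 ≤ (nbhd G i).card * ∑ j ∈ nbhd G i, (clip (X i ω) * clip (X j ω)) ^ 2 :=
            sq_sum_le_card_mul_sum_sq
        _ ≤ D * ∑ j ∈ nbhd G i, (|X i ω| ^ 3 + |X j ω| ^ 3) :=
            mul_le_mul (F.card_le i) (Finset.sum_le_sum fun j _ => clip_mul_sq_le _ _)
              (Finset.sum_nonneg fun j _ => sq_nonneg _) hD0.le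
    refine (integral_mono (hp2 i).integrable_sq
      ((integrable_finsetSum _ fun j _ => hc2 i j).const_mul D) h1).trans_eq ?_
    rw [integral_const_mul, integral_finsetSum _ fun j _ => hc2 i j]
    congr 1
    exact Finset.sum_congr rfl fun j _ => integral_add (F.cube i) (F.cube j)
  have hpF : ∀ i, Measurable[sigAlg X (nbhd G i : Set V)] (p i) := fun i =>
    Finset.measurable_fun_sum _ fun j hj =>
      (measurable_clip.comp (measurable_sigAlg_apply X (self_mem_nbhd G i))).mul
        (measurable_clip.comp (measurable_sigAlg_apply X hj))
  -- Each `p i` reads only the closed neighbourhood of i, and two such neighbourhoods can touch only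
  -- if their centres are within distance 3.
  have hind : ∀ i j, j ∉ ballThree G i → IndepFun (p i) (p j) P := fun i j hij => by
    refine F.dep.indepFun (M := (nbhd G i : Set V)) (N := (nbhd G j : Set V)) ?_ (hpF i) (hpF j)
    intro k hk l hl hkl
    exact hij ((mem_ballThree G).2 ⟨l, (mem_ballTwo G).2 ⟨k, hk, hkl⟩, (mem_nbhd_comm G).1 hl⟩)
  have hvar : Var[q; P] ≤ 2 * D ^ 5 * κ ^ 3 := by
    calc Var[q; P] ≤ D ^ 3 * ∑ i ∈ J, ∫ ω, p i ω ^ 2 ∂P :=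
          variance_sum_le_of_local (fun i j => (mem_ballThree_comm G).1)
            (card_ballThree_le G F.card_le hD0.le) hp2 hind J
      _ ≤ D ^ 3 * (D * (2 * D * κ ^ 3)) := by
          refine mul_le_mul_of_nonneg_left ?_ (by positivity)
          refine (Finset.sum_le_sum fun i _ => hpsq i).trans ?_
          rw [← Finset.mul_sum]
          exact mul_le_mul_of_nonneg_left (F.sum_sum_cubes_le J) hD0.le
      _ = 2 * D ^ 5 * κ ^ 3 := by ring
  rw [variance_eq_integral hqi.aemeasurable] at hvar
  have hEq : ∫ ω, crossSum G X J ω ∂P = ∫ ω, q ω ∂P + ∫ ω, r ω ∂P := by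
    rw [← integral_add hqi hri]
    simp [hr]
  have hrE : |∫ ω, r ω ∂P| ≤ ∫ ω, |r ω| ∂P := abs_integral_le_integral_abs
  have hsqi : Integrable (fun ω => (q ω - ∫ ω', q ω' ∂P) ^ 2) P :=
    (hq2.sub (memLp_const _)).integrable_sq
  -- Since (4x - 1)² ≥ 0 gives x - 1/8 ≤ 2x², the excess over 1/8 is bounded by the variance itself,
  -- of order β, and not by its square root.
  have hpt : ∀ ω, max (|crossSum G X J ω - ∫ ω', crossSum G X J ω' ∂P| - 1 / 8) 0 ≤
      |r ω| + ∫ ω', |r ω'| ∂P + 2 * (q ω - ∫ ω', q ω' ∂P) ^ 2 := fun ω => by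
    have e : crossSum G X J ω - ∫ ω', crossSum G X J ω' ∂P =
        (q ω - ∫ ω', q ω' ∂P) + (r ω - ∫ ω', r ω' ∂P) := by rw [hEq]; simp only [hr]; ring
    have t1 := abs_add_le (q ω - ∫ ω', q ω' ∂P) (r ω - ∫ ω', r ω' ∂P)
    have t2 := abs_sub (r ω) (∫ ω', r ω' ∂P)
    rw [e]
    have t3 : 0 ≤ |r ω| := abs_nonneg _
    have t4 : 0 ≤ |∫ ω', r ω' ∂P| := abs_nonneg _
    have t5 := sq_abs (q ω - ∫ ω', q ω' ∂P)
    refine max_le ?_ (by nlinarith)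
    nlinarith [sq_nonneg (4 * |q ω - ∫ ω', q ω' ∂P| - 1)]
  have hcont : Integrable
      (fun ω => max (|crossSum G X J ω - ∫ ω', crossSum G X J ω' ∂P| - 1 / 8) 0) P :=
    ((((F.integrable_crossSum J).sub (integrable_const _)).abs).sub (integrable_const _)).sup
      (integrable_const 0)
  refine (integral_mono hcont ((hri.abs.add (integrable_const _)).add (hsqi.const_mul 2))
    hpt).trans ?_
  simp only [Pi.add_apply]
  rw [integral_add_add hri.abs (integrable_const _) (hsqi.const_mul 2), integral_const_mul]
  simp only [integral_const, probReal_univ, smul_eq_mul, one_mul]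
  have e1 : D ≤ D ^ 6 := le_self_pow₀ hD (by norm_num)
  have e2 : D ^ 5 ≤ D ^ 6 := pow_le_pow_right₀ hD (by norm_num)
  have hk3 : 0 < κ ^ 3 := by positivity
  nlinarith [mul_le_mul_of_nonneg_right e1 hk3.le, mul_le_mul_of_nonneg_right e2 hk3.le]

end NormalizedField

end GraphDep

namespace GraphDep

/-! ### Overlap lengths and tent functions -/

section Overlap

/-- The length of the set of those `u` with `|u - y| ≤ w` and `|t - u - a| ≤ r`. -/
noncomputable def overlap (y w a r t : ℝ) : ℝ :=
  max 0 (min (y + w) (t - a + r) - max (y - w) (t - a - r))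

theorem overlap_nonneg (y w a r t : ℝ) : 0 ≤ overlap y w a r t := le_max_left _ _

theorem overlap_le {w : ℝ} (hw : 0 ≤ w) (y a r t : ℝ) : overlap y w a r t ≤ 2 * w := by
  refine max_le (by linarith) ?_
  linarith [min_le_left (y + w) (t - a + r), le_max_left (y - w) (t - a - r)]

theorem ofReal_overlap (y w a r t : ℝ) :
    ENNReal.ofReal (overlap y w a r t) =
      volume {u : ℝ | |u - y| ≤ w ∧ |t - (u + a)| ≤ r} := by
  have : {u : ℝ | |u - y| ≤ w ∧ |t - (u + a)| ≤ r} =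
      Set.Icc (max (y - w) (t - a - r)) (min (y + w) (t - a + r)) := by
    ext u
    simp only [Set.mem_ofPred_eq, Set.mem_Icc, abs_le, max_le_iff, le_min_iff]
    constructor
    · rintro ⟨⟨h1, h2⟩, h3, h4⟩; exact ⟨⟨by linarith, by linarith⟩, by linarith, by linarith⟩
    · rintro ⟨⟨h1, h2⟩, h3, h4⟩; exact ⟨⟨by linarith, by linarith⟩, by linarith, by linarith⟩
  rw [this, Real.volume_Icc, overlap]
  rcases le_total 0 (min (y + w) (t - a + r) - max (y - w) (t - a - r)) with h | h
  · rw [max_eq_right h]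
  · rw [max_eq_left h, ENNReal.ofReal_of_nonpos h, ENNReal.ofReal_zero]

/-- The projection onto the interval of radius `r` around `a`. -/
noncomputable def project (a r x : ℝ) : ℝ := max (a - r) (min (a + r) x)

/-- The projection moves, at unit speed, only while its argument is within `r` of `a`; the overlap
is the length of the admissible range of u where this happens. -/
theorem abs_project_sub_le {y w a r t u v : ℝ} (hr : 0 ≤ r) (hu : |u - y| ≤ w)
    (hv : |v - y| ≤ w) :
    |project a r (t - u) - project a r (t - v)| ≤ overlap y w a r t := by
  rw [abs_le] at hu hv
  unfold project overlap
  rw [abs_le]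
  constructor <;> grind

theorem abs_project_sub_self_le {a r : ℝ} (hr : 0 ≤ r) (x : ℝ) : |project a r x - a| ≤ r := by
  unfold project
  rw [abs_le]
  constructor <;> grind

/-- The tent function of height `1` and half-width `r` centred at `a`. -/
noncomputable def tent (a r x : ℝ) : ℝ := max 0 (1 - |x - a| / r)

theorem continuous_tent (a r : ℝ) : Continuous (tent a r) := by
  unfold tent; fun_prop

theorem tent_nonneg (a r x : ℝ) : 0 ≤ tent a r x := le_max_left _ _

theorem tent_le_one {r : ℝ} (hr : 0 < r) (a x : ℝ) : tent a r x ≤ 1 :=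
  max_le zero_le_one (by linarith [div_nonneg (abs_nonneg (x - a)) hr.le])

theorem tent_eq_zero {a r x : ℝ} (hr : 0 < r) (h : r ≤ |x - a|) : tent a r x = 0 :=
  max_eq_left (by linarith [(one_le_div hr).2 h])

theorem half_le_tent {a α x : ℝ} (hα : 0 < α) (h : |x - a| ≤ α) : 1 / 2 ≤ tent a (2 * α) x := by
  refine le_max_of_le_right ?_
  have : |x - a| / (2 * α) ≤ 1 / 2 := by
    rw [div_le_iff₀ (by positivity)]; linarith
  linarith

theorem project_eq_self {a r x : ℝ} (h : |x - a| ≤ r) : project a r x = x := by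
  rw [abs_le] at h
  unfold project
  rw [min_eq_right (by linarith), max_eq_right (by linarith)]

theorem tent_project {a r : ℝ} (hr : 0 < r) (x : ℝ) : tent a r (project a r x) = tent a r x := by
  by_cases h : |x - a| ≤ r
  · rw [project_eq_self h]
  · rw [tent_eq_zero hr (not_le.1 h).le]
    apply tent_eq_zero hr
    unfold project
    grind

theorem abs_tent_sub_le {a r : ℝ} (hr : 0 < r) (x y : ℝ) :
    |tent a r x - tent a r y| ≤ |project a r x - project a r y| / r := by
  rw [← tent_project hr x, ← tent_project hr y]
  set p := project a r x
  set q := project a r y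
  unfold tent
  rw [max_comm, max_comm (0 : ℝ) (1 - |q - a| / r)]
  refine (abs_max_sub_max_le_abs _ _ _).trans ?_
  · rw [show (1 - |p - a| / r) - (1 - |q - a| / r) = (|q - a| - |p - a|) / r by ring, abs_div,
      abs_of_pos hr]
    exact div_le_div_of_nonneg_right ((abs_abs_sub_abs_le (q - a) (p - a)).trans_eq
      (by rw [abs_sub_comm]; congr 1; ring)) hr.le

/-- The primitive of the tent function that vanishes at its centre. -/
noncomputable def tentPrim (a r x : ℝ) : ℝ := ∫ s in a..x, tent a r s

theorem intervalIntegrable_tent (a r x y : ℝ) :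
    IntervalIntegrable (tent a r) volume x y := (continuous_tent a r).intervalIntegrable _ _

theorem tentPrim_sub (a r x y : ℝ) :
    tentPrim a r x - tentPrim a r y = ∫ s in y..x, tent a r s :=
  intervalIntegral.integral_interval_sub_left (intervalIntegrable_tent _ _ _ _)
    (intervalIntegrable_tent _ _ _ _)

theorem abs_tentPrim_sub_le_abs {a r : ℝ} (hr : 0 < r) (x y : ℝ) :
    |tentPrim a r x - tentPrim a r y| ≤ |x - y| := by
  rw [tentPrim_sub, ← Real.norm_eq_abs]
  refine (intervalIntegral.norm_integral_le_of_norm_le_const (C := 1) fun s _ => ?_).trans_eq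
    (by rw [one_mul])
  rw [Real.norm_eq_abs, abs_of_nonneg (tent_nonneg _ _ _)]
  exact tent_le_one hr a s

/-- The tent vanishes beyond distance `r`, so its primitive is constant there and its increments
inherit the overlap bound of the projection. -/
theorem tentPrim_project {a r : ℝ} (hr : 0 < r) (x : ℝ) :
    tentPrim a r (project a r x) = tentPrim a r x := by
  rw [eq_comm, ← sub_eq_zero, tentPrim_sub]
  have h0 : ∀ s ∈ Set.uIcc (project a r x) x, tent a r s =
      if |x - a| ≤ r then tent a r s else 0 := by
    intro s hs
    split_ifs with h
    · rfl
    · refine tent_eq_zero hr ?_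
      rw [Set.mem_uIcc] at hs
      unfold project at hs
      grind
  rw [intervalIntegral.integral_congr h0]
  split_ifs with h
  · rw [project_eq_self h, intervalIntegral.integral_same]
  · simp

theorem abs_tentPrim_le {a r : ℝ} (hr : 0 < r) (x : ℝ) : |tentPrim a r x| ≤ r := by
  have h := abs_tentPrim_sub_le_abs (a := a) hr (project a r x) a
  rw [tentPrim_project hr, show tentPrim a r a = 0 from intervalIntegral.integral_same,
    sub_zero] at h
  exact h.trans (abs_project_sub_self_le hr.le x)

theorem continuous_tentPrim {a r : ℝ} (hr : 0 < r) : Continuous (tentPrim a r) :=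
  LipschitzWith.continuous (K := 1) (LipschitzWith.of_dist_le_mul fun x y => by
    simpa [Real.dist_eq] using abs_tentPrim_sub_le_abs hr x y)

theorem abs_tentPrim_sub_le_overlap {a r y w t u v : ℝ} (hr : 0 < r) (hu : |u - y| ≤ w)
    (hv : |v - y| ≤ w) :
    |tentPrim a r (t - u) - tentPrim a r (t - v)| ≤ overlap y w a r t := by
  rw [← tentPrim_project hr (t - u), ← tentPrim_project hr (t - v)]
  exact (abs_tentPrim_sub_le_abs hr _ _).trans (abs_project_sub_le hr.le hu hv)

/-- The remainder integrates the change of the tent over a segment of length at most `w`; the tent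
is 1/r-Lipschitz in the projection, which gives one overlap. -/
theorem abs_tentPrim_taylor_le {a r w t y : ℝ} (hr : 0 < r) (hy : |y| ≤ w) :
    |tentPrim a r t - tentPrim a r (t - y) - y * tent a r t| ≤
      w * (overlap 0 w a r t / r) := by
  have h1 : tentPrim a r t - tentPrim a r (t - y) - y * tent a r t =
      ∫ s in (t - y)..t, (tent a r s - tent a r t) := by
    rw [intervalIntegral.integral_sub (intervalIntegrable_tent _ _ _ _)
      intervalIntegrable_const, ← tentPrim_sub, intervalIntegral.integral_const, smul_eq_mul]
    ring
  have hw : 0 ≤ w := (abs_nonneg y).trans hy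
  rw [h1, ← Real.norm_eq_abs]
  refine (intervalIntegral.norm_integral_le_of_norm_le_const (C := overlap 0 w a r t / r)
    fun s hs => ?_).trans ?_
  · refine (abs_tent_sub_le hr s t).trans ?_
    gcongr
    have h2 := abs_project_sub_le (y := 0) (w := w) (a := a) (r := r) (t := t) (u := t - s)
      (v := 0) hr.le ?_ (by simpa using hw)
    · simpa using h2
    · rw [sub_zero]
      have : |t - s| ≤ |y| := by
        have := Set.mem_uIoc.1 hs
        grind
      exact this.trans hy
  · rw [mul_comm, sub_sub_cancel]
    gcongr
    exact div_nonneg (overlap_nonneg _ _ _ _ _) hr.le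

theorem measurable_overlap {Ω : Type*} [MeasurableSpace Ω] {y w t : Ω → ℝ} (hy : Measurable y)
    (hw : Measurable w) (ht : Measurable t) (a r : ℝ) :
    Measurable (fun ω => overlap (y ω) (w ω) a r (t ω)) := by
  unfold overlap; fun_prop

end Overlap

/-! ### From conditional concentration to expected overlaps -/

section Decoupling

/-- The σ-algebra is left free because this is applied to the conditioning σ-algebra and not to the
ambient one. -/
theorem measurable_mul_indicator {Ω : Type*} {_ : MeasurableSpace Ω} {ρ y w : Ω → ℝ}
    (hρ : Measurable ρ) (hy : Measurable y) (hw : Measurable w) (u : ℝ) :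
    Measurable (fun ω => ENNReal.ofReal (ρ ω) *
      Set.indicator {p : Ω × ℝ | |p.2 - y p.1| ≤ w p.1} (1 : Ω × ℝ → ENNReal) (ω, u)) := by
  have hset : MeasurableSet {ω | |u - y ω| ≤ w ω} := measurableSet_le (by fun_prop) hw
  exact (ENNReal.measurable_ofReal.comp hρ).mul
    (Measurable.indicator (f := fun _ => (1 : ENNReal)) measurable_const hset)

variable {Ω : Type*} {m : MeasurableSpace Ω} [m0 : MeasurableSpace Ω] {P : Measure Ω} [IsProbabilityMeasure P]

/-- If the intervals of radius `r` have conditional probability at most `c` given `m`, then the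
expected overlap of a random interval with `m`-measurable ends is at most `c` times its mean
length. -/
theorem integral_mul_overlap_le (hm : m ≤ m0) {T : Ω → ℝ}
    (hT : Measurable T) {r c : ℝ} (hc : 0 ≤ c)
    (H : ∀ A, MeasurableSet[m] A → ∀ a, P.real (A ∩ {ω | |T ω - a| ≤ r}) ≤ c * P.real A)
    {ρ y w : Ω → ℝ} (hρ : Measurable[m] ρ) (hy : Measurable[m] y) (hw : Measurable[m] w)
    (hρ0 : ∀ ω, 0 ≤ ρ ω) (hw0 : ∀ ω, 0 ≤ w ω) (hint : Integrable (fun ω => ρ ω * w ω) P)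
    (a : ℝ) :
    Integrable (fun ω => ρ ω * overlap (y ω) (w ω) a r (T ω)) P ∧
      ∫ ω, ρ ω * overlap (y ω) (w ω) a r (T ω) ∂P ≤ 2 * c * ∫ ω, ρ ω * w ω ∂P := by
  have hρ' := hρ.mono hm le_rfl
  have hy' := hy.mono hm le_rfl
  have hw' := hw.mono hm le_rfl
  have hov := measurable_overlap hy' hw' hT a r
  have hI : Integrable (fun ω => ρ ω * overlap (y ω) (w ω) a r (T ω)) P := by
    refine (hint.const_mul 2).mono' (hρ'.mul hov).aestronglyMeasurable
      (Filter.Eventually.of_forall fun ω => ?_)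
    rw [Real.norm_eq_abs, abs_of_nonneg (mul_nonneg (hρ0 ω) (overlap_nonneg _ _ _ _ _))]
    have := mul_le_mul_of_nonneg_left (overlap_le (hw0 ω) (y ω) a r (T ω)) (hρ0 ω)
    linarith
  refine ⟨hI, ?_⟩
  -- On `m`, the hypothesis compares two measures: P restricted to the event and c·P. Integrals of
  -- nonnegative `m`-measurable functions are then compared as well.
  have key : ∀ b : ℝ, ∀ f : Ω → ENNReal, Measurable[m] f →
      ∫⁻ ω in {ω | |T ω - b| ≤ r}, f ω ∂P ≤ ENNReal.ofReal c * ∫⁻ ω, f ω ∂P := by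
    intro b f hf
    rw [← lintegral_trim hm hf, ← lintegral_trim hm hf, ← smul_eq_mul (ENNReal.ofReal c),
      ← lintegral_smul_measure]
    refine lintegral_mono' ?_ le_rfl
    refine Measure.le_iff.2 fun A hA => ?_
    rw [trim_measurableSet_eq hm hA, Measure.smul_apply, trim_measurableSet_eq hm hA,
      Measure.restrict_apply (hm _ hA), smul_eq_mul]
    have := H A hA b
    rw [← ENNReal.ofReal_toReal (measure_ne_top P (A ∩ _)), ← ENNReal.ofReal_toReal
      (measure_ne_top P A), ← ENNReal.ofReal_mul hc]
    exact ENNReal.ofReal_le_ofReal this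
  set S₁ : Set (Ω × ℝ) := {p | |p.2 - y p.1| ≤ w p.1} with hS1
  set S₂ : Set (Ω × ℝ) := {p | |T p.1 - (p.2 + a)| ≤ r} with hS2
  have hmS1 : MeasurableSet S₁ := measurableSet_le (by fun_prop) (by fun_prop)
  have hmS2 : MeasurableSet S₂ := measurableSet_le (by fun_prop) (by fun_prop)
  have e1 : ∀ ω, ENNReal.ofReal (ρ ω * overlap (y ω) (w ω) a r (T ω)) =
      ∫⁻ u, ENNReal.ofReal (ρ ω) * (S₁ ∩ S₂).indicator 1 (ω, u) := fun ω => by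
    rw [ENNReal.ofReal_mul (hρ0 ω), ofReal_overlap, lintegral_const_mul]
    · congr 1
      have hms : MeasurableSet {u : ℝ | |u - y ω| ≤ w ω ∧ |T ω - (u + a)| ≤ r} :=
        measurable_prodMk_left (x := ω) (hmS1.inter hmS2)
      rw [← lintegral_indicator_one hms]
      rfl
    · exact (measurable_one.indicator (hmS1.inter hmS2)).comp measurable_prodMk_left
  have e2 : ∀ ω, ∫⁻ u, ENNReal.ofReal (ρ ω) * S₁.indicator 1 (ω, u) =
      ENNReal.ofReal (2 * (ρ ω * w ω)) := fun ω => by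
    rw [lintegral_const_mul]
    · have hms : MeasurableSet {u : ℝ | |u - y ω| ≤ w ω} :=
        measurable_prodMk_left (x := ω) hmS1
      have h3 : ∫⁻ u, S₁.indicator 1 (ω, u) = volume {u : ℝ | |u - y ω| ≤ w ω} := by
        rw [← lintegral_indicator_one hms]; rfl
      have h4 : {u : ℝ | |u - y ω| ≤ w ω} = Set.Icc (y ω - w ω) (y ω + w ω) := by
        ext u
        simp only [Set.mem_ofPred_eq, Set.mem_Icc, abs_le]
        constructor <;> rintro ⟨h5, h6⟩ <;> constructor <;> linarith
      rw [h3, h4, Real.volume_Icc, ← ENNReal.ofReal_mul (hρ0 ω)]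
      congr 1; ring
    · exact (measurable_one.indicator hmS1).comp measurable_prodMk_left
  have hofρ : Measurable (fun p : Ω × ℝ => ENNReal.ofReal (ρ p.1)) := by fun_prop
  -- Write the overlap as an integral over u and exchange the integrals. For fixed u the weight is
  -- `m`-measurable, so `key` applies at b = u + a; integrating over u again restores the length 2w.
  have hle : ∫⁻ ω, ENNReal.ofReal (ρ ω * overlap (y ω) (w ω) a r (T ω)) ∂P ≤
      ENNReal.ofReal c * ∫⁻ ω, ENNReal.ofReal (2 * (ρ ω * w ω)) ∂P := by
    simp only [e1, ← e2]
    rw [lintegral_lintegral_swap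
        (f := fun ω u => ENNReal.ofReal (ρ ω) * (S₁ ∩ S₂).indicator 1 (ω, u))
        (hofρ.mul (measurable_one.indicator (hmS1.inter hmS2))).aemeasurable,
      lintegral_lintegral_swap (f := fun ω u => ENNReal.ofReal (ρ ω) * S₁.indicator 1 (ω, u))
        (hofρ.mul (measurable_one.indicator hmS1)).aemeasurable,
      ← lintegral_const_mul' _ _ ENNReal.ofReal_ne_top]
    refine lintegral_mono fun u => ?_
    have hmu : Measurable[m] (fun ω => ENNReal.ofReal (ρ ω) * S₁.indicator 1 (ω, u)) :=
      measurable_mul_indicator hρ hy hw u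
    refine le_trans (le_of_eq ?_) (key (u + a) _ hmu)
    rw [← lintegral_indicator (measurableSet_le (by fun_prop) measurable_const)]
    refine lintegral_congr fun ω => ?_
    by_cases h1 : (ω, u) ∈ S₁ <;> by_cases h2 : (ω, u) ∈ S₂
    · have h2' : ω ∈ {ω | |T ω - (u + a)| ≤ r} := h2
      simp [h1, h2, Set.indicator_of_mem h2']
    · have h2' : ω ∉ {ω | |T ω - (u + a)| ≤ r} := h2
      simp [h2, Set.indicator_of_notMem h2']
    · simp [h1, Set.indicator_apply]
    · simp [h1, Set.indicator_apply]
  rw [← ofReal_integral_eq_lintegral_ofReal hI (Filter.Eventually.of_forall fun ω =>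
      mul_nonneg (hρ0 ω) (overlap_nonneg _ _ _ _ _)),
    ← ofReal_integral_eq_lintegral_ofReal (hint.const_mul 2) (Filter.Eventually.of_forall
      fun ω => mul_nonneg zero_le_two (mul_nonneg (hρ0 ω) (hw0 ω))),
    ← ENNReal.ofReal_mul hc, integral_const_mul] at hle
  have h0 : 0 ≤ ∫ ω, ρ ω * w ω ∂P := integral_nonneg fun ω => mul_nonneg (hρ0 ω) (hw0 ω)
  refine ((ENNReal.ofReal_le_ofReal_iff (by positivity)).1 hle).trans_eq (by ring)

end Decoupling

end GraphDep

/-! ### The cut-off normalizer and removal of a neighbourhood -/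

namespace GraphDep

/-- The square root, cut off outside `[1/4, 4]`. -/
noncomputable def clampSqrt (q : ℝ) : ℝ := Real.sqrt (max (1 / 4) (min 4 q))

theorem half_le_clampSqrt (q : ℝ) : 1 / 2 ≤ clampSqrt q :=
  Real.le_sqrt_of_sq_le (le_max_of_le_left (by norm_num))

theorem clampSqrt_le_two (q : ℝ) : clampSqrt q ≤ 2 :=
  Real.sqrt_le_iff.2 ⟨by norm_num, max_le (by norm_num) ((min_le_left _ _).trans (by norm_num))⟩

theorem clampSqrt_pos (q : ℝ) : 0 < clampSqrt q :=
  lt_of_lt_of_le (by norm_num) (half_le_clampSqrt q)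

theorem clampSqrt_eq {q : ℝ} (h1 : 1 / 4 ≤ q) (h2 : q ≤ 4) : clampSqrt q = Real.sqrt q := by
  rw [clampSqrt, min_eq_right h2, max_eq_right h1]

/-- The two roots add up to at least 1, so their difference is at most that of their squares; the
cut-off at 1/4 makes the constant 1. -/
theorem abs_clampSqrt_sub_le (p q : ℝ) : |clampSqrt p - clampSqrt q| ≤ |p - q| := by
  set a := max (1 / 4 : ℝ) (min 4 p) with ha
  set b := max (1 / 4 : ℝ) (min 4 q) with hb
  have h1 : |a - b| ≤ |p - q| := by
    refine (abs_max_sub_max_le_max _ _ _ _).trans (max_le (by simp) ?_)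
    exact (abs_min_sub_min_le_max _ _ _ _).trans (max_le (by simp) le_rfl)
  refine le_trans ?_ h1
  have h2 : a - b = (clampSqrt p - clampSqrt q) * (clampSqrt p + clampSqrt q) := by
    have e1 : clampSqrt p ^ 2 = a := Real.sq_sqrt (le_max_of_le_left (by norm_num))
    have e2 : clampSqrt q ^ 2 = b := Real.sq_sqrt (le_max_of_le_left (by norm_num))
    rw [← e1, ← e2]; ring
  rw [h2, abs_mul]
  refine le_mul_of_one_le_right (abs_nonneg _) ?_
  rw [abs_of_pos (add_pos (clampSqrt_pos p) (clampSqrt_pos q))]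
  linarith [half_le_clampSqrt p, half_le_clampSqrt q]

theorem measurable_clampSqrt : Measurable clampSqrt := by
  unfold clampSqrt; fun_prop

variable {V Ω : Type*} [Fintype V] [DecidableEq V] [MeasurableSpace Ω]

section Definitions

variable (G : SimpleGraph V) [DecidableRel G.Adj] (X : V → Ω → ℝ)

/-- The quadratic form restricted to the vertices outside `A`. -/
def offQuad (A : Finset V) (ω : Ω) : ℝ :=
  ∑ j, ∑ k, if j ∉ A ∧ k ∉ A ∧ k ∈ nbhd G j then X j ω * X k ω else 0

/-- The statistic `S - z √Q` with a cut-off square root. -/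
noncomputable def shifted (z : ℝ) (ω : Ω) : ℝ :=
  ∑ i, X i ω - z * clampSqrt (crossSum G X Finset.univ ω)

/-- The statistic `shifted` computed from the vertices not in the closed neighbourhood of `i`. -/
noncomputable def shiftedOff (z : ℝ) (i : V) (ω : Ω) : ℝ :=
  ∑ j ∈ (nbhd G i)ᶜ, X j ω - z * clampSqrt (offQuad G X (nbhd G i) ω)

/-- A lost product has one factor in the neighbourhood of i and the other adjacent to it, so both
lie in the ball of radius 2. -/
theorem abs_crossSum_sub_offQuad_le (i : V) (ω : Ω) :
    |crossSum G X Finset.univ ω - offQuad G X (nbhd G i) ω| ≤ absSum X (ballTwo G i) ω ^ 2 := by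
  have h1 : crossSum G X Finset.univ ω =
      ∑ j, ∑ k, if k ∈ nbhd G j then X j ω * X k ω else 0 := by
    simp [crossSum, sumY, Finset.mul_sum, Finset.sum_ite_mem]
  have h2 : absSum X (ballTwo G i) ω ^ 2 = ∑ j, ∑ k,
      if j ∈ ballTwo G i then (if k ∈ ballTwo G i then |X j ω| * |X k ω| else 0) else 0 := by
    simp [absSum, sq, Finset.sum_mul_sum, Finset.sum_ite_mem]
  rw [h1, h2, offQuad, ← Finset.sum_sub_distrib]
  refine (Finset.abs_sum_le_sum_abs _ _).trans (Finset.sum_le_sum fun j _ => ?_)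
  rw [← Finset.sum_sub_distrib]
  refine (Finset.abs_sum_le_sum_abs _ _).trans (Finset.sum_le_sum fun k _ => ?_)
  by_cases hk : k ∈ nbhd G j
  · by_cases hA : j ∈ nbhd G i ∨ k ∈ nbhd G i
    · have hB : j ∈ ballTwo G i ∧ k ∈ ballTwo G i := by
        rcases hA with h | h
        · exact ⟨nbhd_subset_ballTwo G i h, (mem_ballTwo G).2 ⟨j, h, hk⟩⟩
        · exact ⟨(mem_ballTwo G).2 ⟨k, h, (mem_nbhd_comm G).1 hk⟩, nbhd_subset_ballTwo G i h⟩
      have hn : ¬ (j ∉ nbhd G i ∧ k ∉ nbhd G i ∧ k ∈ nbhd G j) := by tauto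
      rw [if_pos hk, if_neg hn, if_pos hB.1, if_pos hB.2, sub_zero, abs_mul]
    · push Not at hA
      rw [if_pos hk, if_pos ⟨hA.1, hA.2, hk⟩, sub_self, abs_zero]
      split_ifs <;> positivity
  · have hn : ¬ (j ∉ nbhd G i ∧ k ∉ nbhd G i ∧ k ∈ nbhd G j) := by tauto
    rw [if_neg hk, if_neg hn, sub_self, abs_zero]
    split_ifs <;> positivity

theorem sumS_sub_sumY (i : V) (ω : Ω) :
    ∑ j ∈ (nbhd G i)ᶜ, X j ω = ∑ j, X j ω - sumY G X i ω := by
  rw [sumY, eq_sub_iff_add_eq, add_comm]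
  exact Finset.sum_add_sum_compl _ _

theorem measurable_sigAlg_offQuad (i : V) :
    Measurable[sigAlg X {j | j ∉ nbhd G i}] (offQuad G X (nbhd G i)) :=
  Finset.measurable_fun_sum _ fun j _ => Finset.measurable_fun_sum _ fun k _ => by
    by_cases h : j ∉ nbhd G i ∧ k ∉ nbhd G i ∧ k ∈ nbhd G j
    · simp only [if_pos h]
      exact (measurable_sigAlg_apply X h.1).mul (measurable_sigAlg_apply X h.2.1)
    · simp only [if_neg h]
      exact measurable_const

theorem measurable_sigAlg_sum_compl (i : V) :
    Measurable[sigAlg X {j | j ∉ nbhd G i}] (fun ω => ∑ j ∈ (nbhd G i)ᶜ, X j ω) :=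
  measurable_sigAlg_sum X _ fun j hj => by simpa using hj

theorem measurable_sigAlg_shiftedOff (z : ℝ) (i : V) :
    Measurable[sigAlg X {j | j ∉ nbhd G i}] (shiftedOff G X z i) :=
  (measurable_sigAlg_sum_compl G X i).sub
    (measurable_const.mul (measurable_clampSqrt.comp (measurable_sigAlg_offQuad G X i)))

end Definitions

namespace NormalizedField

variable {P : Measure Ω} [IsProbabilityMeasure P] {G : SimpleGraph V} [DecidableRel G.Adj]
  {X : V → Ω → ℝ} {D κ : ℝ}

theorem measurable_shifted (F : NormalizedField P G X D κ) (z : ℝ) :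
    Measurable (shifted G X z) :=
  (F.measurable_sum _).sub
    (measurable_const.mul (measurable_clampSqrt.comp (F.measurable_crossSum _)))

theorem abs_sumY_le_absSum (i : V) (ω : Ω) :
    |sumY G X i ω| ≤ absSum X (ballTwo G i) ω :=
  (abs_sum_le_absSum X _ ω).trans (absSum_mono X (nbhd_subset_ballTwo G i) ω)

/-- First order expansion of the tent primitive when the neighbourhood of `i` is removed. -/
theorem abs_tentPrim_expansion_le {r : ℝ} (hr : 0 < r)
    (a z : ℝ) (i : V) (ω : Ω) :
    |tentPrim a r (shifted G X z ω) - tentPrim a r (shiftedOff G X z i ω) -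
        sumY G X i ω * tent a r (shifted G X z ω)| ≤
      absSum X (ballTwo G i) ω / r *
          overlap 0 (absSum X (ballTwo G i) ω) a r (shifted G X z ω) +
        overlap (sumY G X i ω) (|z| * absSum X (ballTwo G i) ω ^ 2) a r (shifted G X z ω) := by
  set T := shifted G X z ω with hT
  set Y := sumY G X i ω with hY
  set Z := absSum X (ballTwo G i) ω with hZ
  set e := z * (clampSqrt (crossSum G X Finset.univ ω) -
    clampSqrt (offQuad G X (nbhd G i) ω)) with he
  have h1 : shiftedOff G X z i ω = T - (Y - e) := by
    rw [hT, hY, he, shiftedOff, shifted, sumS_sub_sumY]; ring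
  have h2 : |e| ≤ |z| * Z ^ 2 := by
    rw [he, abs_mul]
    exact mul_le_mul_of_nonneg_left ((abs_clampSqrt_sub_le _ _).trans
      (abs_crossSum_sub_offQuad_le G X i ω)) (abs_nonneg z)
  have h3 := abs_tentPrim_taylor_le (a := a) (t := T) hr (abs_sumY_le_absSum (G := G) (X := X) i ω)
  have h4 := abs_tentPrim_sub_le_overlap (a := a) (r := r) (t := T) (y := Y) (u := Y)
    (v := Y - e) (w := |z| * Z ^ 2) hr (by rw [sub_self, abs_zero]; positivity)
    (by rwa [sub_sub_cancel_left, abs_neg])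
  rw [h1]
  calc _ = |(tentPrim a r T - tentPrim a r (T - Y) - Y * tent a r T) +
        (tentPrim a r (T - Y) - tentPrim a r (T - (Y - e)))| := by congr 1; ring
    _ ≤ _ := (abs_add_le _ _).trans (add_le_add (h3.trans_eq (by ring)) h4)

theorem integrable_bdd_mul {f g : Ω → ℝ} {c : ℝ}
    (hf : Integrable f P) (hg : Measurable g) (hb : ∀ ω, |g ω| ≤ c) :
    Integrable (fun ω => g ω * f ω) P :=
  hf.bdd_mul hg.aestronglyMeasurable (Filter.Eventually.of_forall hb)

theorem integral_mul_of_separated (F : NormalizedField P G X D κ) {M N : Set V}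
    (h : Separated G M N) {ξ η : Ω → ℝ} (hξ : Measurable[sigAlg X M] ξ)
    (hη : Measurable[sigAlg X N] η) :
    ∫ ω, ξ ω * η ω ∂P = (∫ ω, ξ ω ∂P) * ∫ ω, η ω ∂P :=
  (F.dep.indepFun h hξ hη).integral_fun_mul_eq_mul_integral
    (hξ.mono (sigAlg_le F.meas M) le_rfl).aestronglyMeasurable
    (hη.mono (sigAlg_le F.meas N) le_rfl).aestronglyMeasurable

theorem measurable_sigAlg_absSum (X : V → Ω → ℝ) (A : Finset V) :
    Measurable[sigAlg X (A : Set V)] (absSum X A) :=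
  measurable_sigAlg_abs_sum X A fun _ h => h

theorem sum_integral_ballTwo_le (F : NormalizedField P G X D κ) (J : Finset V) :
    ∑ i ∈ J, ∫ ω, |X i ω| * absSum X (ballTwo G i) ω * absSum X (ballTwo G i) ω ∂P ≤
      D ^ 6 * κ ^ 3 := by
  have hD0 := F.pos_D
  have hκ := F.pos
  refine (F.sum_integral_triple_le (fun i j => (mem_ballTwo_comm G).1)
    (card_ballTwo_le G F.card_le hD0.le) (by positivity) J).trans ?_
  rw [← pow_mul]
  gcongr
  · exact F.one_le
  · norm_num

/-- The vertices not far from `M` are covered by the balls of radius 3 around `M`. Discarding them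
must leave the variance near 1. -/
theorem card_near_le (F : NormalizedField P G X D κ) (M : Finset V) :
    (((Finset.univ.filter fun i => ∀ j ∈ M, j ∉ ballThree G i)ᶜ.card : ℕ) : ℝ) ≤
      D ^ 3 * M.card := by
  have h1 : (Finset.univ.filter fun i => ∀ j ∈ M, j ∉ ballThree G i)ᶜ ⊆
      M.biUnion (ballThree G) := by
    intro i hi
    simp only [Finset.mem_compl, Finset.mem_filter, Finset.mem_univ, true_and, not_forall,
      not_not] at hi
    obtain ⟨j, hj, hji⟩ := hi
    exact Finset.mem_biUnion.2 ⟨j, hj, (mem_ballThree_comm G).1 hji⟩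
  calc _ ≤ ((M.biUnion (ballThree G)).card : ℝ) := by exact_mod_cast Finset.card_le_card h1
    _ ≤ ((∑ i ∈ M, (ballThree G i).card : ℕ) : ℝ) := by exact_mod_cast Finset.card_biUnion_le
    _ = ∑ i ∈ M, ((ballThree G i).card : ℝ) := by push_cast; rfl
    _ ≤ ∑ _i ∈ M, D ^ 3 :=
        Finset.sum_le_sum fun i _ => card_ballThree_le G F.card_le F.pos_D.le i
    _ = D ^ 3 * M.card := by simp [mul_comm]

/-- The tent that is at least 1/2 on radius α has half-width 2α; two intervals of radius α cover its
support. -/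
theorem probReal_double_le {M : Set V} {z α c : ℝ}
    (H : ∀ A, MeasurableSet[sigAlg X M] A → ∀ a,
      P.real (A ∩ {ω | |shifted G X z ω - a| ≤ α}) ≤ c * P.real A) (A : Set Ω)
    (hA : MeasurableSet[sigAlg X M] A) (a : ℝ) :
    P.real (A ∩ {ω | |shifted G X z ω - a| ≤ 2 * α}) ≤ 2 * c * P.real A := by
  have h1 : A ∩ {ω | |shifted G X z ω - a| ≤ 2 * α} ⊆
      (A ∩ {ω | |shifted G X z ω - (a - α)| ≤ α}) ∪
        (A ∩ {ω | |shifted G X z ω - (a + α)| ≤ α}) := by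
    rintro ω ⟨hω, h⟩
    simp only [Set.mem_ofPred_eq] at h
    obtain ⟨h3, h4⟩ := abs_le.1 h
    rcases le_total (shifted G X z ω) a with h2 | h2
    · have h5 : |shifted G X z ω - (a - α)| ≤ α := abs_le.2 ⟨by linarith, by linarith⟩
      exact Or.inl ⟨hω, h5⟩
    · have h5 : |shifted G X z ω - (a + α)| ≤ α := abs_le.2 ⟨by linarith, by linarith⟩
      exact Or.inr ⟨hω, h5⟩
  have h2 := (measureReal_mono (μ := P) h1 (measure_ne_top _ _)).trans
    (measureReal_union_le _ _)
  linarith [H A hA (a - α), H A hA (a + α)]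

end NormalizedField

end GraphDep

/-! ### The conditional concentration inequality -/

namespace GraphDep

namespace NormalizedField

variable {V Ω : Type*} [Fintype V] [DecidableEq V] [MeasurableSpace Ω]
  {P : Measure Ω} [IsProbabilityMeasure P] {G : SimpleGraph V} [DecidableRel G.Adj]
  {X : V → Ω → ℝ} {D κ : ℝ}

/-- One summand of the concentration argument: removing the neighbourhood of a vertex far from `M`
changes the weighted mean of the tent primitive by the expected first order term, up to a small
multiple of the concentration bound. -/
theorem abs_integral_expansion_le (F : NormalizedField P G X D κ) {z α c : ℝ} (hα : 0 < α)
    (hc : 0 ≤ c) {M : Finset V} {i : V} (hi : ∀ j ∈ M, j ∉ ballThree G i)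
    (H : ∀ A, MeasurableSet[sigAlg X ((M ∪ ballTwo G i : Finset V) : Set V)] A → ∀ a,
      P.real (A ∩ {ω | |shifted G X z ω - a| ≤ α}) ≤ c * P.real A)
    {ξ : Ω → ℝ} (hξ : Measurable[sigAlg X (M : Set V)] ξ) (hξ0 : ∀ ω, 0 ≤ ξ ω)
    (hξ1 : ∀ ω, ξ ω ≤ 1) (a : ℝ) :
    |∫ ω, ξ ω * (X i ω * tentPrim a (2 * α) (shifted G X z ω)) ∂P -
        ∫ ω, ξ ω * tent a (2 * α) (shifted G X z ω) * (X i ω * sumY G X i ω) ∂P| ≤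
      c * (2 / α + 4 * |z|) * ((∫ ω, ξ ω ∂P) *
        ∫ ω, |X i ω| * absSum X (ballTwo G i) ω * absSum X (ballTwo G i) ω ∂P) := by
  set r := 2 * α with hr
  have hr0 : 0 < r := by positivity
  set T := shifted G X z with hT
  set Z := absSum X (ballTwo G i) with hZ
  set Y := sumY G X i with hY
  set B : Set V := ((M ∪ ballTwo G i : Finset V) : Set V) with hB
  have hTm : Measurable T := F.measurable_shifted z
  have hξm : Measurable ξ := hξ.mono (sigAlg_le F.meas _) le_rfl
  have hξb : ∀ ω, |ξ ω| ≤ 1 := fun ω => by rw [abs_of_nonneg (hξ0 ω)]; exact hξ1 ω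
  have hfm : Measurable (tentPrim a r) := (continuous_tentPrim hr0).measurable
  have htm : Measurable (tent a r) := (continuous_tent a r).measurable
  have hZ0 : ∀ ω, 0 ≤ Z ω := absSum_nonneg X _
  have hsub1 : (M : Set V) ⊆ B := by simp [hB]
  have hsub2 : ((ballTwo G i : Finset V) : Set V) ⊆ B := by simp [hB]
  have hξB : Measurable[sigAlg X B] ξ := hξ.mono (sigAlg_mono X hsub1) le_rfl
  have hZB : Measurable[sigAlg X B] Z :=
    (measurable_sigAlg_absSum X _).mono (sigAlg_mono X hsub2) le_rfl
  have hXB : Measurable[sigAlg X B] (X i) :=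
    measurable_sigAlg_apply X (hsub2 (self_mem_ballTwo G i))
  have hYB : Measurable[sigAlg X B] Y :=
    measurable_sigAlg_sum X _ fun j hj => hsub2 (nbhd_subset_ballTwo G i hj)
  have hint := F.integrable_mul_absSum_mul_absSum i (ballTwo G i) (ballTwo G i)
  have hintξ : Integrable (fun ω => ξ ω * (|X i ω| * Z ω * Z ω)) P :=
    integrable_bdd_mul hint hξm hξb
  have hindep : ∫ ω, ξ ω * (|X i ω| * Z ω * Z ω) ∂P =
      (∫ ω, ξ ω ∂P) * ∫ ω, |X i ω| * Z ω * Z ω ∂P := by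
    refine F.integral_mul_of_separated (separated_of_ballThree hi).symm hξ ?_
    exact ((continuous_abs.measurable.comp (measurable_sigAlg_apply X
      (self_mem_ballTwo G i))).mul (measurable_sigAlg_absSum X _)).mul
        (measurable_sigAlg_absSum X _)
  have hsep : Separated G {i} {j | j ∉ nbhd G i} := separated_nbhd_compl i
  have hMsub : (M : Set V) ⊆ {j | j ∉ nbhd G i} := fun j hj hij =>
    hi j hj (ballTwo_subset_ballThree G i (nbhd_subset_ballTwo G i hij))
  have hTi : Measurable (shiftedOff G X z i) :=
    (measurable_sigAlg_shiftedOff G X z i).mono (sigAlg_le F.meas _) le_rfl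
  -- `M` avoids the neighbourhood of i, so ξ and the reduced statistic together are independent of
  -- the centred `X i`.
  have hzero : ∫ ω, X i ω * (ξ ω * tentPrim a r (shiftedOff G X z i ω)) ∂P = 0 := by
    rw [F.integral_mul_of_separated hsep (measurable_sigAlg_apply X rfl), F.mean i, zero_mul]
    exact (hξ.mono (sigAlg_mono X hMsub) le_rfl).mul
      (hfm.comp (measurable_sigAlg_shiftedOff G X z i))
  have hI1 : Integrable (fun ω => ξ ω * (X i ω * tentPrim a r (T ω))) P := by
    have := integrable_bdd_mul (F.integrable i) (hξm.mul (hfm.comp hTm)) (c := 1 * r)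
      fun ω => by
        rw [Pi.mul_apply, abs_mul]
        exact mul_le_mul (hξb ω) (abs_tentPrim_le hr0 _) (abs_nonneg _) zero_le_one
    refine this.congr (Filter.Eventually.of_forall fun ω => ?_)
    simp only [Pi.mul_apply, Function.comp]; ring
  have hI2 : Integrable (fun ω => X i ω * (ξ ω * tentPrim a r (shiftedOff G X z i ω))) P := by
    have := integrable_bdd_mul (F.integrable i) (hξm.mul (hfm.comp hTi)) (c := 1 * r)
      fun ω => by
        rw [Pi.mul_apply, abs_mul]
        exact mul_le_mul (hξb ω) (abs_tentPrim_le hr0 _) (abs_nonneg _) zero_le_one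
    refine this.congr (Filter.Eventually.of_forall fun ω => ?_)
    simp only [Pi.mul_apply, Function.comp]; ring
  have hI3 : Integrable (fun ω => ξ ω * tent a r (T ω) * (X i ω * Y ω)) P :=
    integrable_bdd_mul (F.integrable_mul_sumY i) (hξm.mul (htm.comp hTm)) (c := 1 * 1)
      fun ω => by
        rw [abs_mul]
        refine mul_le_mul (hξb ω) ?_ (abs_nonneg _) zero_le_one
        rw [abs_of_nonneg (tent_nonneg _ _ _)]
        exact tent_le_one hr0 _ _
  have hsig := sigAlg_le F.meas B
  -- The Taylor remainder from removing Y, with increments in [-Z, Z]; the factor 2 in `2 * c` pays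
  -- for the radius 2α.
  have hdec1 := integral_mul_overlap_le hsig hTm (r := r) (c := 2 * c) (by positivity)
    (probReal_double_le H) (ρ := fun ω => ξ ω * |X i ω| * (Z ω / r)) (y := fun _ => 0) (w := Z)
    ((hξB.mul (continuous_abs.measurable.comp hXB)).mul (hZB.div_const r)) measurable_const hZB
    (fun ω => mul_nonneg (mul_nonneg (hξ0 ω) (abs_nonneg _)) (div_nonneg (hZ0 ω) hr0.le)) hZ0
    ((hintξ.div_const r).congr (Filter.Eventually.of_forall fun ω => by simp only; ring)) a
  -- The change of normalizer: the removed amount stays within |z|Z² of Y.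
  have hdec2 := integral_mul_overlap_le hsig hTm (r := r) (c := 2 * c) (by positivity)
    (probReal_double_le H) (ρ := fun ω => ξ ω * |X i ω|) (y := Y)
    (w := fun ω => |z| * Z ω ^ 2)
    (hξB.mul (continuous_abs.measurable.comp hXB)) hYB (measurable_const.mul (hZB.pow_const 2))
    (fun ω => mul_nonneg (hξ0 ω) (abs_nonneg _)) (fun ω => by positivity)
    ((hintξ.const_mul |z|).congr (Filter.Eventually.of_forall fun ω => by simp only; ring)) a
  have e1 : ∫ ω, ξ ω * |X i ω| * (Z ω / r) * Z ω ∂P =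
      (∫ ω, ξ ω * (|X i ω| * Z ω * Z ω) ∂P) / r := by
    rw [← integral_div]; congr 1; ext ω; ring
  have e2 : ∫ ω, ξ ω * |X i ω| * (|z| * Z ω ^ 2) ∂P =
      |z| * ∫ ω, ξ ω * (|X i ω| * Z ω * Z ω) ∂P := by
    rw [← integral_const_mul]; congr 1; ext ω; ring
  rw [e1] at hdec1
  rw [e2] at hdec2
  have hdiff : ∫ ω, ξ ω * (X i ω * tentPrim a r (T ω)) ∂P -
      ∫ ω, ξ ω * tent a r (T ω) * (X i ω * Y ω) ∂P =
      ∫ ω, (ξ ω * (X i ω * tentPrim a r (T ω)) -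
        X i ω * (ξ ω * tentPrim a r (shiftedOff G X z i ω)) -
        ξ ω * tent a r (T ω) * (X i ω * Y ω)) ∂P := by
    rw [integral_sub_sub hI1 hI2 hI3, hzero, sub_zero]
  rw [hdiff]
  refine abs_integral_le_integral_abs.trans ((integral_mono ((hI1.sub hI2).sub hI3).abs
    (hdec1.1.add hdec2.1) fun ω => ?_).trans ?_)
  · simp only [Pi.add_apply]
    have h1 := abs_tentPrim_expansion_le (G := G) (X := X) hr0 a z i ω
    have h2 : ξ ω * (X i ω * tentPrim a r (T ω)) -
        X i ω * (ξ ω * tentPrim a r (shiftedOff G X z i ω)) -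
        ξ ω * tent a r (T ω) * (X i ω * Y ω) =
        ξ ω * X i ω * (tentPrim a r (T ω) - tentPrim a r (shiftedOff G X z i ω) -
          Y ω * tent a r (T ω)) := by ring
    have h3 : |(ξ ω * (X i ω * tentPrim a r (T ω)) -
        X i ω * (ξ ω * tentPrim a r (shiftedOff G X z i ω)) -
        ξ ω * tent a r (T ω) * (X i ω * Y ω))| ≤ ξ ω * |X i ω| *
          (Z ω / r * overlap 0 (Z ω) a r (T ω) +
            overlap (Y ω) (|z| * Z ω ^ 2) a r (T ω)) := by
      rw [h2, abs_mul, abs_mul, abs_of_nonneg (hξ0 ω)]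
      exact mul_le_mul_of_nonneg_left h1 (mul_nonneg (hξ0 ω) (abs_nonneg _))
    refine h3.trans_eq (by ring)
  · simp only [Pi.add_apply]
    rw [integral_add hdec1.1 hdec2.1, ← hindep]
    refine (add_le_add hdec1.2 hdec2.2).trans_eq ?_
    rw [hr]; field_simp; ring

/-- One step of the recursion for the conditional concentration inequality. -/
theorem concentration_step (F : NormalizedField P G X D κ) {z α c : ℝ} (hα : 0 < α)
    (hα' : 64 * (D ^ 6 * κ ^ 3) ≤ α) (hz : |z| * (D ^ 6 * κ ^ 3) ≤ 1 / 128) (hc : 0 ≤ c)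
    {M : Finset V} (hM : D * (D ^ 3 * M.card) * κ ^ 2 ≤ 1 / 16)
    (H : ∀ i, ∀ A, MeasurableSet[sigAlg X ((M ∪ ballTwo G i : Finset V) : Set V)] A → ∀ a,
      P.real (A ∩ {ω | |shifted G X z ω - a| ≤ α}) ≤ c * P.real A)
    {A : Set Ω} (hA : MeasurableSet[sigAlg X (M : Set V)] A) (a : ℝ) :
    P.real (A ∩ {ω | |shifted G X z ω - a| ≤ α}) ≤ (17 * α + c / 4) * P.real A := by
  set r := 2 * α with hr
  have hr0 : 0 < r := by positivity
  have hD0 := F.pos_D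
  have hκ0 := F.pos
  set T := shifted G X z with hT
  -- Only far vertices are expanded, so that their balls of radius 2 are independent of A; few
  -- enough are dropped for the quadratic form over `J` to keep mean at least 15/16.
  set J : Finset V := Finset.univ.filter fun i => ∀ j ∈ M, j ∉ ballThree G i with hJ
  have hJi : ∀ i ∈ J, ∀ j ∈ M, j ∉ ballThree G i := fun i hi => (Finset.mem_filter.1 hi).2
  have hJc : D * (Jᶜ.card : ℝ) * κ ^ 2 ≤ 1 / 16 := by
    refine le_trans ?_ hM
    gcongr
    exact F.card_near_le M
  have hAm : MeasurableSet A := sigAlg_le F.meas _ _ hA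
  set ξ : Ω → ℝ := A.indicator 1 with hξd
  have hξ : Measurable[sigAlg X (M : Set V)] ξ :=
    Measurable.indicator (f := fun _ => (1 : ℝ)) measurable_const hA
  have hξm : Measurable ξ := hξ.mono (sigAlg_le F.meas _) le_rfl
  have hξ0 : ∀ ω, 0 ≤ ξ ω := fun ω => Set.indicator_nonneg (fun _ _ => zero_le_one) ω
  have hξ1 : ∀ ω, ξ ω ≤ 1 := fun ω => Set.indicator_le_self' (fun _ _ => zero_le_one) ω
  have hξb : ∀ ω, |ξ ω| ≤ 1 := fun ω => by rw [abs_of_nonneg (hξ0 ω)]; exact hξ1 ω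
  have hξint : ∫ ω, ξ ω ∂P = P.real A := integral_indicator_one hAm
  have hξI : Integrable ξ P := (integrable_const (1 : ℝ)).mono' hξm.aestronglyMeasurable
    (Filter.Eventually.of_forall hξb)
  have hTm : Measurable T := F.measurable_shifted z
  have hfm : Measurable (tentPrim a r) := (continuous_tentPrim hr0).measurable
  have htm : Measurable (tent a r) := (continuous_tent a r).measurable
  have htb : ∀ x, |tent a r x| ≤ 1 := fun x => by
    rw [abs_of_nonneg (tent_nonneg _ _ _)]; exact tent_le_one hr0 _ _
  set N : Set V := {k | ∃ i ∈ J, k ∈ ballTwo G i} with hN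
  have hsep : Separated G (M : Set V) N := by
    intro j hj k hk
    obtain ⟨i, hi, hki⟩ := hk
    exact (separated_of_ballThree (hJi i hi)).symm j hj k hki
  have hNJ : ∀ i ∈ J, i ∈ N := fun i hi => ⟨i, hi, self_mem_ballTwo G i⟩
  have hsumN : Measurable[sigAlg X N] (fun ω => ∑ i ∈ J, X i ω) := measurable_sigAlg_sum X J hNJ
  have hcrossN : Measurable[sigAlg X N] (crossSum G X J) :=
    Finset.measurable_fun_sum J fun i hi => (measurable_sigAlg_apply X (hNJ i hi)).mul
      (measurable_sigAlg_sum X _ fun j hj => ⟨i, hi, nbhd_subset_ballTwo G i hj⟩)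
  -- the first moment term
  have hfirst : |∫ ω, ξ ω * ((∑ i ∈ J, X i ω) * tentPrim a r (T ω)) ∂P| ≤
      4 * α * P.real A := by
    have h1 : ∫ ω, ξ ω * |∑ i ∈ J, X i ω| ∂P = P.real A * ∫ ω, |∑ i ∈ J, X i ω| ∂P := by
      rw [← hξint]
      exact F.integral_mul_of_separated hsep hξ (continuous_abs.measurable.comp hsumN)
    have hI : Integrable (fun ω => ξ ω * |∑ i ∈ J, X i ω|) P :=
      integrable_bdd_mul (F.integrable_sum J).abs hξm hξb
    have h2 : ‖∫ ω, ξ ω * ((∑ i ∈ J, X i ω) * tentPrim a r (T ω)) ∂P‖ ≤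
        ∫ ω, r * (ξ ω * |∑ i ∈ J, X i ω|) ∂P := by
      refine norm_integral_le_of_norm_le (hI.const_mul r) (Filter.Eventually.of_forall fun ω => ?_)
      rw [Real.norm_eq_abs, abs_mul, abs_mul, abs_of_nonneg (hξ0 ω)]
      have := mul_le_mul_of_nonneg_left (abs_tentPrim_le (a := a) hr0 (T ω))
        (mul_nonneg (hξ0 ω) (abs_nonneg (∑ i ∈ J, X i ω)))
      linarith
    rw [Real.norm_eq_abs, integral_const_mul, h1] at h2
    refine h2.trans ?_
    have h3 := mul_le_mul_of_nonneg_left (F.integral_abs_sum_le hJc)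
      (measureReal_nonneg (μ := P) (s := A))
    have h4 := mul_le_mul_of_nonneg_left h3 hr0.le
    rw [hr] at h4 ⊢
    linarith
  -- the expansion
  have hIf : ∀ i, Integrable (fun ω => ξ ω * (X i ω * tentPrim a r (T ω))) P := fun i => by
    have := integrable_bdd_mul (F.integrable i) (hξm.mul (hfm.comp hTm)) (c := 1 * r)
      fun ω => by
        rw [Pi.mul_apply, abs_mul]
        exact mul_le_mul (hξb ω) (abs_tentPrim_le hr0 _) (abs_nonneg _) zero_le_one
    refine this.congr (Filter.Eventually.of_forall fun ω => ?_)
    simp only [Pi.mul_apply, Function.comp]; ring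
  have hξt : ∀ ω, |(ξ * tent a r ∘ T) ω| ≤ 1 := fun ω => by
    rw [Pi.mul_apply, abs_mul]
    exact mul_le_one₀ (hξb ω) (abs_nonneg _) (htb _)
  have hξtm : Measurable (ξ * tent a r ∘ T) := hξm.mul (htm.comp hTm)
  have hIt : ∀ i, Integrable (fun ω => ξ ω * tent a r (T ω) * (X i ω * sumY G X i ω)) P :=
    fun i => integrable_bdd_mul (F.integrable_mul_sumY i) hξtm hξt
  have hexp : |∫ ω, ξ ω * ((∑ i ∈ J, X i ω) * tentPrim a r (T ω)) ∂P -
      ∫ ω, ξ ω * tent a r (T ω) * crossSum G X J ω ∂P| ≤ c / 16 * P.real A := by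
    have e1 : ∫ ω, ξ ω * ((∑ i ∈ J, X i ω) * tentPrim a r (T ω)) ∂P =
        ∑ i ∈ J, ∫ ω, ξ ω * (X i ω * tentPrim a r (T ω)) ∂P := by
      rw [← integral_finsetSum J fun i _ => hIf i]
      simp only [Finset.mul_sum, Finset.sum_mul]
    have e2 : ∫ ω, ξ ω * tent a r (T ω) * crossSum G X J ω ∂P =
        ∑ i ∈ J, ∫ ω, ξ ω * tent a r (T ω) * (X i ω * sumY G X i ω) ∂P := by
      rw [← integral_finsetSum J fun i _ => hIt i]
      simp only [crossSum, Finset.mul_sum]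
    rw [e1, e2, ← Finset.sum_sub_distrib]
    refine (Finset.abs_sum_le_sum_abs _ _).trans ((Finset.sum_le_sum fun i hi =>
      F.abs_integral_expansion_le hα hc (hJi i hi) (H i) hξ hξ0 hξ1 a).trans ?_)
    rw [← Finset.mul_sum, ← Finset.mul_sum, hξint]
    have h1 := F.sum_integral_ballTwo_le J
    have hA0 := measureReal_nonneg (μ := P) (s := A)
    -- The lower bound on α and the upper bound on |z| contribute 1/32 each. The total 1/16 becomes
    -- the contraction factor 1/4 below.
    have h2 : (2 / α + 4 * |z|) * (D ^ 6 * κ ^ 3) ≤ 1 / 16 := by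
      have h3 : 2 / α * (D ^ 6 * κ ^ 3) ≤ 1 / 32 := by
        rw [div_mul_eq_mul_div, div_le_iff₀ hα]; linarith
      linarith
    calc _ ≤ c * (2 / α + 4 * |z|) * (P.real A * (D ^ 6 * κ ^ 3)) := by gcongr
      _ = c * P.real A * ((2 / α + 4 * |z|) * (D ^ 6 * κ ^ 3)) := by ring
      _ ≤ c * P.real A * (1 / 16) := by gcongr
      _ = _ := by ring
  -- lower bound of the main term
  have hdefect : ∫ ω, max (1 / 2 - crossSum G X J ω) 0 ∂P ≤ α / 8 := by
    have h1 := F.integral_crossSum_dev_le J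
    have h2 := F.integral_crossSum_ge hJc
    refine (integral_mono (((integrable_const _).sub (F.integrable_crossSum J)).sup
      (integrable_const 0)) ((((F.integrable_crossSum J).sub (integrable_const _)).abs.sub
        (integrable_const _)).sup (integrable_const 0)) fun ω => ?_).trans (h1.trans (by linarith))
    refine max_le_max ?_ le_rfl
    have := neg_abs_le (crossSum G X J ω - ∫ ω', crossSum G X J ω' ∂P)
    simp only [Pi.sub_apply]
    linarith
  have hDI : Integrable (fun ω => max (1 / 2 - crossSum G X J ω) 0) P :=
    ((integrable_const _).sub (F.integrable_crossSum J)).sup (integrable_const 0)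
  have hdefξ : ∫ ω, ξ ω * max (1 / 2 - crossSum G X J ω) 0 ∂P ≤ P.real A * (α / 8) := by
    rw [F.integral_mul_of_separated hsep (η := fun ω => max (1 / 2 - crossSum G X J ω) 0) hξ
        ((measurable_const.sub hcrossN).max measurable_const),
      hξint]
    exact mul_le_mul_of_nonneg_left hdefect measureReal_nonneg
  set E : Set Ω := {ω | |T ω - a| ≤ α} with hE
  have hEm : MeasurableSet E := measurableSet_le (by fun_prop) measurable_const
  -- For 0 ≤ t ≤ 1, tQ + (1/2 - Q)₊ ≥ t/2, and t ≥ 1/2 on `E`. The defect (1/2 - Q)₊ depends on far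
  -- vertices only, so its mean factors off P(A).
  have hlow : P.real (A ∩ E) / 4 ≤ ∫ ω, ξ ω * tent a r (T ω) * crossSum G X J ω ∂P +
      P.real A * (α / 8) := by
    have hIc : Integrable (fun ω => ξ ω * tent a r (T ω) * crossSum G X J ω) P :=
      integrable_bdd_mul (F.integrable_crossSum J) hξtm hξt
    have hId : Integrable (fun ω => ξ ω * max (1 / 2 - crossSum G X J ω) 0) P :=
      integrable_bdd_mul hDI hξm hξb
    have h1 : ∫ ω, (A ∩ E).indicator 1 ω / 4 ∂P ≤ ∫ ω, (ξ ω * tent a r (T ω) * crossSum G X J ω +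
        ξ ω * max (1 / 2 - crossSum G X J ω) 0) ∂P := by
      refine integral_mono (((integrable_const (1 : ℝ)).indicator (hAm.inter hEm)).div_const 4)
        (hIc.add hId) fun ω => ?_
      simp only
      have ht0 := tent_nonneg a r (T ω)
      have ht1 := tent_le_one hr0 a (T ω)
      have hm1 := le_max_left (1 / 2 - crossSum G X J ω) 0
      have hm2 := le_max_right (1 / 2 - crossSum G X J ω) 0
      have h3 : tent a r (T ω) / 2 ≤ tent a r (T ω) * crossSum G X J ω +
          max (1 / 2 - crossSum G X J ω) 0 := by
        nlinarith [mul_le_mul_of_nonneg_left hm1 ht0, mul_le_mul_of_nonneg_right ht1 hm2]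
      by_cases hω : ω ∈ A
      · have hξω : ξ ω = 1 := by simp [hξd, hω]
        rw [hξω, one_mul, one_mul]
        by_cases hω2 : ω ∈ E
        · rw [Set.indicator_of_mem (show ω ∈ A ∩ E from ⟨hω, hω2⟩)]
          have := half_le_tent hα hω2
          simp only [Pi.one_apply]
          rw [← hr] at this
          linarith
        · rw [Set.indicator_of_notMem (fun h => hω2 h.2)]
          linarith
      · have hξω : ξ ω = 0 := by simp [hξd, hω]
        rw [hξω, Set.indicator_of_notMem (fun h => hω h.1)]
        simp
    rw [integral_div, integral_indicator_one (hAm.inter hEm), integral_add hIc hId] at h1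
    linarith
  have h5 := abs_le.1 hfirst
  have h6 := abs_le.1 hexp
  have hA0 := measureReal_nonneg (μ := P) (s := A)
  -- Four times 4α + c/16 + α/8 is 16.5α + c/4.
  nlinarith [mul_nonneg hA0 hα.le]

/-- Concentration of the shifted statistic conditionally on few of the variables. -/
theorem concentration (F : NormalizedField P G X D κ) {z α : ℝ} (hα : 0 < α)
    (hα' : 64 * (D ^ 6 * κ ^ 3) ≤ α) (hz : |z| * (D ^ 6 * κ ^ 3) ≤ 1 / 128) {m : ℝ}
    (hm : D ^ 4 * m * κ ^ 2 ≤ 1 / 16) (l : ℕ) :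
    ∀ M : Finset V, M.card + l * D ^ 2 ≤ m → ∀ A, MeasurableSet[sigAlg X (M : Set V)] A → ∀ a,
      P.real (A ∩ {ω | |shifted G X z ω - a| ≤ α}) ≤
        (28 * α + (1 / 2) ^ l) * P.real A := by
  induction l with
  | zero =>
    intro M _ A _ a
    have h1 : P.real (A ∩ {ω | |shifted G X z ω - a| ≤ α}) ≤ P.real A :=
      measureReal_mono Set.inter_subset_left (measure_ne_top _ _)
    have h2 := mul_nonneg hα.le (measureReal_nonneg (μ := P) (s := A))
    rw [pow_zero]
    linarith
  | succ l ih =>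
    intro M hM A hA a
    have hD0 := F.pos_D
    have hκ := F.pos
    push_cast at hM
    have hM' : D * (D ^ 3 * M.card) * κ ^ 2 ≤ 1 / 16 := by
      refine le_trans ?_ hm
      have h1 : (M.card : ℝ) ≤ m := by nlinarith [show (0 : ℝ) ≤ (l + 1) * D ^ 2 by positivity]
      calc D * (D ^ 3 * M.card) * κ ^ 2 = D ^ 4 * M.card * κ ^ 2 := by ring
        _ ≤ D ^ 4 * m * κ ^ 2 := by gcongr
    -- With c = 28α + 2^(-l) the step returns 24α + 2^(-l)/4. Each level adds at most D² vertices to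
    -- `M`, for which the hypothesis on the cardinality reserves room.
    have h := F.concentration_step hα hα' hz (c := 28 * α + (1 / 2) ^ l) (by positivity) hM'
      (fun i => ih (M ∪ ballTwo G i) ?_) hA a
    · refine h.trans (mul_le_mul_of_nonneg_right ?_ measureReal_nonneg)
      rw [pow_succ]
      have : (0 : ℝ) < (1 / 2) ^ l := by positivity
      linarith
    · have h1 : ((M ∪ ballTwo G i).card : ℝ) ≤ M.card + (ballTwo G i).card := by
        exact_mod_cast Finset.card_union_le _ _
      have h2 := card_ballTwo_le G F.card_le hD0.le i
      linarith

end NormalizedField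

end GraphDep

namespace GraphDep

/-- Sixth power of n ≤ 6·2^⌊n/6⌋; the constant is 6⁶. -/
theorem pow_six_le_two_pow (n : ℕ) : (n : ℝ) ^ 6 ≤ 46656 * 2 ^ n := by
  have h1 : n / 6 + 1 ≤ 2 ^ (n / 6) := Nat.lt_two_pow_self
  have h2 : n ≤ 6 * 2 ^ (n / 6) := by omega
  have h3 : n ^ 6 ≤ 46656 * 2 ^ n := by
    calc n ^ 6 ≤ (6 * 2 ^ (n / 6)) ^ 6 := Nat.pow_le_pow_left h2 6
      _ = 46656 * 2 ^ (n / 6 * 6) := by rw [mul_pow, ← pow_mul]; norm_num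
      _ ≤ 46656 * 2 ^ n :=
        Nat.mul_le_mul_left _ (Nat.pow_le_pow_right (by norm_num) (Nat.div_mul_le_self n 6))
  exact_mod_cast h3

namespace NormalizedField

variable {V Ω : Type*} [Fintype V] [DecidableEq V] [MeasurableSpace Ω]
  {P : Measure Ω} [IsProbabilityMeasure P] {G : SimpleGraph V} [DecidableRel G.Adj]
  {X : V → Ω → ℝ} {D κ : ℝ}

theorem kappa_le (F : NormalizedField P G X D κ) (hs : D ^ 4 * κ ≤ 1 / 64) : κ ≤ 1 / 64 := by
  have h1 : 1 ≤ D ^ 4 := one_le_pow₀ F.one_le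
  nlinarith [F.pos]

/-- The shifted statistic is concentrated conditionally on the variables in a ball of radius
`2`. -/
theorem concentration_ball (F : NormalizedField P G X D κ) (hs : D ^ 4 * κ ≤ 1 / 64) {z : ℝ}
    (hz : |z| * (D ^ 6 * κ ^ 3) ≤ 1 / 128) (i : V) {A : Set Ω}
    (hA : MeasurableSet[sigAlg X ((ballTwo G i : Finset V) : Set V)] A) (a : ℝ) :
    P.real (A ∩ {ω | |shifted G X z ω - a| ≤ 64 * (D ^ 6 * κ ^ 3)}) ≤
      800 * (64 * (D ^ 6 * κ ^ 3)) * P.real A := by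
  have hD := F.one_le
  have hD0 := F.pos_D
  have hκ := F.pos
  set s := Real.sqrt κ with hsd
  have hs0 : 0 < s := Real.sqrt_pos.2 hκ
  have hs2 : s ^ 2 = κ := Real.sq_sqrt hκ.le
  have hs1 : s ≤ 1 := by
    have := F.kappa_le hs
    nlinarith
  have hDs : D ^ 2 * s ≤ 1 / 8 := by
    refine abs_le_of_sq_le_sq' ?_ (by norm_num) |>.2
    calc (D ^ 2 * s) ^ 2 = D ^ 4 * s ^ 2 := by ring
      _ ≤ _ := by rw [hs2]; linarith
  -- A depth of order κ^(-1/2) makes 2^(-l) = O(κ³), while the vertices used cost D⁶lκ², of order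
  -- (D²√κ)³, which `hs` keeps small.
  set l := ⌈1 / s⌉₊ with hl
  have hl1 : 1 / s ≤ l := Nat.le_ceil _
  have hl2 : (l : ℝ) < 1 / s + 1 := Nat.ceil_lt_add_one (by positivity)
  have h1s : 1 ≤ 1 / s := (one_le_div hs0).2 hs1
  have hm : D ^ 4 * (D ^ 2 * (l + 1)) * κ ^ 2 ≤ 1 / 16 := by
    calc D ^ 4 * (D ^ 2 * (l + 1)) * κ ^ 2 ≤ D ^ 4 * (D ^ 2 * (3 * (1 / s))) * κ ^ 2 := by
          gcongr; linarith
      _ = 3 * (D ^ 2 * s) ^ 3 := by rw [← hs2]; field_simp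
      _ ≤ 3 * (1 / 8) ^ 3 := by gcongr
      _ ≤ 1 / 16 := by norm_num
  have hhalf : ((1 : ℝ) / 2) ^ l ≤ 46656 * κ ^ 3 := by
    have h1 := pow_six_le_two_pow l
    have h2 : (1 / s) ^ 6 ≤ (l : ℝ) ^ 6 := by gcongr
    have h3 : (1 / s) ^ 6 * κ ^ 3 = 1 := by rw [← hs2]; field_simp
    have h4 : (1 : ℝ) ≤ 46656 * 2 ^ l * κ ^ 3 := by
      rw [← h3]
      exact mul_le_mul_of_nonneg_right (h2.trans h1) (by positivity)
    rw [one_div, inv_pow]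
    refine inv_le_of_inv_le₀ (by positivity) ?_
    rw [inv_le_iff_one_le_mul₀ (by positivity)]
    linarith
  have h := F.concentration (α := 64 * (D ^ 6 * κ ^ 3)) (by positivity) le_rfl hz hm l
    (ballTwo G i) (by linarith [card_ballTwo_le G F.card_le hD0.le i]) A hA a
  refine h.trans (mul_le_mul_of_nonneg_right ?_ measureReal_nonneg)
  -- The constant 800 comes from 28·64 + 46656 ≤ 800·64.
  have h1 : (1 : ℝ) ≤ D ^ 6 := one_le_pow₀ hD
  nlinarith [pow_pos hκ 3]

end NormalizedField

/-! ### Solutions of the Stein equation -/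

section Stein

open Real

theorem integrable_exp_neg_sq_div_two : Integrable (fun x : ℝ => exp (-(x ^ 2) / 2)) := by
  refine (integrable_exp_neg_mul_sq (b := 1 / 2) (by norm_num)).congr
    (Filter.Eventually.of_forall fun x => ?_)
  simp only; congr 1; ring

theorem integral_exp_neg_sq_div_two_le : ∫ x : ℝ, exp (-(x ^ 2) / 2) ≤ 3 := by
  have h : ∫ x : ℝ, exp (-(x ^ 2) / 2) = √(2 * π) := by
    have := integral_gaussian (1 / 2)
    rw [show π / (1 / 2) = 2 * π by ring] at this
    rw [← this]; congr 1; ext x; congr 1; ring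
  rw [h, Real.sqrt_le_iff]
  exact ⟨by norm_num, by linarith [pi_lt_d2]⟩

theorem integral_Ioi_mul_exp (w : ℝ) :
    IntegrableOn (fun x : ℝ => x * exp (-(x ^ 2) / 2)) (Set.Ioi w) ∧
      ∫ x in Set.Ioi w, x * exp (-(x ^ 2) / 2) = exp (-(w ^ 2) / 2) := by
  have hd : ∀ x : ℝ, HasDerivAt (fun x : ℝ => -exp (-(x ^ 2) / 2)) (x * exp (-(x ^ 2) / 2)) x := by
    intro x
    have h1 : HasDerivAt (fun x : ℝ => -(x ^ 2) / 2) (-x) x := by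
      have := ((hasDerivAt_pow 2 x).neg).div_const 2
      convert! this using 1
      simp; ring
    convert! h1.exp.neg using 1
    ring
  have hlim : Filter.Tendsto (fun x : ℝ => -exp (-(x ^ 2) / 2)) Filter.atTop (nhds 0) := by
    rw [← neg_zero]
    refine Filter.Tendsto.neg (tendsto_exp_atBot.comp ?_)
    have h2 : Filter.Tendsto (fun x : ℝ => x ^ 2 / 2) Filter.atTop Filter.atTop :=
      (Filter.tendsto_pow_atTop two_ne_zero).atTop_div_const (by norm_num)
    refine (Filter.tendsto_neg_atTop_atBot.comp h2).congr fun x => ?_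
    simp only [Function.comp]; ring
  have hint : Integrable (fun x : ℝ => x * exp (-(x ^ 2) / 2)) := by
    refine (integrable_mul_exp_neg_mul_sq (b := 1 / 2) (by norm_num)).congr
      (Filter.Eventually.of_forall fun x => ?_)
    simp only; congr 2; ring
  refine ⟨hint.integrableOn, ?_⟩
  rw [integral_Ioi_of_hasDerivAt_of_tendsto' (fun x _ => hd x) hint.integrableOn hlim]
  ring

/-- Bounds of Mills ratio type for the tails of functions dominated by the Gaussian density. -/
theorem abs_integral_Ioi_le {p : ℝ → ℝ} (hp : ∀ x, |p x| ≤ exp (-(x ^ 2) / 2)) {w : ℝ}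
    (hw : 0 ≤ w) :
    |∫ x in Set.Ioi w, p x| ≤ 3 * exp (-(w ^ 2) / 2) ∧
      w * |∫ x in Set.Ioi w, p x| ≤ exp (-(w ^ 2) / 2) := by
  have h0 : |∫ x in Set.Ioi w, p x| ≤ ∫ x in Set.Ioi w, exp (-(x ^ 2) / 2) := by
    rw [← Real.norm_eq_abs]
    exact norm_integral_le_of_norm_le integrable_exp_neg_sq_div_two.integrableOn
      (Filter.Eventually.of_forall hp)
  constructor
  · refine h0.trans ?_
    have hI : Integrable (fun x : ℝ => exp (-(w ^ 2) / 2) * exp (-((x - w) ^ 2) / 2)) :=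
      (integrable_exp_neg_sq_div_two.comp_sub_right w).const_mul _
    calc ∫ x in Set.Ioi w, exp (-(x ^ 2) / 2)
        ≤ ∫ x in Set.Ioi w, exp (-(w ^ 2) / 2) * exp (-((x - w) ^ 2) / 2) := by
          refine setIntegral_mono_on integrable_exp_neg_sq_div_two.integrableOn
            hI.integrableOn measurableSet_Ioi fun x hx => ?_
          rw [← exp_add]
          refine exp_le_exp.2 ?_
          have : w < x := hx
          nlinarith
      _ ≤ ∫ x, exp (-(w ^ 2) / 2) * exp (-((x - w) ^ 2) / 2) :=
          setIntegral_le_integral hI (Filter.Eventually.of_forall fun x => by positivity)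
      _ = exp (-(w ^ 2) / 2) * ∫ x : ℝ, exp (-(x ^ 2) / 2) := by
          rw [integral_const_mul, integral_sub_right_eq_self (fun x => exp (-(x ^ 2) / 2)) w]
      _ ≤ 3 * exp (-(w ^ 2) / 2) := by
          have := mul_le_mul_of_nonneg_left integral_exp_neg_sq_div_two_le
            (exp_pos (-(w ^ 2) / 2)).le
          linarith
  · obtain ⟨h1, h2⟩ := integral_Ioi_mul_exp w
    refine (mul_le_mul_of_nonneg_left h0 hw).trans ?_
    rw [← integral_const_mul, ← h2]
    refine setIntegral_mono_on (integrable_exp_neg_sq_div_two.integrableOn.const_mul w) h1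
      measurableSet_Ioi fun x hx => ?_
    exact mul_le_mul_of_nonneg_right (le_of_lt hx) (exp_pos _).le

/-- The Stein equation for a continuous test function with values in `[0, 1]` has a bounded
solution. -/
theorem exists_stein_solution {h : ℝ → ℝ} (hc : Continuous h) (h0 : ∀ x, 0 ≤ h x)
    (h1 : ∀ x, h x ≤ 1) :
    ∃ f : ℝ → ℝ, (∀ w, HasDerivAt f (w * f w + (h w - ∫ x, h x ∂gaussianReal 0 1)) w) ∧
      (∀ w, |f w| ≤ 3) ∧ ∀ w, |w * f w| ≤ 1 := by
  set μ := ∫ x, h x ∂gaussianReal 0 1 with hμ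
  have hint : Integrable h (gaussianReal 0 1) :=
    (integrable_const (1 : ℝ)).mono' hc.aestronglyMeasurable
      (Filter.Eventually.of_forall fun x => by rw [Real.norm_eq_abs, abs_of_nonneg (h0 x)]; exact h1 x)
  have hμ0 : 0 ≤ μ := integral_nonneg h0
  have hμ1 : μ ≤ 1 := by
    have := integral_mono hint (integrable_const (1 : ℝ)) h1
    simpa using this
  set p : ℝ → ℝ := fun x => (h x - μ) * exp (-(x ^ 2) / 2) with hp
  have hpc : Continuous p := by fun_prop
  have hpb : ∀ x, |p x| ≤ exp (-(x ^ 2) / 2) := fun x => by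
    rw [hp, abs_mul, abs_of_pos (exp_pos _)]
    refine mul_le_of_le_one_left (exp_pos _).le (abs_le.2 ⟨?_, ?_⟩)
    · linarith [h0 x]
    · linarith [h1 x]
  have hpi : Integrable p := integrable_exp_neg_sq_div_two.mono' hpc.aestronglyMeasurable
    (Filter.Eventually.of_forall hpb)
  have hptot : ∫ x, p x = 0 := by
    have e1 : ∫ x, (h x - μ) ∂gaussianReal 0 1 = 0 := by
      rw [integral_sub hint (integrable_const _)]; simp [hμ]
    rw [integral_gaussianReal_eq_integral_smul (by norm_num)] at e1
    have e2 : ∀ x, gaussianPDFReal 0 1 x • (h x - μ) = (√(2 * π))⁻¹ * p x := fun x => by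
      simp only [gaussianPDFReal, hp, smul_eq_mul, NNReal.coe_one, mul_one, sub_zero]
      ring
    simp only [e2] at e1
    rw [integral_const_mul] at e1
    rcases mul_eq_zero.1 e1 with h2 | h2
    · exact absurd h2 (by positivity)
    · exact h2
  -- This is the integral over (-∞, w], split at 0 so that the fundamental theorem gives its
  -- derivative. As the total integral is 0, it is also minus the right tail, and each half-line
  -- uses the tail that decays.
  set I : ℝ → ℝ := fun w => (∫ x in Set.Iic 0, p x) + ∫ x in (0 : ℝ)..w, p x with hI
  have hI1 : ∀ w, I w = ∫ x in Set.Iic w, p x := fun w => by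
    simp only [hI]
    rw [← intervalIntegral.integral_Iic_sub_Iic hpi.integrableOn hpi.integrableOn]; ring
  have hI2 : ∀ w, I w = -∫ x in Set.Ioi w, p x := fun w => by
    have := integral_add_compl (measurableSet_Iic (a := w)) hpi
    rw [hptot, Set.compl_Iic] at this
    rw [hI1]; linarith
  have hId : ∀ w, HasDerivAt I (p w) w := fun w =>
    (hpc.integral_hasStrictDerivAt 0 w).hasDerivAt.const_add _
  set f : ℝ → ℝ := fun w => exp (w ^ 2 / 2) * I w with hf
  have hmul : ∀ w, exp (w ^ 2 / 2) * exp (-(w ^ 2) / 2) = 1 := fun w => by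
    rw [← exp_add, neg_div, add_neg_cancel, exp_zero]
  have hIb : ∀ w, |I w| ≤ 3 * exp (-(w ^ 2) / 2) ∧ |w| * |I w| ≤ exp (-(w ^ 2) / 2) := by
    intro w
    rcases le_total 0 w with hw | hw
    · rw [hI2, abs_neg, abs_of_nonneg hw]
      exact abs_integral_Ioi_le hpb hw
    · have h2 := abs_integral_Ioi_le (p := fun x => p (-x))
        (fun x => by simpa using hpb (-x)) (neg_nonneg.2 hw)
      rw [integral_comp_neg_Ioi, neg_neg, neg_sq] at h2
      rw [hI1, abs_of_nonpos hw]
      exact h2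
  have hfI : ∀ w, |f w| = exp (w ^ 2 / 2) * |I w| := fun w => by
    rw [hf, abs_mul, abs_of_pos (exp_pos _)]
  refine ⟨f, fun w => ?_, fun w => ?_, fun w => ?_⟩
  · have hd : HasDerivAt (fun w : ℝ => exp (w ^ 2 / 2)) (w * exp (w ^ 2 / 2)) w := by
      have h2 : HasDerivAt (fun x : ℝ => x ^ 2 / 2) w w := by
        convert! (hasDerivAt_pow 2 w).div_const 2 using 1
        simp
      convert! h2.exp using 1
      ring
    convert! hd.mul (hId w) using 1
    have := hmul w
    simp only [hf, hp]
    linear_combination -(h w - μ) * this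
  · rw [hfI]
    have := mul_le_mul_of_nonneg_left (hIb w).1 (exp_pos (w ^ 2 / 2)).le
    nlinarith [hmul w]
  · rw [abs_mul, hfI]
    have := mul_le_mul_of_nonneg_left (hIb w).2 (exp_pos (w ^ 2 / 2)).le
    nlinarith [hmul w]

end Stein

end GraphDep

namespace GraphDep

/-! ### Smoothed indicators -/

section Ramp

/-- The continuous function that is `1` up to `z`, `0` from `z + α` on, and affine between. -/
noncomputable def ramp (z α x : ℝ) : ℝ := max 0 (min 1 ((z + α - x) / α))

theorem continuous_ramp (z α : ℝ) : Continuous (ramp z α) := by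
  unfold ramp; fun_prop

theorem ramp_nonneg (z α x : ℝ) : 0 ≤ ramp z α x := le_max_left _ _

theorem ramp_le_one (z α x : ℝ) : ramp z α x ≤ 1 := max_le zero_le_one (min_le_left _ _)

theorem ramp_eq_one {z α x : ℝ} (hα : 0 < α) (h : x ≤ z) : ramp z α x = 1 := by
  rw [ramp, min_eq_left ((one_le_div hα).2 (by linarith)), max_eq_right zero_le_one]

theorem ramp_eq_zero {z α x : ℝ} (hα : 0 < α) (h : z + α ≤ x) : ramp z α x = 0 := by
  rw [ramp, max_eq_left]
  exact (min_le_right _ _).trans (div_nonpos_of_nonpos_of_nonneg (by linarith) hα.le)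

theorem abs_ramp_zero_sub_le {b : ℝ} (hb : 0 < b) (x y : ℝ) :
    |ramp 0 b x - ramp 0 b y| ≤ |x - y| / b := by
  unfold ramp
  rw [max_comm, max_comm (0 : ℝ)]
  refine (abs_max_sub_max_le_abs _ _ _).trans ((abs_min_sub_min_le_max _ _ _ _).trans
    (max_le (by simp; positivity) ?_))
  rw [← sub_div, abs_div, abs_of_pos hb, abs_sub_comm]
  refine le_of_eq ?_
  congr 2; ring

/-- The transition zone [0, b] lies in [0, 2α], the interval of radius α about α. -/
theorem ramp_zero_project {α b : ℝ} (hb : 0 < b) (h : b ≤ 2 * α) (x : ℝ) :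
    ramp 0 b (project α α x) = ramp 0 b x := by
  rcases le_total x 0 with h1 | h1
  · rw [ramp_eq_one hb h1, ramp_eq_one hb]
    unfold project; grind
  · rcases le_total (2 * α) x with h2 | h2
    · rw [ramp_eq_zero (x := x) hb (by linarith), ramp_eq_zero hb]
      unfold project; grind
    · rw [project_eq_self]
      rw [abs_le]; constructor <;> linarith

/-- Level z for s/c is level 0 for s - zc. This turns smoothing of the quotient into concentration
of the shifted statistic. -/
theorem ramp_div {z α c s : ℝ} (hα : 0 < α) (hc : 0 < c) :
    ramp z α (s / c) = ramp 0 (α * c) (s - z * c) := by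
  unfold ramp
  congr 2
  field_simp; ring

/-- Increments of the ramp along a segment are controlled by an overlap. -/
theorem abs_ramp_sub_le_overlap {z α c s u w : ℝ} (hα : 0 < α) (hc1 : 1 / 2 ≤ c) (hc2 : c ≤ 2)
    (hu : |u| ≤ w) :
    |ramp z α ((s - u) / c) - ramp z α (s / c)| ≤ 2 / α * overlap 0 w α α (s - z * c) := by
  have hc : 0 < c := by linarith
  have hb : 0 < α * c := mul_pos hα hc
  have hb2 : α * c ≤ 2 * α := by nlinarith
  have hw : 0 ≤ w := (abs_nonneg u).trans hu
  rw [ramp_div hα hc, ramp_div hα hc, ← ramp_zero_project hb hb2,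
    ← ramp_zero_project hb hb2 (s - z * c), show s - u - z * c = s - z * c - u by ring]
  refine (abs_ramp_zero_sub_le hb _ _).trans ?_
  have h1 := abs_project_sub_le (y := 0) (w := w) (a := α) (r := α) (t := s - z * c) (u := u)
    (v := 0) hα.le (by simpa using hu) (by simpa using hw)
  rw [sub_zero] at h1
  rw [div_le_iff₀ hb]
  refine h1.trans ?_
  have h2 := overlap_nonneg 0 w α α (s - z * c)
  have h3 : 2 / α * overlap 0 w α α (s - z * c) * (α * c) =
      (2 * c) * overlap 0 w α α (s - z * c) := by field_simp
  rw [h3]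
  nlinarith

end Ramp

/-! ### Pointwise Stein expansion -/

section SteinExpansion

variable {f h : ℝ → ℝ} {μ : ℝ}

theorem abs_stein_deriv_le (h0 : ∀ x, 0 ≤ h x) (h1 : ∀ x, h x ≤ 1) (hμ0 : 0 ≤ μ) (hμ1 : μ ≤ 1)
    (hf1 : ∀ w, |w * f w| ≤ 1) (w : ℝ) : |w * f w + (h w - μ)| ≤ 2 := by
  have h2 := abs_le.1 (hf1 w)
  rw [abs_le]
  constructor <;> linarith [h0 w, h1 w]

theorem stein_lipschitz (hd : ∀ w, HasDerivAt f (w * f w + (h w - μ)) w)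
    (hb : ∀ w, |w * f w + (h w - μ)| ≤ 2) (x y : ℝ) : |f x - f y| ≤ 2 * |x - y| := by
  have := Convex.norm_image_sub_le_of_norm_hasDerivWithin_le (s := Set.univ) (C := 2)
    (fun w _ => (hd w).hasDerivWithinAt) (fun w _ => hb w) convex_univ (Set.mem_univ y)
    (Set.mem_univ x)
  simpa [Real.norm_eq_abs] using this

/-- The linear bound holds because both inverses are at most 2. It is used where a further factor Z'
is present, to keep the total order in the X's at two. -/
theorem abs_inv_sub_inv_le {c c' Z : ℝ} (hc : 1 / 2 ≤ c) (hc' : 1 / 2 ≤ c')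
    (hZ : 0 ≤ Z) (h : |c - c'| ≤ Z ^ 2) :
    |c⁻¹ - c'⁻¹| ≤ 4 * Z ^ 2 ∧ |c⁻¹ - c'⁻¹| ≤ 4 * Z := by
  have h0 : 0 < c := by linarith
  have h0' : 0 < c' := by linarith
  have h1 : |c⁻¹ - c'⁻¹| ≤ 4 * Z ^ 2 := by
    rw [inv_sub_inv h0.ne' h0'.ne', abs_div, abs_of_pos (mul_pos h0 h0'),
      div_le_iff₀ (mul_pos h0 h0'), abs_sub_comm]
    have : 1 / 4 ≤ c * c' := by nlinarith
    nlinarith [sq_nonneg Z]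
  refine ⟨h1, ?_⟩
  rcases le_total Z 1 with h2 | h2
  · nlinarith
  · have e1 : c⁻¹ ≤ 2 := inv_le_of_inv_le₀ two_pos (by norm_num; linarith)
    have e2 : c'⁻¹ ≤ 2 := inv_le_of_inv_le₀ two_pos (by norm_num; linarith)
    have e3 : 0 < c⁻¹ := by positivity
    have e4 : 0 < c'⁻¹ := by positivity
    rw [abs_le]; constructor <;> linarith

set_option maxHeartbeats 1000000 in
/-- The pointwise estimate behind the Stein expansion: the effect of replacing the sum `S` by
`S - Y` and the normalizer `c` by `c'`. -/
theorem abs_stein_expansion_le {z α : ℝ} (hα : 0 < α)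
    (hd : ∀ w, HasDerivAt f (w * f w + (ramp z α w - μ)) w) (hμ0 : 0 ≤ μ) (hμ1 : μ ≤ 1)
    (hf0 : ∀ w, |f w| ≤ 3) (hf1 : ∀ w, |w * f w| ≤ 1) {S Y c c' Z Z' s : ℝ}
    (hc : 1 / 2 ≤ c) (hc2 : c ≤ 2) (hc' : 1 / 2 ≤ c') (hcc : |c - c'| ≤ Z ^ 2)
    (hY : |Y| ≤ Z) (hZ : Z ≤ Z') (hs : 0 ≤ s) (hS : |S| ≤ s + Z') (hSY : |S - Y| ≤ s + Z') :
    |f (S / c) / c - f ((S - Y) / c') / c' -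
        Y / c ^ 2 * (S / c * f (S / c) + (ramp z α (S / c) - μ))| ≤
      84 * Z' ^ 2 + 48 * s * Z ^ 2 + 8 / α * (Z * overlap 0 Z α α (S - z * c)) := by
  have hb := abs_stein_deriv_le (ramp_nonneg z α) (ramp_le_one z α) hμ0 hμ1 hf1
  have hlip := stein_lipschitz hd hb
  have hZ0 : 0 ≤ Z := (abs_nonneg Y).trans hY
  have hZ0' : 0 ≤ Z' := hZ0.trans hZ
  obtain ⟨hg1, hg2⟩ := abs_inv_sub_inv_le hc hc' hZ0 hcc
  have hc0 : 0 < c := by linarith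
  set g := c⁻¹ with hg
  set g' := c'⁻¹ with hg'
  have hg0 : 0 < g := by positivity
  have hg3 : g ≤ 2 := inv_le_of_inv_le₀ two_pos (by norm_num; linarith)
  set U := S / c with hU
  set ov := overlap 0 Z α α (S - z * c) with hov
  have hov0 : 0 ≤ ov := overlap_nonneg _ _ _ _ _
  have hUb : |U| ≤ 2 * s + 2 * Z' := by
    rw [hU, div_eq_mul_inv, abs_mul, abs_of_pos hg0]
    exact (mul_le_mul hS hg3 hg0.le (by positivity)).trans_eq (by ring)
  -- Three changes are separated: the outer factor 1/c here, the normalizer inside f in `hB`, and S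
  -- to S - Y at fixed normalizer in `hC`.
  have hA : |(g - g') * f ((S - Y) * g')| ≤ 12 * Z ^ 2 := by
    rw [abs_mul]
    exact (mul_le_mul hg1 (hf0 _) (abs_nonneg _) (by positivity)).trans_eq (by ring)
  have hB : |g * (f ((S - Y) * g) - f ((S - Y) * g'))| ≤ 16 * s * Z ^ 2 + 16 * (Z * Z') := by
    rw [abs_mul, abs_of_pos hg0]
    have h1 := hlip ((S - Y) * g) ((S - Y) * g')
    rw [← mul_sub, abs_mul] at h1
    have h2 : |S - Y| * |g - g'| ≤ 4 * s * Z ^ 2 + 4 * (Z * Z') := by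
      calc |S - Y| * |g - g'| ≤ (s + Z') * |g - g'| := by gcongr
        _ = s * |g - g'| + Z' * |g - g'| := by ring
        _ ≤ s * (4 * Z ^ 2) + Z' * (4 * Z) := by gcongr
        _ = _ := by ring
    have h3 : |f ((S - Y) * g) - f ((S - Y) * g')| ≤ 8 * s * Z ^ 2 + 8 * (Z * Z') := by
      linarith
    exact (mul_le_mul hg3 h3 (abs_nonneg _) zero_le_two).trans_eq (by ring)
  have hinc : ∀ u, |u| ≤ Z → |((S - u) / c * f ((S - u) / c) +
      (ramp z α ((S - u) / c) - μ)) - (U * f U + (ramp z α U - μ))| ≤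
      6 * Z + 8 * s * Z + 8 * Z' + 2 / α * ov := by
    intro u hu
    set v := (S - u) / c with hv
    have huv : |v - U| ≤ 2 * Z := by
      have : v - U = -(u * g) := by rw [hv, hU, hg]; field_simp; ring
      rw [this, abs_neg, abs_mul, abs_of_pos hg0]
      exact (mul_le_mul hu hg3 hg0.le hZ0).trans_eq (by ring)
    have h1 := abs_ramp_sub_le_overlap (z := z) (s := S) hα hc hc2 hu
    have h2 : |v * f v - U * f U| ≤ 6 * Z + 8 * s * Z + 8 * Z' := by
      -- For Z' ≤ 1 the product rule suffices. For Z' ≥ 1 the bound |w f(w)| ≤ 1 makes the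
      -- difference at most 2, avoiding a term quadratic in Z'.
      rcases le_total Z' 1 with h3 | h3
      · have e : v * f v - U * f U = U * (f v - f U) + (v - U) * f v := by ring
        have h4 : |U * (f v - f U)| ≤ (2 * s + 2 * Z') * (2 * (2 * Z)) := by
          rw [abs_mul]
          exact mul_le_mul hUb ((hlip v U).trans (by linarith)) (abs_nonneg _) (by positivity)
        have h5 : |(v - U) * f v| ≤ 2 * Z * 3 := by
          rw [abs_mul]
          exact mul_le_mul huv (hf0 v) (abs_nonneg _) (by positivity)
        rw [e]
        refine (abs_add_le _ _).trans ((add_le_add h4 h5).trans ?_)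
        have h6 : Z' * Z ≤ Z' * 1 := mul_le_mul_of_nonneg_left (hZ.trans h3) hZ0'
        linarith
      · have h4 := abs_sub (v * f v) (U * f U)
        have h5 : 0 ≤ s * Z := by positivity
        linarith [hf1 v, hf1 U]
    have e : (v * f v + (ramp z α v - μ)) - (U * f U + (ramp z α U - μ)) =
        (v * f v - U * f U) + (ramp z α v - ramp z α U) := by ring
    rw [e]
    exact (abs_add_le _ _).trans (add_le_add h2 h1)
  have hC : |g * (f U - f ((S - Y) * g) - Y * g * (U * f U + (ramp z α U - μ)))| ≤
      4 * Z * (6 * Z + 8 * s * Z + 8 * Z' + 2 / α * ov) := by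
    set K := 6 * Z + 8 * s * Z + 8 * Z' + 2 / α * ov with hK
    have hK0 : 0 ≤ K := by positivity
    set d := U * f U + (ramp z α U - μ) with hdd
    -- The added linear term cancels the derivative at u = 0, so the mean value bound sees only the
    -- increment of f'.
    have hder : ∀ u ∈ Set.uIcc 0 Y, HasDerivWithinAt (fun u => f ((S - u) / c) + u * (g * d))
        (((S - u) / c * f ((S - u) / c) + (ramp z α ((S - u) / c) - μ)) * (-1 / c) + 1 * (g * d))
        (Set.uIcc 0 Y) u := by
      intro u _
      have h1 : HasDerivAt (fun u => (S - u) / c) (-1 / c) u :=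
        ((hasDerivAt_id u).const_sub S).div_const c
      exact (((hd _).comp u h1).add ((hasDerivAt_id u).mul_const _)).hasDerivWithinAt
    have hbound : ∀ u ∈ Set.uIcc 0 Y, ‖((S - u) / c * f ((S - u) / c) +
        (ramp z α ((S - u) / c) - μ)) * (-1 / c) + 1 * (g * d)‖ ≤ 2 * K := by
      intro u hu
      have huY : |u| ≤ Z := by
        refine le_trans ?_ hY
        rw [Set.mem_uIcc] at hu
        grind
      have e : ((S - u) / c * f ((S - u) / c) + (ramp z α ((S - u) / c) - μ)) * (-1 / c) +
          1 * (g * d) = -g * (((S - u) / c * f ((S - u) / c) +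
            (ramp z α ((S - u) / c) - μ)) - d) := by rw [hg]; ring
      rw [e, Real.norm_eq_abs, abs_mul, abs_neg, abs_of_pos hg0]
      exact mul_le_mul hg3 (hinc u huY) (abs_nonneg _) zero_le_two
    have h2 := Convex.norm_image_sub_le_of_norm_hasDerivWithin_le hder hbound
      (convex_uIcc 0 Y) Set.right_mem_uIcc Set.left_mem_uIcc
    rw [Real.norm_eq_abs, Real.norm_eq_abs, zero_sub, abs_neg] at h2
    have e : f U - f ((S - Y) * g) - Y * g * d =
        f ((S - 0) / c) + 0 * (g * d) - (f ((S - Y) / c) + Y * (g * d)) := by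
      rw [sub_zero, hU, hg]; simp only [div_eq_mul_inv]; ring
    rw [abs_mul, abs_of_pos hg0, e]
    calc _ ≤ 2 * (2 * K * Z) := mul_le_mul hg3
            (h2.trans (mul_le_mul_of_nonneg_left hY (by positivity))) (abs_nonneg _) zero_le_two
      _ = _ := by ring
  have e : f U / c - f ((S - Y) / c') / c' - Y / c ^ 2 * (U * f U + (ramp z α U - μ)) =
      (g - g') * f ((S - Y) * g') + g * (f ((S - Y) * g) - f ((S - Y) * g')) +
        g * (f U - f ((S - Y) * g) - Y * g * (U * f U + (ramp z α U - μ))) := by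
    simp only [hg, hg', div_eq_mul_inv]
    ring
  rw [e]
  refine (abs_add_three _ _ _).trans ((add_le_add (add_le_add hA hB) hC).trans ?_)
  have t1 : Z * Z ≤ Z * Z' := mul_le_mul_of_nonneg_left hZ hZ0
  have t2 : Z * Z' ≤ Z' * Z' := mul_le_mul_of_nonneg_right hZ hZ0'
  have t3 : 4 * Z * (6 * Z + 8 * s * Z + 8 * Z' + 2 / α * ov) =
      24 * Z ^ 2 + 32 * s * Z ^ 2 + 32 * (Z * Z') + 8 / α * (Z * ov) := by ring
  rw [t3]
  linarith

end SteinExpansion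

end GraphDep

/-! ### Stein's method for the cut-off statistic -/

namespace GraphDep

/-- The left side vanishes unless the cut-off is active. Then |q - 1| ≥ 3/4, and 1 + 4|q| ≤ 5 + 4|q
- 1| fits under the right side. -/
theorem abs_one_sub_div_clampSqrt_sq_le (q : ℝ) :
    |1 - q / clampSqrt q ^ 2| ≤ 13 * max (|q - 1| - 1 / 8) 0 := by
  have hm := le_max_right (|q - 1| - 1 / 8) 0
  have hm2 := le_max_left (|q - 1| - 1 / 8) 0
  have hc := half_le_clampSqrt q
  by_cases h : 1 / 4 ≤ q ∧ q ≤ 4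
  · rw [clampSqrt_eq h.1 h.2, Real.sq_sqrt (by linarith), div_self (by linarith), sub_self,
      abs_zero]
    linarith
  · have h1 : 3 / 4 ≤ |q - 1| := by
      by_contra hlt
      push Not at hlt
      have := abs_lt.1 hlt
      exact h ⟨by linarith, by linarith⟩
    have h2 : |q / clampSqrt q ^ 2| ≤ 4 * |q| := by
      rw [abs_div, abs_of_pos (by positivity : 0 < clampSqrt q ^ 2),
        div_le_iff₀ (by nlinarith)]
      nlinarith [abs_nonneg q, mul_nonneg (abs_nonneg q)
        (by nlinarith : 0 ≤ clampSqrt q ^ 2 - 1 / 4)]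
    have h3 : |q| ≤ |q - 1| + 1 := by
      calc |q| = |(q - 1) + 1| := by congr 1; ring
        _ ≤ |q - 1| + |1| := abs_add_le _ _
        _ = _ := by rw [abs_one]
    have h4 := abs_sub 1 (q / clampSqrt q ^ 2)
    rw [abs_one] at h4
    linarith

namespace NormalizedField

variable {V Ω : Type*} [Fintype V] [DecidableEq V] [MeasurableSpace Ω]
  {P : Measure Ω} [IsProbabilityMeasure P] {G : SimpleGraph V} [DecidableRel G.Adj]
  {X : V → Ω → ℝ} {D κ : ℝ}

/-- The sum divided by the cut-off normalizer. -/
noncomputable def cutStat (G : SimpleGraph V) [DecidableRel G.Adj] (X : V → Ω → ℝ) (ω : Ω) : ℝ :=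
  (∑ i, X i ω) / clampSqrt (crossSum G X Finset.univ ω)

theorem measurable_cutStat (F : NormalizedField P G X D κ) : Measurable (cutStat G X) :=
  (F.measurable_sum _).div (measurable_clampSqrt.comp (F.measurable_crossSum _))

theorem integral_crossSum_univ (F : NormalizedField P G X D κ) :
    ∫ ω, crossSum G X Finset.univ ω ∂P = 1 := by
  rw [← F.unit]
  exact integral_finsetSum _ fun i _ => F.integrable_mul_sumY i

theorem sum_integral_ballThree_le (F : NormalizedField P G X D κ) :
    ∑ i, ∫ ω, |X i ω| * absSum X (ballThree G i) ω * absSum X (ballThree G i) ω ∂P ≤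
      D ^ 6 * κ ^ 3 := by
  refine (F.sum_integral_triple_le (fun i j => (mem_ballThree_comm G).1)
    (card_ballThree_le G F.card_le F.pos_D.le) (by have := F.pos_D; positivity) _).trans_eq ?_
  rw [← pow_mul]

/-- One summand of the Stein expansion of the cut-off statistic. -/
theorem abs_integral_stein_le (F : NormalizedField P G X D κ) (hs : D ^ 4 * κ ≤ 1 / 64) {z : ℝ}
    (hz : |z| * (D ^ 6 * κ ^ 3) ≤ 1 / 128) {f : ℝ → ℝ} {μ : ℝ}
    (hd : ∀ w, HasDerivAt f (w * f w + (ramp z (64 * (D ^ 6 * κ ^ 3)) w - μ)) w)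
    (hμ0 : 0 ≤ μ) (hμ1 : μ ≤ 1) (hf0 : ∀ w, |f w| ≤ 3) (hf1 : ∀ w, |w * f w| ≤ 1) (i : V) :
    |∫ ω, X i ω * (f (cutStat G X ω) / clampSqrt (crossSum G X Finset.univ ω)) ∂P -
      ∫ ω, (cutStat G X ω * f (cutStat G X ω) +
          (ramp z (64 * (D ^ 6 * κ ^ 3)) (cutStat G X ω) - μ)) /
          clampSqrt (crossSum G X Finset.univ ω) ^ 2 * (X i ω * sumY G X i ω) ∂P| ≤
      84 * ∫ ω, |X i ω| * absSum X (ballThree G i) ω * absSum X (ballThree G i) ω ∂P +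
        12896 * ∫ ω, |X i ω| * absSum X (ballTwo G i) ω * absSum X (ballTwo G i) ω ∂P := by
  have hD := F.one_le
  have hD0 := F.pos_D
  have hκ := F.pos
  set α := 64 * (D ^ 6 * κ ^ 3) with hαd
  have hα : 0 < α := by positivity
  set U := cutStat G X with hU
  set c : Ω → ℝ := fun ω => clampSqrt (crossSum G X Finset.univ ω) with hcd
  set c' : Ω → ℝ := fun ω => clampSqrt (offQuad G X (nbhd G i) ω) with hcd'
  set Y := sumY G X i with hY
  set Z := absSum X (ballTwo G i) with hZ
  set Z' := absSum X (ballThree G i) with hZ'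
  set d : ℝ → ℝ := fun w => w * f w + (ramp z α w - μ) with hdd
  have hdb : ∀ w, |d w| ≤ 2 :=
    abs_stein_deriv_le (ramp_nonneg z α) (ramp_le_one z α) hμ0 hμ1 hf1
  have hfc : Continuous f := continuous_iff_continuousAt.2 fun w => (hd w).continuousAt
  have hdc : Continuous d := (continuous_id.mul hfc).add ((continuous_ramp z α).sub continuous_const)
  have hUm : Measurable U := F.measurable_cutStat
  have hcm : Measurable c := measurable_clampSqrt.comp (F.measurable_crossSum _)
  have hc1 : ∀ ω, 1 / 2 ≤ c ω := fun ω => half_le_clampSqrt _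
  have hc1' : ∀ ω, 1 / 2 ≤ c' ω := fun ω => half_le_clampSqrt _
  have hTm : Measurable (shifted G X z) := F.measurable_shifted z
  set Jf : Finset V := (ballThree G i)ᶜ with hJf
  -- The far part of S is independent of the ball of radius 2, so E s|Xᵢ|Z² factors with E s ≤ 2.
  -- Bounding with S itself would call for fourth moments.
  set s : Ω → ℝ := fun ω => |∑ j ∈ Jf, X j ω| with hsd
  have hs2 : ∫ ω, s ω ∂P ≤ 2 := by
    refine F.integral_abs_sum_le ?_
    have h1 := card_ballThree_le G F.card_le hD0.le i
    have h2 := F.kappa_le hs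
    rw [hJf, compl_compl]
    calc D * ((ballThree G i).card : ℝ) * κ ^ 2 ≤ D * D ^ 3 * κ ^ 2 := by gcongr
      _ = (D ^ 4 * κ) * κ := by ring
      _ ≤ 1 / 64 * (1 / 64) := mul_le_mul hs h2 hκ.le (by norm_num)
      _ ≤ 1 / 16 := by norm_num
  have hsepF : Separated G {i} {j | j ∉ nbhd G i} := separated_nbhd_compl i
  -- the term vanishing by independence
  have hoffm : Measurable[sigAlg X {j | j ∉ nbhd G i}]
      (fun ω => f ((∑ j ∈ (nbhd G i)ᶜ, X j ω) / c' ω) / c' ω) := by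
    have h1 := measurable_clampSqrt.comp (measurable_sigAlg_offQuad G X i)
    exact (hfc.measurable.comp ((measurable_sigAlg_sum_compl G X i).div h1)).div h1
  have hzero : ∫ ω, X i ω * (f ((∑ j ∈ (nbhd G i)ᶜ, X j ω) / c' ω) / c' ω) ∂P = 0 := by
    rw [F.integral_mul_of_separated hsepF (measurable_sigAlg_apply X rfl) hoffm, F.mean i,
      zero_mul]
  have hdiv : ∀ {x y : ℝ}, |x| ≤ 3 → 1 / 2 ≤ y → |x / y| ≤ 6 := fun {x y} hx hy => by
    rw [abs_div, abs_of_pos (by linarith : 0 < y), div_le_iff₀ (by linarith)]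
    linarith
  have hI1 : Integrable (fun ω => X i ω * (f (U ω) / c ω)) P := by
    have := integrable_bdd_mul (F.integrable i) ((hfc.measurable.comp hUm).div hcm)
      (fun ω => hdiv (hf0 (U ω)) (hc1 ω))
    exact this.congr (Filter.Eventually.of_forall fun ω => mul_comm _ _)
  have hI2 : Integrable
      (fun ω => X i ω * (f ((∑ j ∈ (nbhd G i)ᶜ, X j ω) / c' ω) / c' ω)) P := by
    have := integrable_bdd_mul (F.integrable i) (hoffm.mono (sigAlg_le F.meas _) le_rfl)
      (fun ω => hdiv (hf0 _) (hc1' ω))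
    exact this.congr (Filter.Eventually.of_forall fun ω => mul_comm _ _)
  have hI3 : Integrable (fun ω => d (U ω) / c ω ^ 2 * (X i ω * Y ω)) P := by
    refine integrable_bdd_mul (F.integrable_mul_sumY i)
      ((hdc.measurable.comp hUm).div (hcm.pow_const 2)) (c := 8) fun ω => ?_
    have h1 : (1 : ℝ) / 4 ≤ c ω ^ 2 := by nlinarith [hc1 ω]
    rw [abs_div, abs_of_pos (by linarith : 0 < c ω ^ 2), div_le_iff₀ (by linarith)]
    linarith [hdb (U ω)]
  -- integrable bounds
  have hint2 := F.integrable_mul_absSum_mul_absSum i (ballTwo G i) (ballTwo G i)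
  have hint3 := F.integrable_mul_absSum_mul_absSum i (ballThree G i) (ballThree G i)
  set B : Set V := ((ballTwo G i : Finset V) : Set V) with hB
  have hZB : Measurable[sigAlg X B] Z := measurable_sigAlg_absSum X _
  have hXB : Measurable[sigAlg X B] (X i) := measurable_sigAlg_apply X (self_mem_ballTwo G i)
  have hwm : Measurable[sigAlg X B] (fun ω => |X i ω| * Z ω * Z ω) :=
    ((continuous_abs.measurable.comp hXB).mul hZB).mul hZB
  have hsm : Measurable[sigAlg X (Jf : Set V)] s :=
    continuous_abs.measurable.comp (measurable_sigAlg_sum X Jf fun j hj => hj)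
  have hsepJ : Separated G (Jf : Set V) B := by
    refine (separated_of_ballThree (G := G) (i := i) fun j hj => ?_).symm
    simpa [hJf] using hj
  have hindep := F.integral_mul_of_separated hsepJ hsm hwm
  have hIs : Integrable (fun ω => s ω * (|X i ω| * Z ω * Z ω)) P :=
    (F.dep.indepFun hsepJ hsm hwm).integrable_mul (F.integrable_sum Jf).abs hint2
  -- Concentration of order α cancels the 1/α of the ramp: 8/α · 2 · 800α = 12800, and 48 · E s adds
  -- 96.
  have hdec := integral_mul_overlap_le (sigAlg_le F.meas B) hTm (r := α) (c := 800 * α)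
    (by positivity) (fun A hA a => F.concentration_ball hs hz i hA a)
    (ρ := fun ω => |X i ω| * Z ω) (y := fun _ => 0) (w := Z)
    ((continuous_abs.measurable.comp hXB).mul hZB) measurable_const hZB
    (fun ω => mul_nonneg (abs_nonneg _) (absSum_nonneg X _ ω)) (absSum_nonneg X _) hint2 α
  have hdiff : ∫ ω, X i ω * (f (U ω) / c ω) ∂P - ∫ ω, d (U ω) / c ω ^ 2 * (X i ω * Y ω) ∂P =
      ∫ ω, (X i ω * (f (U ω) / c ω) -
        X i ω * (f ((∑ j ∈ (nbhd G i)ᶜ, X j ω) / c' ω) / c' ω) -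
        d (U ω) / c ω ^ 2 * (X i ω * Y ω)) ∂P := by
    rw [integral_sub_sub hI1 hI2 hI3, hzero, sub_zero]
  rw [hdiff]
  have hpt : ∀ ω, |X i ω * (f (U ω) / c ω) -
        X i ω * (f ((∑ j ∈ (nbhd G i)ᶜ, X j ω) / c' ω) / c' ω) -
        d (U ω) / c ω ^ 2 * (X i ω * Y ω)| ≤
      84 * (|X i ω| * Z' ω * Z' ω) + 48 * (s ω * (|X i ω| * Z ω * Z ω)) +
        8 / α * (|X i ω| * Z ω * overlap 0 (Z ω) α α (shifted G X z ω)) := fun ω => by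
    have hfar : ∀ A : Finset V, A ⊆ ballThree G i → |∑ j ∈ Aᶜ, X j ω| ≤ s ω + Z' ω := by
      intro A hA
      have e1 : ∑ j ∈ Aᶜ, X j ω = ∑ j ∈ Jf, X j ω + ∑ j ∈ ballThree G i \ A, X j ω := by
        rw [add_comm, ← Finset.sum_sdiff (Finset.compl_subset_compl.2 hA)]
        congr 2
        ext j
        simp only [Finset.mem_sdiff, Finset.mem_compl, not_not]
        tauto
      rw [e1]
      exact (abs_add_le _ _).trans (add_le_add le_rfl ((abs_sum_le_absSum X _ ω).trans
        (absSum_mono X Finset.sdiff_subset ω)))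
    have h1 := abs_stein_expansion_le hα hd hμ0 hμ1 hf0 hf1 (S := ∑ j, X j ω) (Y := Y ω)
      (c := c ω) (c' := c' ω) (Z := Z ω) (Z' := Z' ω) (s := s ω) (hc1 ω) (clampSqrt_le_two _)
      (hc1' ω) ((abs_clampSqrt_sub_le _ _).trans (abs_crossSum_sub_offQuad_le G X i ω))
      (abs_sumY_le_absSum i ω) (absSum_mono X (ballTwo_subset_ballThree G i) ω) (abs_nonneg _)
      (by simpa using hfar ∅ (Finset.empty_subset _))
      (by
        rw [hY, ← sumS_sub_sumY]
        exact hfar _ ((nbhd_subset_ballTwo G i).trans (ballTwo_subset_ballThree G i)))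
    rw [hY, ← sumS_sub_sumY] at h1
    have e : X i ω * (f (U ω) / c ω) -
        X i ω * (f ((∑ j ∈ (nbhd G i)ᶜ, X j ω) / c' ω) / c' ω) -
        d (U ω) / c ω ^ 2 * (X i ω * Y ω) =
        X i ω * (f (U ω) / c ω - f ((∑ j ∈ (nbhd G i)ᶜ, X j ω) / c' ω) / c' ω -
          Y ω / c ω ^ 2 * d (U ω)) := by ring
    rw [e, abs_mul]
    refine (mul_le_mul_of_nonneg_left h1 (abs_nonneg (X i ω))).trans_eq ?_
    simp only [shifted]
    ring
  refine abs_integral_le_integral_abs.trans ((integral_mono ((hI1.sub hI2).sub hI3).abs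
    (((hint3.const_mul 84).add (hIs.const_mul 48)).add (hdec.1.const_mul (8 / α))) hpt).trans ?_)
  simp only [Pi.add_apply]
  rw [integral_add_add (hint3.const_mul 84) (hIs.const_mul 48) (hdec.1.const_mul (8 / α)),
    integral_const_mul, integral_const_mul, integral_const_mul, hindep]
  have h2 : 0 ≤ ∫ ω, |X i ω| * Z ω * Z ω ∂P := integral_nonneg fun ω =>
    mul_nonneg (mul_nonneg (abs_nonneg _) (absSum_nonneg X _ ω)) (absSum_nonneg X _ ω)
  have h3 := mul_le_mul_of_nonneg_right hs2 h2
  have h4 := mul_le_mul_of_nonneg_left hdec.2 (by positivity : 0 ≤ 8 / α)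
  have h5 : 8 / α * (2 * (800 * α) * ∫ ω, |X i ω| * Z ω * Z ω ∂P) =
      12800 * ∫ ω, |X i ω| * Z ω * Z ω ∂P := by field_simp; ring
  rw [h5] at h4
  linarith

/-- Smooth version of the Berry-Esseen bound for the cut-off statistic. -/
theorem abs_integral_ramp_sub_le (F : NormalizedField P G X D κ) (hs : D ^ 4 * κ ≤ 1 / 64) {z : ℝ}
    (hz : |z| * (D ^ 6 * κ ^ 3) ≤ 1 / 128) :
    |∫ ω, ramp z (64 * (D ^ 6 * κ ^ 3)) (cutStat G X ω) ∂P -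
        ∫ x, ramp z (64 * (D ^ 6 * κ ^ 3)) x ∂gaussianReal 0 1| ≤
      13188 * (D ^ 6 * κ ^ 3) := by
  set α := 64 * (D ^ 6 * κ ^ 3) with hαd
  obtain ⟨f, hd, hf0, hf1⟩ := exists_stein_solution (continuous_ramp z α) (ramp_nonneg z α)
    (ramp_le_one z α)
  set μ := ∫ x, ramp z α x ∂gaussianReal 0 1 with hμ
  have hgi : Integrable (ramp z α) (gaussianReal 0 1) :=
    (integrable_const (1 : ℝ)).mono' (continuous_ramp z α).aestronglyMeasurable
      (Filter.Eventually.of_forall fun x => by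
        rw [Real.norm_eq_abs, abs_of_nonneg (ramp_nonneg _ _ _)]; exact ramp_le_one _ _ _)
  have hμ0 : 0 ≤ μ := integral_nonneg (ramp_nonneg z α)
  have hμ1 : μ ≤ 1 := by
    have := integral_mono hgi (integrable_const (1 : ℝ)) (ramp_le_one z α)
    simpa using this
  set U := cutStat G X with hU
  set Q := crossSum G X Finset.univ with hQ
  have hUm : Measurable U := F.measurable_cutStat
  have hQm : Measurable Q := F.measurable_crossSum _
  set d : ℝ → ℝ := fun w => w * f w + (ramp z α w - μ) with hdd
  have hdb : ∀ w, |d w| ≤ 2 :=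
    abs_stein_deriv_le (ramp_nonneg z α) (ramp_le_one z α) hμ0 hμ1 hf1
  have hfc : Continuous f := continuous_iff_continuousAt.2 fun w => (hd w).continuousAt
  have hdc : Continuous d := (continuous_id.mul hfc).add ((continuous_ramp z α).sub continuous_const)
  have hbdd : ∀ {φ : Ω → ℝ} {b : ℝ}, Measurable φ → (∀ ω, |φ ω| ≤ b) → Integrable φ P :=
    fun {φ b} hm hb => (integrable_const b).mono' hm.aestronglyMeasurable
      (Filter.Eventually.of_forall hb)
  have hId : Integrable (fun ω => d (U ω)) P := hbdd (hdc.measurable.comp hUm) fun ω => hdb _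
  have hIuf : Integrable (fun ω => U ω * f (U ω)) P :=
    hbdd (hUm.mul (hfc.measurable.comp hUm)) fun ω => hf1 _
  have hIr : Integrable (fun ω => ramp z α (U ω)) P :=
    hbdd ((continuous_ramp z α).measurable.comp hUm) (b := 1) fun ω => by
      rw [abs_of_nonneg (ramp_nonneg _ _ _)]; exact ramp_le_one _ _ _
  have hc1 : ∀ ω, 1 / 2 ≤ clampSqrt (Q ω) := fun ω => half_le_clampSqrt _
  have hcm : Measurable (fun ω => clampSqrt (Q ω)) := measurable_clampSqrt.comp hQm
  have hIX : ∀ i, Integrable (fun ω => X i ω * (f (U ω) / clampSqrt (Q ω))) P := fun i => by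
    have := integrable_bdd_mul (F.integrable i) ((hfc.measurable.comp hUm).div hcm) (c := 6)
      (fun ω => by
        simp only [Pi.div_apply, Function.comp]
        rw [abs_div, abs_of_pos (clampSqrt_pos _), div_le_iff₀ (clampSqrt_pos _)]
        linarith [hf0 (U ω), hc1 ω])
    exact this.congr (Filter.Eventually.of_forall fun ω => mul_comm _ _)
  have hdcb : ∀ ω, |d (U ω) / clampSqrt (Q ω) ^ 2| ≤ 8 := fun ω => by
    have h1 : (1 : ℝ) / 4 ≤ clampSqrt (Q ω) ^ 2 := by nlinarith [hc1 ω]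
    rw [abs_div, abs_of_pos (by linarith : 0 < clampSqrt (Q ω) ^ 2), div_le_iff₀ (by linarith)]
    linarith [hdb (U ω)]
  have hdcm : Measurable (fun ω => d (U ω) / clampSqrt (Q ω) ^ 2) :=
    (hdc.measurable.comp hUm).div (hcm.pow_const 2)
  have hIXY : ∀ i, Integrable
      (fun ω => d (U ω) / clampSqrt (Q ω) ^ 2 * (X i ω * sumY G X i ω)) P := fun i =>
    integrable_bdd_mul (F.integrable_mul_sumY i) hdcm hdcb
  have hIQ : Integrable (fun ω => d (U ω) / clampSqrt (Q ω) ^ 2 * Q ω) P :=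
    integrable_bdd_mul (F.integrable_crossSum _) hdcm hdcb
  have e1 : ∫ ω, U ω * f (U ω) ∂P =
      ∑ i, ∫ ω, X i ω * (f (U ω) / clampSqrt (Q ω)) ∂P := by
    rw [← integral_finsetSum _ fun i _ => hIX i]
    congr 1; ext ω
    rw [← Finset.sum_mul]
    simp only [hU, cutStat]
    ring
  have e2 : ∫ ω, d (U ω) / clampSqrt (Q ω) ^ 2 * Q ω ∂P =
      ∑ i, ∫ ω, d (U ω) / clampSqrt (Q ω) ^ 2 * (X i ω * sumY G X i ω) ∂P := by
    rw [← integral_finsetSum _ fun i _ => hIXY i]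
    congr 1; ext ω
    rw [← Finset.mul_sum]
    rfl
  have h1 : |∫ ω, U ω * f (U ω) ∂P - ∫ ω, d (U ω) / clampSqrt (Q ω) ^ 2 * Q ω ∂P| ≤
      12980 * (D ^ 6 * κ ^ 3) := by
    rw [e1, e2, ← Finset.sum_sub_distrib]
    refine (Finset.abs_sum_le_sum_abs _ _).trans ((Finset.sum_le_sum fun i _ =>
      F.abs_integral_stein_le hs hz hd hμ0 hμ1 hf0 hf1 i).trans ?_)
    rw [Finset.sum_add_distrib, ← Finset.mul_sum, ← Finset.mul_sum]
    linarith [F.sum_integral_ballThree_le, F.sum_integral_ballTwo_le Finset.univ]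
  -- Replacing Q/c² by 1 costs 2 · 13 times the mean excess 8β.
  have h2 : |∫ ω, d (U ω) ∂P - ∫ ω, d (U ω) / clampSqrt (Q ω) ^ 2 * Q ω ∂P| ≤
      208 * (D ^ 6 * κ ^ 3) := by
    rw [← integral_sub hId hIQ]
    have hdev := F.integral_crossSum_dev_le Finset.univ
    rw [F.integral_crossSum_univ] at hdev
    have hIdev : Integrable (fun ω => max (|Q ω - 1| - 1 / 8) 0) P :=
      ((((F.integrable_crossSum _).sub (integrable_const _)).abs).sub (integrable_const _)).sup
        (integrable_const 0)
    refine abs_integral_le_integral_abs.trans ((integral_mono (hId.sub hIQ).abs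
      (hIdev.const_mul 26) fun ω => ?_).trans ?_)
    · simp only [Pi.sub_apply]
      have e : d (U ω) - d (U ω) / clampSqrt (Q ω) ^ 2 * Q ω =
          d (U ω) * (1 - Q ω / clampSqrt (Q ω) ^ 2) := by ring
      rw [e, abs_mul]
      exact (mul_le_mul (hdb _) (abs_one_sub_div_clampSqrt_sq_le (Q ω)) (abs_nonneg _)
        zero_le_two).trans_eq (by ring)
    · rw [integral_const_mul]
      linarith
  have e3 : ∫ ω, ramp z α (U ω) ∂P - μ = ∫ ω, d (U ω) ∂P - ∫ ω, U ω * f (U ω) ∂P := by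
    have : ∫ ω, d (U ω) ∂P = ∫ ω, U ω * f (U ω) ∂P + (∫ ω, ramp z α (U ω) ∂P - μ) := by
      simp only [hdd]
      rw [integral_add (g := fun ω => ramp z α (U ω) - μ) hIuf (hIr.sub (integrable_const _)),
        integral_sub hIr (integrable_const _)]
      simp
    rw [this]; ring
  rw [e3]
  have h3 := abs_le.1 h1
  have h4 := abs_le.1 h2
  rw [abs_le]
  constructor <;> linarith

end NormalizedField

end GraphDep

/-! ### Gaussian tails and smoothing inequalities -/

namespace GraphDep

theorem gaussianPDF_le_one (x : ℝ) : gaussianPDF 0 1 x ≤ 1 := by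
  rw [gaussianPDF, ← ENNReal.ofReal_one]
  refine ENNReal.ofReal_le_ofReal ?_
  rw [gaussianPDFReal]
  have h1 : (√(2 * Real.pi * ((1 : NNReal) : ℝ)))⁻¹ ≤ 1 := by
    refine inv_le_one_of_one_le₀ (Real.one_le_sqrt.2 ?_)
    have := Real.pi_gt_three
    push_cast
    linarith
  have h2 : Real.exp (-(x - 0) ^ 2 / (2 * ((1 : NNReal) : ℝ))) ≤ 1 := by
    rw [Real.exp_le_one_iff]
    push_cast
    nlinarith [sq_nonneg (x - 0)]
  exact mul_le_one₀ h1 (Real.exp_pos _).le h2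

theorem cdf_gaussian_add_le (z : ℝ) {a : ℝ} (ha : 0 ≤ a) :
    cdf (gaussianReal 0 1) (z + a) ≤ cdf (gaussianReal 0 1) z + a := by
  have h1 : ENNReal.ofReal (cdf (gaussianReal 0 1) (z + a) - cdf (gaussianReal 0 1) z) ≤
      ENNReal.ofReal a := by
    rw [← StieltjesFunction.measure_Ioc, measure_cdf, gaussianReal_apply 0 one_ne_zero]
    calc ∫⁻ x in Set.Ioc z (z + a), gaussianPDF 0 1 x
        ≤ ∫⁻ _ in Set.Ioc z (z + a), 1 := lintegral_mono fun x => gaussianPDF_le_one x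
      _ = ENNReal.ofReal a := by simp
  rw [ENNReal.ofReal_le_ofReal_iff ha] at h1
  linarith

/-- The cubic term of the exponential series at s²/2 is s⁶/48. The power 6 matches the truncation
level n^(1/12), which must leave a tail of order n^(-1/2). -/
theorem exp_neg_sq_half_le {s : ℝ} (hs : 0 < s) : Real.exp (-(s ^ 2 / 2)) ≤ 48 / s ^ 6 := by
  have h := Real.pow_div_factorial_le_exp (s ^ 2 / 2) (by positivity) 3
  rw [Real.exp_neg, inv_le_comm₀ (Real.exp_pos _) (by positivity), inv_div]
  refine le_trans (le_of_eq ?_) h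
  norm_num [Nat.factorial]
  ring

theorem cdf_gaussian_neg_le {s : ℝ} (hs : 0 < s) :
    cdf (gaussianReal 0 1) (-s) ≤ 48 / s ^ 6 := by
  refine le_trans ?_ (exp_neg_sq_half_le hs)
  rw [cdf_eq_real]
  have h := measure_le_le_exp_mul_mgf (μ := gaussianReal 0 1) (X := id) (-s) (t := -s)
    (by linarith) (integrable_exp_mul_gaussianReal _)
  rw [mgf_id_gaussianReal, ← Real.exp_add] at h
  refine le_trans h (le_of_eq ?_)
  congr 1
  push_cast
  ring

theorem one_sub_cdf_gaussian_le {s : ℝ} (hs : 0 < s) :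
    1 - cdf (gaussianReal 0 1) s ≤ 48 / s ^ 6 := by
  refine le_trans ?_ (exp_neg_sq_half_le hs)
  rw [cdf_eq_real, ← probReal_compl_eq_one_sub measurableSet_Iic]
  have h := measure_ge_le_exp_mul_mgf (μ := gaussianReal 0 1) (X := id) s (t := s)
    hs.le (integrable_exp_mul_gaussianReal _)
  rw [mgf_id_gaussianReal, ← Real.exp_add] at h
  refine le_trans (measureReal_mono fun x hx => ?_) (le_trans h (le_of_eq ?_))
  · have h : s < x := by simpa using hx
    exact h.le
  · congr 1
    push_cast
    ring

section Smoothing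

variable {Ω : Type*} [MeasurableSpace Ω] {P : Measure Ω} [IsProbabilityMeasure P] {U : Ω → ℝ}

theorem integrable_ramp_comp (hU : Measurable U) (z α : ℝ) :
    Integrable (fun ω => ramp z α (U ω)) P := by
  refine (integrable_const (1 : ℝ)).mono'
    ((continuous_ramp z α).measurable.comp hU).aestronglyMeasurable
    (Filter.Eventually.of_forall fun ω => ?_)
  rw [Real.norm_eq_abs, abs_of_nonneg (ramp_nonneg _ _ _)]
  exact ramp_le_one _ _ _

theorem measureReal_le_integral_ramp (hU : Measurable U) {z α : ℝ} (hα : 0 < α) :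
    P.real {ω | U ω ≤ z} ≤ ∫ ω, ramp z α (U ω) ∂P := by
  have hm : MeasurableSet {ω | U ω ≤ z} := measurableSet_le hU measurable_const
  rw [← integral_indicator_one hm]
  refine integral_mono ((integrable_const 1).indicator hm) (integrable_ramp_comp hU z α)
    fun ω => ?_
  by_cases h : U ω ≤ z
  · rw [Set.indicator_of_mem (by exact h), ramp_eq_one hα h]
    rfl
  · rw [Set.indicator_of_notMem (by exact h)]
    exact ramp_nonneg _ _ _

theorem integral_ramp_le_measureReal (hU : Measurable U) {z α : ℝ} (hα : 0 < α) :
    ∫ ω, ramp z α (U ω) ∂P ≤ P.real {ω | U ω ≤ z + α} := by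
  have hm : MeasurableSet {ω | U ω ≤ z + α} := measurableSet_le hU measurable_const
  rw [← integral_indicator_one hm]
  refine integral_mono (integrable_ramp_comp hU z α) ((integrable_const 1).indicator hm)
    fun ω => ?_
  by_cases h : U ω ≤ z + α
  · rw [Set.indicator_of_mem (by exact h)]
    exact ramp_le_one _ _ _
  · rw [Set.indicator_of_notMem (by exact h), ramp_eq_zero hα (by linarith [not_le.1 h])]

theorem cdf_gaussian_le_integral_ramp (z : ℝ) {α : ℝ} (hα : 0 < α) :
    cdf (gaussianReal 0 1) z ≤ ∫ x, ramp z α x ∂gaussianReal 0 1 := by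
  rw [cdf_eq_real]
  exact measureReal_le_integral_ramp measurable_id hα

theorem integral_ramp_le_cdf_gaussian (z : ℝ) {α : ℝ} (hα : 0 < α) :
    ∫ x, ramp z α x ∂gaussianReal 0 1 ≤ cdf (gaussianReal 0 1) (z + α) := by
  rw [cdf_eq_real]
  exact integral_ramp_le_measureReal measurable_id hα

theorem measureReal_le_mono (z : ℝ) {z' : ℝ} (h : z ≤ z') :
    P.real {ω | U ω ≤ z} ≤ P.real {ω | U ω ≤ z'} :=
  measureReal_mono fun _ hω => le_trans hω h

/-- A Kolmogorov bound on a central range together with Gaussian tails gives a uniform one. -/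
theorem abs_measureReal_sub_cdf_gaussian_le_of_range {s a : ℝ} (hs : 0 < s)
    (h : ∀ z, |z| ≤ s → |P.real {ω | U ω ≤ z} - cdf (gaussianReal 0 1) z| ≤ a) (z : ℝ) :
    |P.real {ω | U ω ≤ z} - cdf (gaussianReal 0 1) z| ≤ a + 48 / s ^ 6 := by
  have h0 : 0 ≤ 48 / s ^ 6 := by positivity
  by_cases hz : |z| ≤ s
  · linarith [h z hz]
  have hP := measureReal_le_one (μ := P) (s := {ω | U ω ≤ z})
  have hP0 := measureReal_nonneg (μ := P) (s := {ω | U ω ≤ z})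
  have hΦ := cdf_le_one (gaussianReal 0 1) z
  have hΦ0 := cdf_nonneg (gaussianReal 0 1) z
  rcases lt_abs.1 (not_le.1 hz) with hz | hz
  · have h1 := abs_le.1 (h s (abs_of_pos hs).le)
    have h2 := one_sub_cdf_gaussian_le hs
    have h3 := measureReal_le_mono (P := P) (U := U) s hz.le
    have h4 := monotone_cdf (gaussianReal 0 1) hz.le
    rw [abs_le]
    constructor <;> linarith
  · have hz' : z ≤ -s := by linarith
    have h1 := abs_le.1 (h (-s) (by rw [abs_neg, abs_of_pos hs]))
    have h2 := cdf_gaussian_neg_le hs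
    have h3 := measureReal_le_mono (P := P) (U := U) z hz'
    have h4 := monotone_cdf (gaussianReal 0 1) hz'
    rw [abs_le]
    constructor <;> linarith

/-- The probability that `U` is large, from a uniform distance to the Gaussian law. -/
theorem measureReal_lt_abs_le (hU : Measurable U) {s δ : ℝ} (hs : 0 < s)
    (h : ∀ z, |P.real {ω | U ω ≤ z} - cdf (gaussianReal 0 1) z| ≤ δ) :
    P.real {ω | s < |U ω|} ≤ 2 * δ + 2 * (48 / s ^ 6) := by
  have h1 := abs_le.1 (h s)
  have h2 := abs_le.1 (h (-s))
  have h3 := one_sub_cdf_gaussian_le hs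
  have h4 := cdf_gaussian_neg_le hs
  have h5 : P.real {ω | s < |U ω|} ≤ P.real ({ω | U ω ≤ s}ᶜ ∪ {ω | U ω ≤ -s}) := by
    refine measureReal_mono fun ω hω => ?_
    have hω : s < |U ω| := hω
    rcases lt_abs.1 hω with hω | hω
    · left
      exact not_le.2 hω
    · right
      exact (by linarith : U ω ≤ -s)
  have h6 := measureReal_union_le (μ := P) {ω | U ω ≤ s}ᶜ {ω | U ω ≤ -s}
  rw [probReal_compl_eq_one_sub (measurableSet_le hU measurable_const)] at h6
  linarith

/-- Two statistics that are within `ε` outside of an event of probability at most `p` have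
close distances to the Gaussian law. -/
theorem abs_measureReal_sub_cdf_gaussian_le_of_close {W : Ω → ℝ} {E : Set Ω} {ε p δ : ℝ}
    (hε : 0 ≤ ε) (h : ∀ z, |P.real {ω | U ω ≤ z} - cdf (gaussianReal 0 1) z| ≤ δ)
    (hE : P.real E ≤ p) (hW : ∀ ω ∉ E, |W ω - U ω| ≤ ε) (z : ℝ) :
    |P.real {ω | W ω ≤ z} - cdf (gaussianReal 0 1) z| ≤ δ + ε + p := by
  have h1 : P.real {ω | W ω ≤ z} ≤ P.real {ω | U ω ≤ z + ε} + P.real E := by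
    refine le_trans (measureReal_mono fun ω hω => ?_) (measureReal_union_le _ _)
    have hω : W ω ≤ z := hω
    by_cases hωE : ω ∈ E
    · exact Or.inr hωE
    · have := abs_le.1 (hW ω hωE)
      exact Or.inl (by linarith : U ω ≤ z + ε)
  have h2 : P.real {ω | U ω ≤ z - ε} ≤ P.real {ω | W ω ≤ z} + P.real E := by
    refine le_trans (measureReal_mono fun ω hω => ?_) (measureReal_union_le _ _)
    have hω : U ω ≤ z - ε := hω
    by_cases hωE : ω ∈ E
    · exact Or.inr hωE
    · have := abs_le.1 (hW ω hωE)
      exact Or.inl (by linarith : W ω ≤ z)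
  have h3 := abs_le.1 (h (z + ε))
  have h4 := abs_le.1 (h (z - ε))
  have h5 := cdf_gaussian_add_le z hε
  have h6 := cdf_gaussian_add_le (z - ε) hε
  rw [sub_add_cancel] at h6
  rw [abs_le]
  constructor <;> linarith

end Smoothing

/-! ### Kolmogorov distance of the cut-off statistic -/

namespace NormalizedField

variable {V Ω : Type*} [Fintype V] [DecidableEq V] [MeasurableSpace Ω]
  {P : Measure Ω} [IsProbabilityMeasure P] {G : SimpleGraph V} [DecidableRel G.Adj]
  {X : V → Ω → ℝ} {D κ : ℝ}

theorem pow_mul_pow_le (F : NormalizedField P G X D κ) (hs : D ^ 4 * κ ≤ 1 / 64) :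
    D ^ 6 * κ ^ 3 ≤ 1 / 64 ^ 3 := by
  have h1 : (D ^ 4 * κ) ^ 3 ≤ (1 / 64) ^ 3 :=
    pow_le_pow_left₀ (mul_nonneg (by have := F.pos_D; positivity) F.pos.le) hs 3
  have h2 : D ^ 6 * κ ^ 3 ≤ D ^ 12 * κ ^ 3 :=
    mul_le_mul_of_nonneg_right (pow_le_pow_right₀ F.one_le (by norm_num))
      (pow_nonneg F.pos.le 3)
  calc D ^ 6 * κ ^ 3 ≤ (D ^ 4 * κ) ^ 3 := by rw [mul_pow, ← pow_mul]; exact h2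
    _ ≤ _ := h1.trans_eq (by norm_num)

/-- The Berry--Esseen bound for the cut-off statistic. -/
theorem abs_measureReal_cutStat_sub_le (F : NormalizedField P G X D κ)
    (hs : D ^ 4 * κ ≤ 1 / 64) (z : ℝ) :
    |P.real {ω | cutStat G X ω ≤ z} - cdf (gaussianReal 0 1) z| ≤ 13253 * (D ^ 6 * κ ^ 3) := by
  have hβ := F.pow_mul_pow_le hs
  have hβ0 : 0 < D ^ 6 * κ ^ 3 := by have := F.pos_D; have := F.pos; positivity
  have hramp := fun z => F.abs_integral_ramp_sub_le (z := z) hs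
  generalize D ^ 6 * κ ^ 3 = β at *
  have hα : 0 < 64 * β := by positivity
  -- Ramps starting at z and at z - α sandwich the indicator, and the Gaussian distribution function
  -- moves by at most α. The range 1/(256β) leaves room for the shifted level.
  have hmid : ∀ z, |z| ≤ 1 / (256 * β) →
      |P.real {ω | cutStat G X ω ≤ z} - cdf (gaussianReal 0 1) z| ≤ 13252 * β := by
    intro z hz
    rw [le_div_iff₀ (by positivity)] at hz
    have h1 := abs_le.1 (hramp z (by linarith))
    have h2 := abs_le.1 (hramp (z - 64 * β) (by
      have := abs_sub z (64 * β)
      rw [abs_of_pos hα] at this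
      nlinarith))
    have h3 := measureReal_le_integral_ramp (P := P) F.measurable_cutStat (z := z) hα
    have h4 := integral_ramp_le_measureReal (P := P) F.measurable_cutStat (z := z - 64 * β) hα
    have h5 := integral_ramp_le_cdf_gaussian z hα
    have h6 := cdf_gaussian_le_integral_ramp (z - 64 * β) hα
    have h7 := cdf_gaussian_add_le z hα.le
    have h8 := cdf_gaussian_add_le (z - 64 * β) hα.le
    rw [sub_add_cancel] at h4 h8
    rw [abs_le]
    constructor <;> linarith
  refine (abs_measureReal_sub_cdf_gaussian_le_of_range (by positivity) hmid z).trans ?_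
  -- Since β ≤ 2⁻¹⁸, the tail 48(256β)⁶ beyond the central range is far below β.
  have h : 48 / (1 / (256 * β)) ^ 6 ≤ β := by
    have h5 : β ^ 5 ≤ (1 / 64 ^ 3) ^ 5 := pow_le_pow_left₀ hβ0.le hβ 5
    rw [div_pow, one_pow, div_div_eq_mul_div, div_one]
    calc 48 * (256 * β) ^ 6 = 48 * 256 ^ 6 * β ^ 5 * β := by ring
      _ ≤ 1 * β := by
          refine mul_le_mul_of_nonneg_right ?_ hβ0.le
          norm_num at h5 ⊢
          linarith
      _ = β := one_mul β
  linarith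

end NormalizedField

end GraphDep

/-! ### Restoring the centring of the normalizer -/

namespace GraphDep

theorem abs_inv_sqrt_sub_inv_sqrt_le {a b : ℝ} (ha : 1 / 2 ≤ a) (hb : 1 / 2 ≤ b) :
    |(√a)⁻¹ - (√b)⁻¹| ≤ 2 * |a - b| := by
  have ha0 : 0 < √a := Real.sqrt_pos.2 (by linarith)
  have hb0 : 0 < √b := Real.sqrt_pos.2 (by linarith)
  have ha2 : 1 / 2 ≤ √a := Real.le_sqrt_of_sq_le (by linarith)
  have hb2 : 1 / 2 ≤ √b := Real.le_sqrt_of_sq_le (by linarith)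
  have hab : 1 / 2 ≤ √a * √b := by
    rw [← Real.sqrt_mul (by linarith)]
    exact Real.le_sqrt_of_sq_le (by nlinarith)
  have h1 : |√a - √b| ≤ |a - b| := by
    have e : a - b = (√a - √b) * (√a + √b) := by
      ring_nf
      rw [Real.sq_sqrt (by linarith), Real.sq_sqrt (by linarith)]
    rw [e, abs_mul, abs_of_pos (add_pos ha0 hb0)]
    nlinarith [abs_nonneg (√a - √b)]
  have e : (√a)⁻¹ - (√b)⁻¹ = -((√a - √b) / (√a * √b)) := by
    field_simp
    ring
  rw [e, abs_neg, abs_div, abs_of_pos (mul_pos ha0 hb0), div_le_iff₀ (mul_pos ha0 hb0)]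
  nlinarith [abs_nonneg (a - b)]

section Pointwise

variable {V Ω : Type*} [Fintype V] [DecidableEq V] (G : SimpleGraph V) [DecidableRel G.Adj]
  (X : V → Ω → ℝ)

theorem sum_sumY (ω : Ω) :
    ∑ i, sumY G X i ω = ∑ i, ((nbhd G i).card : ℝ) * X i ω := by
  have h : ∀ i j, (if j ∈ nbhd G i then X j ω else 0) = if i ∈ nbhd G j then X j ω else 0 :=
    fun i j => by simp only [mem_nbhd_comm G (i := i) (j := j)]
  calc ∑ i, sumY G X i ω = ∑ i, ∑ j, if j ∈ nbhd G i then X j ω else 0 := by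
        simp [sumY, Finset.sum_ite_mem]
    _ = ∑ j, ∑ i, if j ∈ nbhd G i then X j ω else 0 := Finset.sum_comm
    _ = ∑ i, ((nbhd G i).card : ℝ) * X i ω := by
        simp [h, Finset.sum_ite_mem]

theorem sum_sub_avg_mul_avg [Nonempty V] (ω : Ω) :
    ∑ i, (X i ω * sumY G X i ω - avg X ω * avg (sumY G X) ω) =
      crossSum G X Finset.univ ω - (∑ i, X i ω) * (∑ i, sumY G X i ω) / Fintype.card V := by
  have hn : (Fintype.card V : ℝ) ≠ 0 := by simp
  rw [Finset.sum_sub_distrib, Finset.sum_const, Finset.card_univ, nsmul_eq_mul, crossSum, avg, avg]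
  field_simp

/-- On this event Q and Q - ST/n are at least 1/2, so neither the positive part nor the cut-off
acts, and the inverse roots differ by at most 2|ST|/n. |S| ≤ s follows because the cut-off root is
at most 2. -/
theorem abs_statW_sub_cutStat_le [Nonempty V] {s t : ℝ} {ω : Ω} (hs : 0 ≤ s)
    (hst : s * t / Fintype.card V ≤ 1 / 4) (hQ : |crossSum G X Finset.univ ω - 1| ≤ 1 / 4)
    (hU : |NormalizedField.cutStat G X ω| ≤ s / 2) (hT : |∑ i, sumY G X i ω| ≤ t) :
    |statW G X ω - NormalizedField.cutStat G X ω| ≤ 2 * s ^ 2 * t / Fintype.card V := by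
  have hn : (0 : ℝ) < Fintype.card V := Nat.cast_pos.2 Fintype.card_pos
  have hQ' := abs_le.1 hQ
  rw [statW, normV, sum_sub_avg_mul_avg, sumS]
  rw [NormalizedField.cutStat] at hU ⊢
  set Q := crossSum G X Finset.univ ω
  set T := ∑ i, sumY G X i ω
  set S := ∑ i, X i ω
  have hS : |S| ≤ s := by
    have hc := clampSqrt_pos Q
    have hc2 := clampSqrt_le_two Q
    rw [abs_div, abs_of_pos hc, div_le_iff₀ hc] at hU
    nlinarith
  have hST : |S * T / Fintype.card V| ≤ s * t / Fintype.card V := by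
    rw [abs_div, abs_mul, abs_of_pos hn]
    gcongr
  have h1 := abs_le.1 (hST.trans hst)
  rw [max_eq_left (by linarith), clampSqrt_eq (by linarith) (by linarith), div_eq_mul_inv S,
    div_eq_mul_inv S, ← mul_sub, abs_mul]
  have h2 := abs_inv_sqrt_sub_inv_sqrt_le (a := Q - S * T / Fintype.card V) (b := Q) (by linarith)
    (by linarith)
  rw [sub_sub_cancel_left, abs_neg] at h2
  calc _ ≤ s * (2 * (s * t / Fintype.card V)) := 
        mul_le_mul hS (h2.trans (by linarith)) (abs_nonneg _) hs
    _ = _ := by ring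

end Pointwise

namespace NormalizedField

variable {V Ω : Type*} [Fintype V] [DecidableEq V] [MeasurableSpace Ω]
  {P : Measure Ω} [IsProbabilityMeasure P] {G : SimpleGraph V} [DecidableRel G.Adj]
  {X : V → Ω → ℝ} {D κ : ℝ}

theorem nonempty (F : NormalizedField P G X D κ) : Nonempty V := by
  by_contra h
  rw [not_nonempty_iff] at h
  simpa using F.unit

theorem integral_sum_sumY_sq_le (F : NormalizedField P G X D κ) :
    ∫ ω, (∑ i, sumY G X i ω) ^ 2 ∂P ≤ D ^ 3 * ∑ i, ∫ ω, X i ω ^ 2 ∂P := by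
  simp only [sum_sumY]
  refine (F.integral_weighted_sum_sq_le Finset.univ fun i => ((nbhd G i).card : ℝ)).trans ?_
  rw [show D ^ 3 * ∑ i, ∫ ω, X i ω ^ 2 ∂P = D * ∑ i, D ^ 2 * ∫ ω, X i ω ^ 2 ∂P by
    rw [← Finset.mul_sum]; ring]
  refine mul_le_mul_of_nonneg_left (Finset.sum_le_sum fun i _ => ?_) F.pos_D.le
  exact mul_le_mul_of_nonneg_right (pow_le_pow_left₀ (Nat.cast_nonneg _) (F.card_le i) 2)
    (integral_nonneg fun ω => sq_nonneg _)

theorem measureReal_abs_sum_sumY_le (F : NormalizedField P G X D κ) {t : ℝ} (ht : 0 < t) :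
    P.real {ω | t < |∑ i, sumY G X i ω|} ≤ D ^ 3 * (∑ i, ∫ ω, X i ω ^ 2 ∂P) / t ^ 2 := by
  have hint : Integrable (fun ω => (∑ i, sumY G X i ω) ^ 2) P :=
    (memLp_finsetSum Finset.univ fun i _ => F.memLp_two_sum (nbhd G i)).integrable_sq
  have h := mul_meas_ge_le_integral_of_nonneg (μ := P)
    (Filter.Eventually.of_forall fun ω => sq_nonneg (∑ i, sumY G X i ω)) hint (t ^ 2)
  have h2 : P.real {ω | t < |∑ i, sumY G X i ω|} ≤
      P.real {ω | t ^ 2 ≤ (∑ i, sumY G X i ω) ^ 2} := by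
    refine measureReal_mono fun ω hω => ?_
    have hω : t < |∑ i, sumY G X i ω| := hω
    have h3 : t ^ 2 ≤ (∑ i, sumY G X i ω) ^ 2 := by
      rw [← sq_abs (∑ i, sumY G X i ω)]
      exact pow_le_pow_left₀ ht.le hω.le 2
    exact h3
  rw [le_div_iff₀ (by positivity), mul_comm]
  exact ((mul_le_mul_of_nonneg_left h2 (sq_nonneg t)).trans h).trans F.integral_sum_sumY_sq_le

theorem measureReal_crossSum_dev_le (F : NormalizedField P G X D κ) :
    P.real {ω | 1 / 4 < |crossSum G X Finset.univ ω - 1|} ≤ 64 * (D ^ 6 * κ ^ 3) := by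
  have hd := F.integral_crossSum_dev_le Finset.univ
  rw [F.integral_crossSum_univ] at hd
  have hint : Integrable (fun ω => max (|crossSum G X Finset.univ ω - 1| - 1 / 8) 0) P :=
    ((((F.integrable_crossSum Finset.univ).sub (integrable_const 1)).abs.sub
      (integrable_const (1 / 8))).sup (integrable_const 0))
  have h := mul_meas_ge_le_integral_of_nonneg (μ := P)
    (Filter.Eventually.of_forall fun ω => le_max_right _ _) hint (1 / 8)
  have h2 : P.real {ω | 1 / 4 < |crossSum G X Finset.univ ω - 1|} ≤
      P.real {ω | 1 / 8 ≤ max (|crossSum G X Finset.univ ω - 1| - 1 / 8) 0} := by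
    refine measureReal_mono fun ω hω => ?_
    have hω : 1 / 4 < |crossSum G X Finset.univ ω - 1| := hω
    have h3 : 1 / 8 ≤ max (|crossSum G X Finset.univ ω - 1| - 1 / 8) 0 :=
      le_max_of_le_left (by linarith)
    exact h3
  have h4 : 1 / 8 * P.real {ω | 1 / 8 ≤ max (|crossSum G X Finset.univ ω - 1| - 1 / 8) 0} ≤
      8 * (D ^ 6 * κ ^ 3) := h.trans hd
  linarith

/-- The distance of the self-normalized sum to the Gaussian law, with free truncation levels for
the sum and for the total of the neighbourhood sums. -/
theorem abs_measureReal_statW_sub_le (F : NormalizedField P G X D κ)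
    (hD : D ^ 4 * κ ≤ 1 / 64) {s t : ℝ} (hs : 0 < s) (ht : 0 < t)
    (hst : s * t / Fintype.card V ≤ 1 / 4) (z : ℝ) :
    |P.real {ω | statW G X ω ≤ z} - cdf (gaussianReal 0 1) z| ≤
      39823 * (D ^ 6 * κ ^ 3) + 2 * s ^ 2 * t / Fintype.card V +
        D ^ 3 * (∑ i, ∫ ω, X i ω ^ 2 ∂P) / t ^ 2 + 6144 / s ^ 6 := by
  have := F.nonempty
  have hU := F.abs_measureReal_cutStat_sub_le hD
  have h1 := F.measureReal_crossSum_dev_le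
  have h2 := F.measureReal_abs_sum_sumY_le ht
  have h3 := measureReal_lt_abs_le F.measurable_cutStat (half_pos hs) hU
  set E₁ := {ω | 1 / 4 < |crossSum G X Finset.univ ω - 1|}
  set E₂ := {ω | t < |∑ i, sumY G X i ω|}
  set E₃ := {ω | s / 2 < |cutStat G X ω|}
  have h4 := measureReal_union_le (μ := P) (E₁ ∪ E₂) E₃
  have h5 := measureReal_union_le (μ := P) E₁ E₂
  have h6 : 0 ≤ 2 * s ^ 2 * t / (Fintype.card V : ℝ) := by positivity
  refine (abs_measureReal_sub_cdf_gaussian_le_of_close (E := E₁ ∪ E₂ ∪ E₃) h6 hU le_rfl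
    (fun ω hω => ?_) z).trans ?_
  · have hω1 : ¬ 1 / 4 < |crossSum G X Finset.univ ω - 1| := fun h => hω (Or.inl (Or.inl h))
    have hω2 : ¬ t < |∑ i, sumY G X i ω| := fun h => hω (Or.inl (Or.inr h))
    have hω3 : ¬ s / 2 < |cutStat G X ω| := fun h => hω (Or.inr h)
    exact abs_statW_sub_cutStat_le G X hs.le hst (not_lt.1 hω1) (not_lt.1 hω3) (not_lt.1 hω2)
  · have e : 48 / (s / 2) ^ 6 = 3072 / s ^ 6 := by field_simp; norm_num
    have e2 : 6144 / s ^ 6 = 2 * (3072 / s ^ 6) := by ring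
    rw [e] at h3
    rw [e2]
    linarith

/-- Hölder across the vertices, through `three_mul_integral_sq_le` at t = κ/m, which balances the
two terms. -/
theorem sum_integral_sq_le (F : NormalizedField P G X D κ) {m : ℝ} (hm : 0 < m)
    (hmn : m ^ 3 = Fintype.card V) : ∑ i, ∫ ω, X i ω ^ 2 ∂P ≤ m * κ ^ 2 := by
  have hκ := F.pos
  have h := Finset.sum_le_sum fun i (_ : i ∈ Finset.univ) =>
    F.three_mul_integral_sq_le i (div_pos hκ hm)
  rw [← Finset.mul_sum, Finset.sum_add_distrib, ← Finset.sum_div, ← Finset.mul_sum,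
    Finset.sum_const, Finset.card_univ, nsmul_eq_mul, ← hmn] at h
  have h2 : 2 * (∑ i, ∫ ω, |X i ω| ^ 3 ∂P) / (κ / m) ≤ 2 * κ ^ 3 / (κ / m) := by
    have := F.sum_cube
    gcongr
  have e : 2 * κ ^ 3 / (κ / m) + m ^ 3 * (κ / m) ^ 2 = 3 * (m * κ ^ 2) := by
    field_simp
    ring
  linarith

/-- The theorem for a normalized field, with `r` the twelfth root of the number of vertices. -/
theorem abs_measureReal_statW_sub_le_of_root (F : NormalizedField P G X D κ) {d r : ℝ}
    (hd : 1 ≤ d) (hDd : D ≤ 2 * d) (hr : 0 < r) (hrn : r ^ 12 = Fintype.card V) (z : ℝ) :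
    |P.real {ω | statW G X ω ≤ z} - cdf (gaussianReal 0 1) z| ≤
      2 ^ 31 * d ^ 9 * (1 + d ^ 6 * r ^ 4 * κ ^ 2) * (1 / r ^ 6 + κ ^ 3) := by
  have := F.nonempty
  have hκ := F.pos
  have hD0 := F.pos_D
  have hr1 : 1 ≤ r := by
    have h : (1 : ℝ) ≤ r ^ 12 := by
      rw [hrn]
      exact_mod_cast Fintype.card_pos (α := V)
    exact (one_le_pow_iff_of_nonneg hr.le (by norm_num)).1 h
  have hBM := F.sum_integral_sq_le (m := r ^ 4) (by positivity) (by rw [← pow_mul]; exact hrn)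
  have hDB := F.one_le_mul_sum_sq
  have hst := fun hD z t ht => F.abs_measureReal_statW_sub_le (s := r) (t := t) hD hr ht (z := z)
  set B := ∑ i, ∫ ω, X i ω ^ 2 ∂P
  rw [← hrn] at hst
  set M := r ^ 4 * κ ^ 2
  -- The claimed bound without its constant; wherever R is bounded below, the statement is trivial
  -- by `htriv`.
  set R := d ^ 9 * (1 + d ^ 6 * M) * (1 / r ^ 6 + κ ^ 3) with hR
  have hB : 0 < B := pos_of_mul_pos_right (lt_of_lt_of_le one_pos hDB) hD0.le
  have hM : 0 < M := by positivity
  have hd9 : 1 ≤ d ^ 9 := one_le_pow₀ hd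
  have hd6 : 1 ≤ d ^ 6 := one_le_pow₀ hd
  have hr6 : 0 < 1 / r ^ 6 := by positivity
  have hκ3 : 0 < κ ^ 3 := by positivity
  have hd0 : 0 < d := by linarith
  have hdM : 0 ≤ d ^ 6 * M := by positivity
  have hRr : 1 / r ^ 6 ≤ R := by
    calc 1 / r ^ 6 = 1 * 1 * (1 / r ^ 6) := by ring
      _ ≤ R := by
        rw [hR]
        gcongr <;> linarith
  have hRβ : D ^ 6 * κ ^ 3 ≤ 64 * R := by
    have h1 : D ^ 6 ≤ (2 * d) ^ 6 := by gcongr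
    have h2 : d ^ 6 ≤ d ^ 9 := pow_le_pow_right₀ hd (by norm_num)
    calc D ^ 6 * κ ^ 3 ≤ (2 * d) ^ 6 * κ ^ 3 := by gcongr
      _ = 64 * (d ^ 6 * 1 * κ ^ 3) := by ring
      _ ≤ 64 * R := by
        rw [hR]
        gcongr <;> linarith
  have hRB : (D ^ 3 + B) * (1 / r ^ 6) ≤ 8 * R := by
    have h1 : D ^ 3 ≤ (2 * d) ^ 3 := by gcongr
    have h2 : d ^ 3 ≤ d ^ 9 := pow_le_pow_right₀ hd (by norm_num)
    have h3 : D ^ 3 + B ≤ 8 * (d ^ 9 * (1 + d ^ 6 * M)) := by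
      have h4 : M ≤ d ^ 9 * (d ^ 6 * M) := by
        calc M = 1 * (1 * M) := by ring
          _ ≤ _ := by gcongr
      have h5 : (2 * d) ^ 3 = 8 * d ^ 3 := by ring
      nlinarith
    calc _ ≤ 8 * (d ^ 9 * (1 + d ^ 6 * M)) * (1 / r ^ 6 + κ ^ 3) := by
          gcongr
          linarith
      _ = 8 * R := by rw [hR]; ring
  have hR0 : 0 < R := hr6.trans_le hRr
  have hgoal : 2 ^ 31 * d ^ 9 * (1 + d ^ 6 * r ^ 4 * κ ^ 2) * (1 / r ^ 6 + κ ^ 3) =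
      2 ^ 31 * R := by simp only [hR, M]; ring
  rw [hgoal]
  have htriv : 1 ≤ 2 ^ 31 * R →
      |P.real {ω | statW G X ω ≤ z} - cdf (gaussianReal 0 1) z| ≤ 2 ^ 31 * R := fun h => by
    have hP := measureReal_le_one (μ := P) (s := {ω | statW G X ω ≤ z})
    have hP0 := measureReal_nonneg (μ := P) (s := {ω | statW G X ω ≤ z})
    have hΦ := cdf_le_one (gaussianReal 0 1) z
    have hΦ0 := cdf_nonneg (gaussianReal 0 1) z
    rw [abs_le]
    constructor <;> linarith
  by_cases hDκ : D ^ 4 * κ ≤ 1 / 64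
  swap
  -- The lower bound 1 ≤ D·B ≤ 2dM raises d¹²κ³ to 2d¹⁵Mκ³ ≤ 2R. With D ≤ 2d and (D⁴κ)³ ≥ 2⁻¹⁸ this
  -- gives 1 ≤ 2^(18+12+1)R, the source of the constant 2³¹.
  · refine htriv ?_
    have h1 : (1 / 64) ^ 3 ≤ (D ^ 4 * κ) ^ 3 :=
      pow_le_pow_left₀ (by norm_num) (not_le.1 hDκ).le 3
    have h2 : 1 ≤ 2 * d * M := hDB.trans (by gcongr)
    have h3 : d ^ 12 * κ ^ 3 ≤ 2 * R := by
      calc d ^ 12 * κ ^ 3 = d ^ 12 * κ ^ 3 * 1 := by ring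
        _ ≤ d ^ 12 * κ ^ 3 * (2 * d * M) := by gcongr
        _ = 2 * (d ^ 13 * M * κ ^ 3) := by ring
        _ ≤ 2 * (d ^ 15 * M * κ ^ 3) := by
          gcongr
          norm_num
        _ = 2 * (d ^ 9 * (d ^ 6 * M) * κ ^ 3) := by ring
        _ ≤ 2 * R := by
          rw [hR]
          gcongr <;> linarith
    have h4 : (D ^ 4 * κ) ^ 3 ≤ 2 ^ 12 * (d ^ 12 * κ ^ 3) := by
      calc (D ^ 4 * κ) ^ 3 ≤ ((2 * d) ^ 4 * κ) ^ 3 := by gcongr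
        _ = _ := by ring
    norm_num at h1 h4 ⊢
    linarith
  -- The level t = q r³ makes the Chebyshev term exactly r⁻⁶, like the tail at s = r. The remaining
  -- 2s²t/n equals 2q r⁻⁷, and q ≤ D³ + B by AM-GM.
  set q := √(D ^ 3 * B)
  have hq0 : 0 < q := Real.sqrt_pos.2 (by positivity)
  have hq2 : q ^ 2 = D ^ 3 * B := Real.sq_sqrt (by positivity)
  have hq : q ≤ D ^ 3 + B := by
    refine Real.sqrt_le_iff.2 ⟨by positivity, ?_⟩
    nlinarith [pow_pos hD0 3]
  have hqR : q * (1 / r ^ 6) ≤ 8 * R := (mul_le_mul_of_nonneg_right hq hr6.le).trans hRB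
  have e1 : r * (q * r ^ 3) / r ^ 12 = q * (1 / r ^ 6) * (1 / r ^ 2) := by
    field_simp
  have e2 : 2 * r ^ 2 * (q * r ^ 3) / r ^ 12 = 2 * (q * (1 / r ^ 6) * (1 / r)) := by
    field_simp
  have e3 : D ^ 3 * B / (q * r ^ 3) ^ 2 = 1 / r ^ 6 := by
    rw [mul_pow, hq2]
    field_simp
  have hr2 : 1 / r ^ 2 ≤ 1 := (div_le_one (by positivity)).2 (one_le_pow₀ hr1)
  have hr' : 1 / r ≤ 1 := (div_le_one hr).2 hr1
  have hqr0 : 0 ≤ q * (1 / r ^ 6) := by positivity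
  have h1 : q * (1 / r ^ 6) * (1 / r ^ 2) ≤ 8 * R := (mul_le_of_le_one_right hqr0 hr2).trans hqR
  have h2 : q * (1 / r ^ 6) * (1 / r) ≤ 8 * R := (mul_le_of_le_one_right hqr0 hr').trans hqR
  by_cases hsmall : r * (q * r ^ 3) / r ^ 12 ≤ 1 / 4
  · have h := hst hDκ z (q * r ^ 3) (by positivity) hsmall
    rw [e2, e3, div_eq_mul_one_div (6144 : ℝ)] at h
    linarith
  -- If st/n exceeds 1/4, then so does 8R.
  · refine htriv ?_
    rw [e1] at hsmall
    linarith

end NormalizedField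

end GraphDep

/-! ### Reduction to unit variance -/

namespace GraphDep

variable {V Ω : Type*}

theorem IsDependencyGraph.div_const [MeasurableSpace Ω] {P : Measure Ω} {G : SimpleGraph V}
    {X : V → Ω → ℝ} (h : IsDependencyGraph P G X) (c : ℝ) :
    IsDependencyGraph P G fun i ω => X i ω / c := fun Γ₁ Γ₂ hd hG =>
  (h Γ₁ Γ₂ hd hG).comp
    (φ := fun (f : Γ₁ → ℝ) i => f i / c) (ψ := fun (f : Γ₂ → ℝ) j => f j / c)
    (by fun_prop) (by fun_prop)

variable [Fintype V] [DecidableEq V]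

theorem sumY_div_const (G : SimpleGraph V) [DecidableRel G.Adj] (X : V → Ω → ℝ) (c : ℝ) (i : V)
    (ω : Ω) : sumY G (fun i ω => X i ω / c) i ω = sumY G X i ω / c :=
  (Finset.sum_div _ _ _).symm

/-- Numerator and normalizer are homogeneous of degree one; where the normalizer vanishes both
quotients are 0 by convention. -/
theorem statW_div_const (G : SimpleGraph V) [DecidableRel G.Adj] (X : V → Ω → ℝ) {c : ℝ}
    (hc : 0 < c) : statW G (fun i ω => X i ω / c) = statW G X := by
  funext ω
  have hS : sumS (fun i ω => X i ω / c) ω = sumS X ω / c := (Finset.sum_div _ _ _).symm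
  have hV : normV G (fun i ω => X i ω / c) ω = normV G X ω / c := by
    have e : ∑ i, (X i ω / c * (sumY G X i ω / c) -
        avg (fun i ω => X i ω / c) ω * avg (fun i ω => sumY G X i ω / c) ω) =
        (∑ i, (X i ω * sumY G X i ω - avg X ω * avg (sumY G X) ω)) / c ^ 2 := by
      rw [Finset.sum_div]
      refine Finset.sum_congr rfl fun i _ => ?_
      simp only [avg, ← Finset.sum_div]
      ring
    have e2 : sumY G (fun i ω => X i ω / c) = fun i ω => sumY G X i ω / c := by
      funext i ω
      exact sumY_div_const G X c i ω
    simp only [normV, e2, e]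
    rw [← zero_div (c ^ 2), max_div_div_right (by positivity), zero_div,
      Real.sqrt_div (le_max_right _ _), Real.sqrt_sq hc.le]
  rw [statW, statW, hS, hV, div_div_div_cancel_right₀ hc.ne']

variable [MeasurableSpace Ω] {P : Measure Ω} [IsProbabilityMeasure P] {G : SimpleGraph V}
  [DecidableRel G.Adj] {X : V → Ω → ℝ}

theorem card_nbhd_le (i : V) : ((nbhd G i).card : ℝ) ≤ 2 * max (G.maxDegree : ℝ) 1 := by
  have h : (nbhd G i).card ≤ G.maxDegree + 1 := by
    refine (Finset.card_insert_le _ _).trans ?_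
    rw [G.card_neighborFinset_eq_degree]
    exact Nat.add_le_add_right (G.degree_le_maxDegree i) 1
  have h' : ((nbhd G i).card : ℝ) ≤ G.maxDegree + 1 := by exact_mod_cast h
  linarith [le_max_left (G.maxDegree : ℝ) 1, le_max_right (G.maxDegree : ℝ) 1]

theorem normalizedField_div_sqrt_sigmaSq (hX : ∀ i, Measurable (X i))
    (h3 : ∀ i, Integrable (fun ω => |X i ω| ^ 3) P) (h0 : ∀ i, ∫ ω, X i ω ∂P = 0)
    (hdep : IsDependencyGraph P G X) (hσ : 0 < sigmaSq P G X) {κ : ℝ} (hκ : 0 < κ)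
    (hγ : gamma P G X ≤ κ ^ 3) :
    NormalizedField P G (fun i ω => X i ω / √(sigmaSq P G X)) (2 * max (G.maxDegree : ℝ) 1) κ where
  meas i := (hX i).div_const _
  cube i := by
    simp only [abs_div, div_pow]
    exact (h3 i).div_const _
  mean i := by rw [integral_div, h0 i, zero_div]
  dep := hdep.div_const _
  card_le := card_nbhd_le
  one_le := by linarith [le_max_right (G.maxDegree : ℝ) 1]
  pos := hκ
  sum_cube := hγ
  unit := by
    have hσ2 := Real.sq_sqrt hσ.le
    set c := √(sigmaSq P G X)
    have h : ∀ i ω, X i ω / c * sumY G (fun i ω => X i ω / c) i ω =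
        X i ω * sumY G X i ω / c ^ 2 := fun i ω => by
      rw [sumY_div_const]
      ring
    simp only [h, integral_div, ← Finset.sum_div, hσ2]
    exact div_self hσ.ne'

/-- The cube root of γ is to serve as κ, which must be positive. Were γ ≤ 0, every κ > 0 would be
admissible, and 1 ≤ D ∑ E Xᵢ² ≤ D n^(1/3)κ² would fail for small κ. -/
theorem gamma_pos (hX : ∀ i, Measurable (X i))
    (h3 : ∀ i, Integrable (fun ω => |X i ω| ^ 3) P) (h0 : ∀ i, ∫ ω, X i ω ∂P = 0)
    (hdep : IsDependencyGraph P G X) (hσ : 0 < sigmaSq P G X) : 0 < gamma P G X := by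
  by_contra hγ
  have F := fun (κ : ℝ) (hκ : 0 < κ) => normalizedField_div_sqrt_sigmaSq hX h3 h0 hdep hσ hκ
    ((not_lt.1 hγ).trans (by positivity))
  have hV := (F 1 one_pos).nonempty
  set D := 2 * max (G.maxDegree : ℝ) 1
  have hD := (F 1 one_pos).pos_D
  set m : ℝ := (Fintype.card V : ℝ) ^ (1 / 3 : ℝ) with hm
  have hn : (0 : ℝ) < Fintype.card V := Nat.cast_pos.2 Fintype.card_pos
  have hm0 : 0 < m := Real.rpow_pos_of_pos hn _
  have hm3 : m ^ 3 = Fintype.card V := by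
    rw [hm, ← Real.rpow_natCast, ← Real.rpow_mul hn.le]
    norm_num
  set κ := √(1 / (2 * D * m)) with hκ
  have hκ0 : 0 < κ := Real.sqrt_pos.2 (by positivity)
  have hκ2 : D * (m * κ ^ 2) = 1 / 2 := by
    rw [hκ, Real.sq_sqrt (by positivity)]
    field_simp
  have h1 := (F κ hκ0).one_le_mul_sum_sq
  have h2 := mul_le_mul_of_nonneg_left ((F κ hκ0).sum_integral_sq_le hm0 hm3) hD.le
  linarith

end GraphDep

/-! ### The theorem -/

theorem theorem3p2 :
    ∃ C : ℝ, 0 < C ∧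
      ∀ (V : Type*) [Fintype V] [DecidableEq V] (G : SimpleGraph V) [DecidableRel G.Adj]
        (Ω : Type*) [MeasurableSpace Ω] (P : Measure Ω) [IsProbabilityMeasure P]
        (X : V → Ω → ℝ),
        (∀ i, Measurable (X i)) →
        (∀ i, Integrable (fun ω => |X i ω| ^ 3) P) →
        (∀ i, ∫ ω, X i ω ∂P = 0) →
        GraphDep.IsDependencyGraph P G X →
        0 < GraphDep.sigmaSq P G X →
        ∀ (n d : ℝ), n = (Fintype.card V : ℝ) → d = max (G.maxDegree : ℝ) 1 →
          (⨆ z : ℝ, |P.real {ω | GraphDep.statW G X ω ≤ z} - cdf (gaussianReal 0 1) z|) ≤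
            C * d ^ 9 *
              (1 + d ^ 6 * n ^ (1 / 3 : ℝ) * GraphDep.gamma P G X ^ (2 / 3 : ℝ)) *
              (n ^ (-(1 / 2) : ℝ) + GraphDep.gamma P G X) := by
  refine ⟨2 ^ 31, by norm_num, fun V _ _ G _ Ω _ P _ X hX h3 h0 hdep hσ n d hn hd =>
    ciSup_le fun z => ?_⟩
  have hγ := GraphDep.gamma_pos hX h3 h0 hdep hσ
  set γ := GraphDep.gamma P G X
  have hκ3 : (γ ^ (1 / 3 : ℝ)) ^ 3 = γ := by
    rw [← Real.rpow_natCast, ← Real.rpow_mul hγ.le]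
    norm_num
  have F := GraphDep.normalizedField_div_sqrt_sigmaSq hX h3 h0 hdep hσ
    (Real.rpow_pos_of_pos hγ (1 / 3)) hκ3.ge
  have := F.nonempty
  have hn0 : 0 < n := by
    rw [hn]
    exact Nat.cast_pos.2 Fintype.card_pos
  have hpow : ∀ k : ℕ, (n ^ (1 / 12 : ℝ)) ^ k = n ^ ((k : ℝ) / 12) := fun k => by
    rw [← Real.rpow_natCast, ← Real.rpow_mul hn0.le]
    congr 1
    ring
  -- The twelfth root of n makes both n^(1/3) and n^(-1/2) integer powers of one quantity.
  have h := F.abs_measureReal_statW_sub_le_of_root (d := d) (r := n ^ (1 / 12 : ℝ))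
    (hd ▸ le_max_right _ _) (by rw [hd]) (Real.rpow_pos_of_pos hn0 _)
    (by rw [hpow, ← hn]; norm_num) z
  have e1 : (n ^ (1 / 12 : ℝ)) ^ 4 = n ^ (1 / 3 : ℝ) := by
    rw [hpow]
    norm_num
  have e2 : 1 / (n ^ (1 / 12 : ℝ)) ^ 6 = n ^ (-(1 / 2) : ℝ) := by
    rw [hpow, Real.rpow_neg hn0.le, one_div]
    norm_num
  have e3 : (γ ^ (1 / 3 : ℝ)) ^ 2 = γ ^ (2 / 3 : ℝ) := by
    rw [← Real.rpow_natCast, ← Real.rpow_mul hγ.le]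
    norm_num
  rwa [GraphDep.statW_div_const G X (Real.sqrt_pos.2 hσ), hκ3, e1, e2, e3] at h
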